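/- **Notation.** Let $\eta(\tau)=q^{1/24}\prod_{n\ge1}(1-q^n)$, $q=e^{2\pi i\tau}$, and write $[d]$ for $\eta(d\tau)$. Let $j=E_4^3/\eta^{24}=q^{-1}+744+\cdots$. The integers $N>1$ for which $X_0(N)=\Gamma_0(N)\backslash\mathcal H^*$ has genus zero, i.e. for which $1+\frac{\psi(N)}{12}-\frac{\sigma_\infty(N)}2-\frac{\epsilon_2(N)}4-\frac{\epsilon_3(N)}3=0$ (with $\psi(N)=N\prod_{p\mid N}(1+\frac1p)$ the index of $\Gamma_0(N)$, and $\sigma_\infty,\epsilon_2,\epsilon_3$ the numbers of cusps, quadratic and cubic elliptic points), are the $14$ values below. For each of them the canonical Hauptmodul $t_N$ of $\Gamma_0(N)$ is - $t_2=2^{12}[2]^{24}/[1]^{24}$, $t_3=3^6[3]^{12}/[1]^{12}$, $t_4=2^8[4]^8/[1]^8$, $t_5=5^3[5]^6/[1]^6$, - $t_6=2^33^2[2][6]^5/([1]^5[3])$, $t_7=7^2[7]^4/[1]^4$, $t_8=2^5[2]^2[8]^4/([1]^4[4]^2)$, $t_9=3^3[9]^3/[1]^3$, - $t_{10}=2^2\,5\,[2][10]^3/([1]^3[5])$,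 $t_{12}=2^2\,3\,[2]^2[3][12]^3/([1]^3[4][6]^2)$, $t_{13}=13[13]^2/[1]^2$, - $t_{16}=2^3[2][16]^2/([1]^2[8])$, $t_{18}=2\cdot3\,[2][3][18]^2/([1]^2[6][9])$, $t_{25}=5[25]/[1]$. If $j(\tau)=P(t_M(\tau))/Q(t_M(\tau))$ for all $\tau\in\mathcal H$, with $P,Q\in\mathbb C[t]$ coprime, then $h_M$ is defined near $t=0$ by $$h_M(t)=[P(t)/P(0)]^{-1/12}\;{}_2F_1\!\left(\tfrac1{12},\tfrac5{12};1;12^3Q(t)/P(t)\right).$$ Powers with fractional exponents are principal branches, and $\circ$ denotes composition of functions of $t$. **Theorem.** Let $M,N>1$ be such that $X_0(M)$ and $X_0(NM)$ have genus zero. Then $j$ is a rational function of $t_M$, so that $h_M$ is defined; the pair $(M,N)$ occurs in the table below; and if $u,v,\mathcal M$ are the functions of a row for $(M,N)$, then 1. $t_M(\tau)=u(t_{NM}(\tau))$ and $t_M(N\tau)=v(t_{NM}(\tau))$ for all $\tau\in\mathcal H$; 2. for all $t$ in some neighborhood of $0$ in $\mathbb C$, $\;h_M(u(t))=\mathcal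 M(t)\,h_M(v(t))$. | $M$ | $N$ | $u(t)$ | $v(t)$ | $\mathcal M(t)$ | |---|---|---|---|---| | 2 | 2 | $t(t+16)$ | $\frac{t^2}{t+16}$ | $2(t+16)^{-1/4}$ | | 2 | 3 | $\frac{t(t+8)^3}{t+9}$ | $\frac{t^3(t+8)}{(t+9)^3}$ | $3(t+9)^{-1/2}$ | | 2 | 4 | $t(t+16)\circ t(t+8)$ | $\frac{t^2}{t+16}\circ\frac{t^2}{t+4}$ | $4[(t+4)(t+8)^2]^{-1/4}$ | | 2 | 5 | $\frac{t(t+4)^5}{t+5}$ | $\frac{t^5(t+4)}{(t+5)^5}$ | $5(t+5)^{-1}$ | | 2 | 6 | $\frac{t(t+8)^3}{t+9}\circ t(t+6)$ | $\frac{t^3(t+8)}{(t+9)^3}\circ\frac{t^2}{t+2}$ | $6[(t+2)(t+3)(t+6)^3]^{-1/4}$ | | 2 | 6 | $t(t+16)\circ\frac{t(t+4)^3}{t+3}$ | $\frac{t^2}{t+16}\circ\frac{t^3(t+4)}{(t+3)^3}$ | $6[(t+2)(t+3)(t+6)^3]^{-1/4}$ | | 2 | 8 | $t(t+16)\circ t(t+8)\circ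 t(t+4)$ | $\frac{t^2}{t+16}\circ\frac{t^2}{t+4}\circ\frac{t^2}{t+2}$ | $8[(t+2)(t+4)^4(t^2+4t+8)]^{-1/4}$ | | 2 | 9 | $\frac{t(t+8)^3}{t+9}\circ t(t^2+6t+12)$ | $\frac{t^3(t+8)}{(t+9)^3}\circ\frac{t^3}{t^2+3t+3}$ | $9(t+3)^{-2}$ | | 3 | 2 | $\frac{t(t+9)^2}{t+8}$ | $\frac{t^2(t+9)}{(t+8)^2}$ | $2(t+8)^{-1/3}$ | | 3 | 3 | $t(t^2+9t+27)$ | $\frac{t^3}{t^2+9t+27}$ | $3(t^2+9t+27)^{-1/3}$ | | 3 | 4 | $\frac{t(t+9)^2}{t+8}\circ t(t+6)$ | $\frac{t^2(t+9)}{(t+8)^2}\circ\frac{t^2}{t+2}$ | $4(t+4)^{-1}$ | | 3 | 6 | $t(t^2+9t+27)\circ\frac{t(t+3)^2}{t+2}$ | $\frac{t^3}{t^2+9t+27}\circ\frac{t^2(t+3)}{(t+2)^2}$ | $6\left[\frac{(t^2+3t+3)(t^2+6t+12)^2}{t+2}\right]^{-1/3}$ | | 3 | 6 | $\frac{t(t+9)^2}{t+8}\circ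 t(t^2+6t+12)$ | $\frac{t^2(t+9)}{(t+8)^2}\circ\frac{t^3}{t^2+3t+3}$ | $6\left[\frac{(t^2+3t+3)(t^2+6t+12)^2}{t+2}\right]^{-1/3}$ | | 4 | 2 | $t(t+8)$ | $\frac{t^2}{t+4}$ | $2(t+4)^{-1/2}$ | | 4 | 3 | $\frac{t(t+4)^3}{t+3}$ | $\frac{t^3(t+4)}{(t+3)^3}$ | $3(t+3)^{-1}$ | | 4 | 4 | $t(t+8)\circ t(t+4)$ | $\frac{t^2}{t+4}\circ\frac{t^2}{t+2}$ | $4[(t+2)(t^2+4t+8)]^{-1/2}$ | | 5 | 2 | $\frac{t(t+5)^2}{t+4}$ | $\frac{t^2(t+5)}{(t+4)^2}$ | $2(t+4)^{-1/2}$ | | 5 | 5 | $t(t^4+5t^3+15t^2+25t+25)$ | $\frac{t^5}{t^4+5t^3+15t^2+25t+25}$ | $5[t^4+5t^3+15t^2+25t+25]^{-1/2}$ | | 6 | 2 | $t(t+6)$ | $\frac{t^2}{t+2}$ | $2(t+2)^{-1}$ | | 6 | 3 | $t(t^2+6t+12)$ | $\frac{t^3}{t^2+3t+3}$ | $3(t^2+3t+3)^{-1}$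 | | 8 | 2 | $t(t+4)$ | $\frac{t^2}{t+2}$ | $2(t+2)^{-1}$ | | 9 | 2 | $\frac{t(t+3)^2}{t+2}$ | $\frac{t^2(t+3)}{(t+2)^2}$ | $2(t+2)^{-1}$ | -/

import Mathlib

open scoped Topology UpperHalfPlane

namespace GenusZero

/-! ### The genus of `X₀(N)` -/

/-- `ψ(N) = N ∏_{p ∣ N} (1 + 1/p)`, the index of `Γ₀(N)` in the modular group. -/
def psi (N : ℕ) : ℚ := N * ∏ p ∈ N.primeFactors, (1 + 1 / (p : ℚ))

/-- `σ_∞(N) = ∑_{d ∣ N} φ((d, N/d))`, the number of cusps of `X₀(N)`. -/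
def numCusps (N : ℕ) : ℕ := ∑ d ∈ N.divisors, (Nat.gcd d (N / d)).totient

/-- `ε₂(N)`, the number of quadratic elliptic points of `X₀(N)`; the symbol `(-1/p)` is `χ₄ p`
(it vanishes at `p = 2`). -/
def numEllipticTwo (N : ℕ) : ℤ :=
  if 4 ∣ N then 0 else ∏ p ∈ N.primeFactors, (1 + ZMod.χ₄ (p : ZMod 4))

/-- `ε₃(N)`, the number of cubic elliptic points of `X₀(N)`; the symbol `(-3/p)` equals `(p/3)`
(it vanishes at `p = 3` and is `-1` at `p = 2`). -/
def numEllipticThree (N : ℕ) : ℤ :=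
  if 9 ∣ N then 0 else ∏ p ∈ N.primeFactors, (1 + jacobiSym (p : ℤ) 3)

/-- The genus of `X₀(N) = Γ₀(N) \ ℍ*`, by the Hurwitz formula for the covering
`X₀(N) → X(1)`. -/
def genus (N : ℕ) : ℚ :=
  1 + psi N / 12 - numCusps N / 2 - numEllipticTwo N / 4 - numEllipticThree N / 3

/-! ### The `j`-invariant and the canonical Hauptmoduln -/

/-- `j = E₄³ / Δ = q⁻¹ + 744 + 196884 q + ⋯`, with `Δ = η²⁴` here. -/
noncomputable def j (τ : ℍ) : ℂ := ModularForm.E₄ τ ^ 3 / ModularForm.discriminant τ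

/-- `[d](z) = η(d z)`. -/
noncomputable def etaMul (d : ℕ) (z : ℂ) : ℂ := ModularForm.eta (d * z)

/-- The canonical Hauptmodul `t_N = κ_N ∏_{d ∣ N} η(d z)^{r_d}` of `Γ₀(N)`, for the `N > 1` with
`Γ₀(N)` of genus zero: it has a simple zero at the cusp `i∞`, a simple pole at the cusp `0`, and
`t_N(-1/(N z)) = q⁻¹ + O(1)`. (For all other `N` it is set to zero and never used.) -/
noncomputable def hauptmodul : ℕ → ℂ → ℂ
  | 2, z => 2 ^ 12 * etaMul 2 z ^ 24 / etaMul 1 z ^ 24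
  | 3, z => 3 ^ 6 * etaMul 3 z ^ 12 / etaMul 1 z ^ 12
  | 4, z => 2 ^ 8 * etaMul 4 z ^ 8 / etaMul 1 z ^ 8
  | 5, z => 5 ^ 3 * etaMul 5 z ^ 6 / etaMul 1 z ^ 6
  | 6, z => 2 ^ 3 * 3 ^ 2 * (etaMul 2 z * etaMul 6 z ^ 5) / (etaMul 1 z ^ 5 * etaMul 3 z)
  | 7, z => 7 ^ 2 * etaMul 7 z ^ 4 / etaMul 1 z ^ 4
  | 8, z => 2 ^ 5 * (etaMul 2 z ^ 2 * etaMul 8 z ^ 4) / (etaMul 1 z ^ 4 * etaMul 4 z ^ 2)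
  | 9, z => 3 ^ 3 * etaMul 9 z ^ 3 / etaMul 1 z ^ 3
  | 10, z => 2 ^ 2 * 5 * (etaMul 2 z * etaMul 10 z ^ 3) / (etaMul 1 z ^ 3 * etaMul 5 z)
  | 12, z => 2 ^ 2 * 3 * (etaMul 2 z ^ 2 * etaMul 3 z * etaMul 12 z ^ 3) /
      (etaMul 1 z ^ 3 * etaMul 4 z * etaMul 6 z ^ 2)
  | 13, z => 13 * etaMul 13 z ^ 2 / etaMul 1 z ^ 2
  | 16, z => 2 ^ 3 * (etaMul 2 z * etaMul 16 z ^ 2) / (etaMul 1 z ^ 2 * etaMul 8 z)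
  | 18, z => 2 * 3 * (etaMul 2 z * etaMul 3 z * etaMul 18 z ^ 2) /
      (etaMul 1 z ^ 2 * etaMul 6 z * etaMul 9 z)
  | 25, z => 5 * etaMul 25 z / etaMul 1 z
  | _, _ => 0

/-! ### The functions `h_M` -/

/-- `j = P(t_M) / Q(t_M)` on the upper half plane, in lowest terms. By coprimality `Q(t_M(τ))` cannot
vanish, and `(P, Q)` is determined up to a common nonzero constant factor. -/
def IsCovering (M : ℕ) (P Q : Polynomial ℂ) : Prop :=
  IsCoprime P Q ∧ ∀ τ : ℍ, j τ * Q.eval (hauptmodul M τ) = P.eval (hauptmodul M τ)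

/-- The function `t ↦ [P(t)/P(0)]^{-1/12} ₂F₁(1/12, 5/12; 1; 12³ Q(t)/P(t))`, considered near
`t = 0` (principal branch of the power, equal to `1` at `t = 0`). If `j = P(t_M) / Q(t_M)` in
lowest terms then this is `h_M`; it is unchanged if `(P, Q)` is replaced by `(c P, c Q)`. -/
noncomputable def hFun (P Q : Polynomial ℂ) (t : ℂ) : ℂ :=
  (P.eval t / P.eval 0) ^ (-1 / 12 : ℂ) *
    ordinaryHypergeometric (1 / 12 : ℂ) (5 / 12 : ℂ) (1 : ℂ) (12 ^ 3 * Q.eval t / P.eval t)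

/-! ### The table of modular equations -/

/-- `TableRow M N u v m` says that the table of modular equations has the row
`h_M(u(t)) = m(t) h_M(v(t))` at level `M`, of degree `N`. Here `t` stands for `t_{NM}`, `u` for the
map `t_{NM} ↦ t_M` and `v` for the map `t_{NM} ↦ t'_M`; powers are principal ones. When `u` and `v`
have two decompositions, there is a row for each of them. -/
inductive TableRow : ℕ → ℕ → (ℂ → ℂ) → (ℂ → ℂ) → (ℂ → ℂ) → Prop
  | r2_2 : TableRow 2 2
      (fun t => t * (t + 16))
      (fun t => t ^ 2 / (t + 16))
      (fun t => 2 * (t + 16) ^ (-1 / 4 : ℂ))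
  | r2_3 : TableRow 2 3
      (fun t => t * (t + 8) ^ 3 / (t + 9))
      (fun t => t ^ 3 * (t + 8) / (t + 9) ^ 3)
      (fun t => 3 * (t + 9) ^ (-1 / 2 : ℂ))
  | r2_4 : TableRow 2 4
      ((fun t => t * (t + 16)) ∘ (fun t => t * (t + 8)))
      ((fun t => t ^ 2 / (t + 16)) ∘ (fun t => t ^ 2 / (t + 4)))
      (fun t => 4 * ((t + 4) * (t + 8) ^ 2) ^ (-1 / 4 : ℂ))
  | r2_5 : TableRow 2 5
      (fun t => t * (t + 4) ^ 5 / (t + 5))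
      (fun t => t ^ 5 * (t + 4) / (t + 5) ^ 5)
      (fun t => 5 * (t + 5)⁻¹)
  | r2_6 : TableRow 2 6
      ((fun t => t * (t + 8) ^ 3 / (t + 9)) ∘ (fun t => t * (t + 6)))
      ((fun t => t ^ 3 * (t + 8) / (t + 9) ^ 3) ∘ (fun t => t ^ 2 / (t + 2)))
      (fun t => 6 * ((t + 2) * (t + 3) * (t + 6) ^ 3) ^ (-1 / 4 : ℂ))
  | r2_6' : TableRow 2 6
      ((fun t => t * (t + 16)) ∘ (fun t => t * (t + 4) ^ 3 / (t + 3)))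
      ((fun t => t ^ 2 / (t + 16)) ∘ (fun t => t ^ 3 * (t + 4) / (t + 3) ^ 3))
      (fun t => 6 * ((t + 2) * (t + 3) * (t + 6) ^ 3) ^ (-1 / 4 : ℂ))
  | r2_8 : TableRow 2 8
      ((fun t => t * (t + 16)) ∘ (fun t => t * (t + 8)) ∘ (fun t => t * (t + 4)))
      ((fun t => t ^ 2 / (t + 16)) ∘ (fun t => t ^ 2 / (t + 4)) ∘ (fun t => t ^ 2 / (t + 2)))
      (fun t => 8 * ((t + 2) * (t + 4) ^ 4 * (t ^ 2 + 4 * t + 8)) ^ (-1 / 4 : ℂ))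
  | r2_9 : TableRow 2 9
      ((fun t => t * (t + 8) ^ 3 / (t + 9)) ∘ (fun t => t * (t ^ 2 + 6 * t + 12)))
      ((fun t => t ^ 3 * (t + 8) / (t + 9) ^ 3) ∘ (fun t => t ^ 3 / (t ^ 2 + 3 * t + 3)))
      (fun t => 9 * ((t + 3) ^ 2)⁻¹)
  | r3_2 : TableRow 3 2
      (fun t => t * (t + 9) ^ 2 / (t + 8))
      (fun t => t ^ 2 * (t + 9) / (t + 8) ^ 2)
      (fun t => 2 * (t + 8) ^ (-1 / 3 : ℂ))
  | r3_3 : TableRow 3 3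
      (fun t => t * (t ^ 2 + 9 * t + 27))
      (fun t => t ^ 3 / (t ^ 2 + 9 * t + 27))
      (fun t => 3 * (t ^ 2 + 9 * t + 27) ^ (-1 / 3 : ℂ))
  | r3_4 : TableRow 3 4
      ((fun t => t * (t + 9) ^ 2 / (t + 8)) ∘ (fun t => t * (t + 6)))
      ((fun t => t ^ 2 * (t + 9) / (t + 8) ^ 2) ∘ (fun t => t ^ 2 / (t + 2)))
      (fun t => 4 * (t + 4)⁻¹)
  | r3_6 : TableRow 3 6
      ((fun t => t * (t ^ 2 + 9 * t + 27)) ∘ (fun t => t * (t + 3) ^ 2 / (t + 2)))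
      ((fun t => t ^ 3 / (t ^ 2 + 9 * t + 27)) ∘ (fun t => t ^ 2 * (t + 3) / (t + 2) ^ 2))
      (fun t => 6 * ((t ^ 2 + 3 * t + 3) * (t ^ 2 + 6 * t + 12) ^ 2 / (t + 2)) ^ (-1 / 3 : ℂ))
  | r3_6' : TableRow 3 6
      ((fun t => t * (t + 9) ^ 2 / (t + 8)) ∘ (fun t => t * (t ^ 2 + 6 * t + 12)))
      ((fun t => t ^ 2 * (t + 9) / (t + 8) ^ 2) ∘ (fun t => t ^ 3 / (t ^ 2 + 3 * t + 3)))
      (fun t => 6 * ((t ^ 2 + 3 * t + 3) * (t ^ 2 + 6 * t + 12) ^ 2 / (t + 2)) ^ (-1 / 3 : ℂ))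
  | r4_2 : TableRow 4 2
      (fun t => t * (t + 8))
      (fun t => t ^ 2 / (t + 4))
      (fun t => 2 * (t + 4) ^ (-1 / 2 : ℂ))
  | r4_3 : TableRow 4 3
      (fun t => t * (t + 4) ^ 3 / (t + 3))
      (fun t => t ^ 3 * (t + 4) / (t + 3) ^ 3)
      (fun t => 3 * (t + 3)⁻¹)
  | r4_4 : TableRow 4 4
      ((fun t => t * (t + 8)) ∘ (fun t => t * (t + 4)))
      ((fun t => t ^ 2 / (t + 4)) ∘ (fun t => t ^ 2 / (t + 2)))
      (fun t => 4 * ((t + 2) * (t ^ 2 + 4 * t + 8)) ^ (-1 / 2 : ℂ))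
  | r5_2 : TableRow 5 2
      (fun t => t * (t + 5) ^ 2 / (t + 4))
      (fun t => t ^ 2 * (t + 5) / (t + 4) ^ 2)
      (fun t => 2 * (t + 4) ^ (-1 / 2 : ℂ))
  | r5_5 : TableRow 5 5
      (fun t => t * (t ^ 4 + 5 * t ^ 3 + 15 * t ^ 2 + 25 * t + 25))
      (fun t => t ^ 5 / (t ^ 4 + 5 * t ^ 3 + 15 * t ^ 2 + 25 * t + 25))
      (fun t => 5 * (t ^ 4 + 5 * t ^ 3 + 15 * t ^ 2 + 25 * t + 25) ^ (-1 / 2 : ℂ))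
  | r6_2 : TableRow 6 2
      (fun t => t * (t + 6))
      (fun t => t ^ 2 / (t + 2))
      (fun t => 2 * (t + 2)⁻¹)
  | r6_3 : TableRow 6 3
      (fun t => t * (t ^ 2 + 6 * t + 12))
      (fun t => t ^ 3 / (t ^ 2 + 3 * t + 3))
      (fun t => 3 * (t ^ 2 + 3 * t + 3)⁻¹)
  | r8_2 : TableRow 8 2
      (fun t => t * (t + 4))
      (fun t => t ^ 2 / (t + 2))
      (fun t => 2 * (t + 2)⁻¹)
  | r9_2 : TableRow 9 2
      (fun t => t * (t + 3) ^ 2 / (t + 2))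
      (fun t => t ^ 2 * (t + 3) / (t + 2) ^ 2)
      (fun t => 2 * (t + 2)⁻¹)

end GenusZero

/-! ### The hypergeometric function and its differential equation -/

namespace GenusZero

open Filter

/-! A modular equation for `h_M` compares `hyp` at `1728 / j(τ)` with `hyp` at `1728 / j(Nτ)`. For
`p = 2, 3, 5` both `j(τ)` and `j(pτ)` are rational in `t = t_p(τ)`. After multiplication by suitable
algebraic factors, the two pullbacks of the hypergeometric equation become one and the same equation
`θ²f = p θf + s f`, where `θ = t d/dt` and the coefficients `p`, `s` vanish at `0`. Its indicial
polynomial there is `n²`, so an analytic solution is determined by its value at `0`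
(`eq_of_eulerD_eq`), and the two pullbacks agree. The resulting identities `hyp_transform_two`,
`hyp_transform_three` and `hyp_transform_five` are the only analytic facts about `hyp` that relate
different arguments.

The other modular equations follow by substitution. Twelfth powers are free of branches. The maps
`u`, `v` of prime degree satisfy commutation relations, because two routes between modular curves
give the same function, and the composite rows are chains of prime ones. The twelfth root is taken
at the end, by continuity, both sides being `1` at `t = 0` (`eventually_eq_of_pow_twelve`). Since
`t_M` takes infinitely many values, coprime `P`, `Q` are unique up to a constant, so one explicit
pair per level is enough (`IsCovering.hFun_eq`).

The relations between the Hauptmoduln rest on one principle: a holomorphic `Γ₀(L)`-invariant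
function that is bounded at the cusps other than `0` and vanishes at `0` is zero
(`eq_zero_of_gamma0`). Invariance of eta quotients comes from the transformation law of `η²`
(`eta_smul_sq`), their growth at the cusps from the order formula
(`isBoundedAtImInfty_etaQuot_smul`), and their behaviour at the cusp `0` from the Fricke involution,
which turns an eta quotient into another one whose `q`-expansion is computed with lists of integers.
As only `η²` is controlled, some quotients are known to be invariant only up to sign; an identity is
then multiplied by its conjugates under the sign changes before the principle is applied
(`HasFrickeExp.eq_zero`). Six identities between eta quotients and `j t_2 = (t_2 + 16)³` are proved
in this way; the rest is Fricke duality and algebra.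

For the classification, each of the two elliptic point counts is at most the number `σ` of cusps, so
genus zero forces `ψ < 13 σ`. Together with `σ² n ≤ ψ²` this gives `n < 169`, which leaves a finite
check (`genus_eq_zero`). -/

theorem mem_eball_zero_one_iff {z : ℂ} : z ∈ Metric.eball (0 : ℂ) 1 ↔ ‖z‖ < 1 := by
  rw [Metric.mem_eball, edist_zero_right, ← ofReal_norm, ENNReal.ofReal_lt_one]

/-- Termwise differentiation on the unit disc, phrased through coefficients so that it can be
iterated in `hyp_ode`. -/
theorem hasSum_deriv_of_hasSum {c : ℕ → ℂ} {f : ℂ → ℂ}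
    (h : ∀ z : ℂ, ‖z‖ < 1 → HasSum (fun n => c n * z ^ n) (f z)) {z : ℂ} (hz : ‖z‖ < 1) :
    HasSum (fun n : ℕ => ((n : ℂ) + 1) * c (n + 1) * z ^ n) (deriv f z) := by
  have hp : HasFPowerSeriesOnBall f (FormalMultilinearSeries.ofScalars ℂ c) 0 1 := by
    refine ⟨?_, by simp, ?_⟩
    · refine ENNReal.le_of_forall_nnreal_lt fun r hr => ?_
      have hr1 : (r : ℝ) < 1 := by exact_mod_cast hr
      refine FormalMultilinearSeries.le_radius_of_tendsto _ (l := 0) ?_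
      have := (h (r : ℂ) (by simpa using hr1)).summable.tendsto_atTop_zero.norm
      simpa [FormalMultilinearSeries.ofScalars_norm] using this
    · intro y hy
      have hy' : ‖y‖ < 1 := mem_eball_zero_one_iff.1 hy
      simpa [FormalMultilinearSeries.ofScalars_apply_eq, smul_eq_mul, mul_comm] using h y hy'
  have hd := hp.fderiv.hasSum (y := z) (mem_eball_zero_one_iff.2 hz)
  have hd' := hd.mapL (ContinuousLinearMap.apply ℂ ℂ (1 : ℂ))
  simp only [zero_add] at hd'
  have e : (fun n : ℕ => ((n : ℂ) + 1) * c (n + 1) * z ^ n) = fun b =>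
      ((ContinuousLinearMap.apply ℂ ℂ) 1)
        (((FormalMultilinearSeries.ofScalars ℂ c).derivSeries b) fun _ => z) := by
    funext n
    rw [ContinuousLinearMap.apply_apply, FormalMultilinearSeries.apply_eq_pow_smul_coeff,
      _root_.smul_apply, FormalMultilinearSeries.derivSeries_coeff_one,
      FormalMultilinearSeries.coeff_ofScalars]
    simp [smul_eq_mul]; ring
  rw [e]
  exact hd'

/-- Multiplication by `z` brings a differentiated series back to the powers `z ^ n` with factor `n`,
so that all terms of the equation can be compared coefficientwise. -/
theorem hasSum_shift {b : ℕ → ℂ} {z S : ℂ}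
    (h : HasSum (fun n : ℕ => ((n : ℂ) + 1) * b (n + 1) * z ^ n) S) :
    HasSum (fun n : ℕ => (n : ℂ) * b n * z ^ n) (z * S) := by
  rw [← hasSum_nat_add_iff' 1]
  have := h.mul_left z
  simp only [Finset.range_one, Finset.sum_singleton, Nat.cast_zero, zero_mul, sub_zero]
  have e : ∀ n : ℕ, ((n + 1 : ℕ) : ℂ) * b (n + 1) * z ^ (n + 1)
      = z * (((n : ℂ) + 1) * b (n + 1) * z ^ n) := fun n => by push_cast; ring
  simpa only [e] using this

/-- `₂F₁(1/12, 5/12; 1; z)`. -/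
noncomputable def hyp (z : ℂ) : ℂ := ordinaryHypergeometric (1 / 12 : ℂ) (5 / 12 : ℂ) (1 : ℂ) z

theorem hyp_zero : hyp 0 = 1 := by simp [hyp]

/-- The Taylor coefficients of `hyp`. -/
noncomputable abbrev hypCoeff (n : ℕ) : ℂ :=
  ordinaryHypergeometricCoefficient (1 / 12 : ℂ) (5 / 12 : ℂ) (1 : ℂ) n

/-- The hypergeometric equation on the level of coefficients. The square comes from the lower
parameter `1`. -/
theorem hypCoeff_succ (n : ℕ) :
    ((n : ℂ) + 1) ^ 2 * hypCoeff (n + 1) = (n + 1 / 12) * (n + 5 / 12) * hypCoeff n := by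
  have h1 : (n.factorial : ℂ) ≠ 0 := by exact_mod_cast n.factorial_ne_zero
  have h2 : (n : ℂ) + 1 ≠ 0 := by exact_mod_cast n.succ_ne_zero
  simp only [hypCoeff, ordinaryHypergeometricCoefficient, ascPochhammer_succ_eval,
    ascPochhammer_eval_one, Nat.factorial_succ, Nat.cast_mul, Nat.cast_succ]
  have h3 : (1 : ℂ) + n ≠ 0 := by rwa [add_comm]
  field_simp
  ring

theorem hasFPowerSeriesOnBall_hyp : HasFPowerSeriesOnBall hyp
    (ordinaryHypergeometricSeries ℂ (1 / 12 : ℂ) (5 / 12 : ℂ) (1 : ℂ)) 0 1 := by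
  have hr : (ordinaryHypergeometricSeries ℂ (1 / 12 : ℂ) (5 / 12 : ℂ) (1 : ℂ)).radius = 1 := by
    apply ordinaryHypergeometricSeries_radius_eq_one
    intro k
    refine ⟨fun h => ?_, fun h => ?_, fun h => ?_⟩ <;>
    · have := congrArg Complex.re h
      norm_num at this
      have hk : (0 : ℝ) ≤ k := k.cast_nonneg
      linarith
  have := FormalMultilinearSeries.hasFPowerSeriesOnBall
    (ordinaryHypergeometricSeries ℂ (1 / 12 : ℂ) (5 / 12 : ℂ) (1 : ℂ)) (by rw [hr]; simp)
  rwa [hr] at this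

theorem hasSum_hyp (z : ℂ) (hz : ‖z‖ < 1) : HasSum (fun n => hypCoeff n * z ^ n) (hyp z) := by
  have := hasFPowerSeriesOnBall_hyp.hasSum (y := z) (mem_eball_zero_one_iff.2 hz)
  simp only [ordinaryHypergeometricSeries, FormalMultilinearSeries.ofScalars_apply_eq,
    smul_eq_mul, zero_add] at this
  exact this

theorem analyticAt_hyp {z : ℂ} (hz : ‖z‖ < 1) : AnalyticAt ℂ hyp z :=
  hasFPowerSeriesOnBall_hyp.analyticAt_of_mem (mem_eball_zero_one_iff.2 hz)

theorem hyp_ode {z : ℂ} (hz : ‖z‖ < 1) :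
    z * (1 - z) * deriv (deriv hyp) z + (1 - 3 / 2 * z) * deriv hyp z = 5 / 144 * hyp z := by
  have h0 := hasSum_hyp z hz
  have h1 := hasSum_deriv_of_hasSum hasSum_hyp hz
  have h2 := hasSum_deriv_of_hasSum (c := fun n : ℕ => ((n : ℂ) + 1) * hypCoeff (n + 1))
    (fun w hw => hasSum_deriv_of_hasSum hasSum_hyp hw) hz
  have h3 := hasSum_shift (b := hypCoeff) h1
  have h4 := hasSum_shift (b := fun n : ℕ => ((n : ℂ) + 1) * hypCoeff (n + 1)) h2
  -- Two shifts produce the factor `n (n - 1)` of `z² F''`.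
  have h5 : HasSum (fun n : ℕ => (n : ℂ) * ((n : ℂ) - 1) * hypCoeff n * z ^ n)
      (z * (z * deriv (deriv hyp) z)) := by
    have : HasSum (fun n : ℕ => ((n : ℂ) + 1) * (((n + 1 : ℕ) : ℂ) - 1) * hypCoeff (n + 1) * z ^ n)
        (z * deriv (deriv hyp) z) := by
      convert h4 using 2 with n
      push_cast; ring
    have := hasSum_shift (b := fun n : ℕ => ((n : ℂ) - 1) * hypCoeff n) (S := z * deriv (deriv hyp) z)
      (by convert this using 2; ring)
    convert this using 2; ring
  have key := (((h4.sub h5).add h1).sub (h3.mul_left (3 / 2))).sub (h0.mul_left (5 / 144))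
  -- The coefficient of `z ^ n` in the equation vanishes by the recurrence; `3/2 = 1/12 + 5/12 + 1`
  -- and `5/144 = 1/12 · 5/12`.
  have hz : ∀ n : ℕ, (n : ℂ) * (((n : ℂ) + 1) * hypCoeff (n + 1)) * z ^ n
      - n * (n - 1) * hypCoeff n * z ^ n + (n + 1) * hypCoeff (n + 1) * z ^ n
      - 3 / 2 * (n * hypCoeff n * z ^ n) - 5 / 144 * (hypCoeff n * z ^ n) = 0 := by
    intro n
    linear_combination z ^ n * hypCoeff_succ n
  have := key.unique (by simpa only [hz] using hasSum_zero)
  linear_combination this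

/-! ### Uniqueness at a regular singular point -/

/-- The Euler derivation `t d/dt`. -/
noncomputable def eulerD (f : ℂ → ℂ) (t : ℂ) : ℂ := t * deriv f t

theorem analyticAt_eulerD {f : ℂ → ℂ} {t : ℂ} (h : AnalyticAt ℂ f t) :
    AnalyticAt ℂ (eulerD f) t := analyticAt_id.mul h.deriv

theorem eulerD_congr {f g : ℂ → ℂ} {t : ℂ} (h : f =ᶠ[𝓝 t] g) : eulerD f =ᶠ[𝓝 t] eulerD g := by
  filter_upwards [h.deriv] with x hx
  simp [eulerD, hx]

/-- Conjugation by `t ^ n` turns `θ` into `θ + n`, which makes the indicial polynomial visible. -/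
theorem eulerD_pow_mul {e : ℂ → ℂ} (he : AnalyticAt ℂ e 0) (n : ℕ) :
    eulerD (fun t => t ^ n * e t) =ᶠ[𝓝 0] fun t => t ^ n * (n * e t + eulerD e t) := by
  filter_upwards [he.eventually_analyticAt] with t ht
  rw [eulerD, deriv_fun_mul (by fun_prop) ht.differentiableAt, eulerD]
  rcases n with _ | n
  · simp
  · simp; ring

/-- Otherwise `g = t ^ n e` with `e 0 ≠ 0`. Dividing the equation by `t ^ n` and letting `t → 0`
removes the terms with `p` and `s` and leaves `n² e(0) = 0`, whereas `g 0 = 0` forces `n ≠ 0`. -/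
theorem eq_zero_of_eulerD_eq {g p s : ℂ → ℂ} (hg : AnalyticAt ℂ g 0)
    (hp : Tendsto p (𝓝[≠] 0) (𝓝 0)) (hs : Tendsto s (𝓝[≠] 0) (𝓝 0))
    (hode : ∀ᶠ t in 𝓝[≠] 0, eulerD (eulerD g) t = p t * eulerD g t + s t * g t) (h0 : g 0 = 0) :
    ∀ᶠ t in 𝓝 0, g t = 0 := by
  rcases hg.eventually_eq_zero_or_eventually_ne_zero with h | h
  · exact h
  exfalso
  obtain ⟨n, e, he, hne, hev⟩ := hg.exists_eventuallyEq_pow_smul_nonzero_iff.mpr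
    (fun h' => by
      obtain ⟨t, ht⟩ := ((h'.filter_mono nhdsWithin_le_nhds).and h).exists
      exact ht.2 ht.1)
  simp only [sub_zero, smul_eq_mul] at hev
  have hn : n ≠ 0 := by
    rintro rfl
    apply hne
    simpa [h0] using hev.self_of_nhds.symm
  have e1 := (eulerD_congr hev).trans (eulerD_pow_mul he n)
  have he1 : AnalyticAt ℂ (fun t => n * e t + eulerD e t) 0 :=
    (analyticAt_const.mul he).add (analyticAt_eulerD he)
  have e2 := (eulerD_congr e1).trans (eulerD_pow_mul he1 n)
  have he2 : AnalyticAt ℂ (fun t => n * (n * e t + eulerD e t)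
      + eulerD (fun t => n * e t + eulerD e t) t) 0 :=
    (analyticAt_const.mul he1).add (analyticAt_eulerD he1)
  have hcong : ∀ᶠ t in 𝓝[≠] (0 : ℂ), n * (n * e t + eulerD e t)
      + eulerD (fun t => n * e t + eulerD e t) t = p t * (n * e t + eulerD e t) + s t * e t := by
    filter_upwards [hode, hev.filter_mono nhdsWithin_le_nhds,
      e1.filter_mono nhdsWithin_le_nhds, e2.filter_mono nhdsWithin_le_nhds,
      self_mem_nhdsWithin] with t h1 h2 h3 h4 h5
    have h5' : t ^ n ≠ 0 := pow_ne_zero _ h5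
    rw [h4, h3, h2] at h1
    apply mul_left_cancel₀ h5'
    rw [h1]; ring
  have l1 := he2.continuousAt.tendsto.mono_left (nhdsWithin_le_nhds (s := {0}ᶜ))
  have l2 := (hp.mul (he1.continuousAt.tendsto.mono_left (nhdsWithin_le_nhds (s := {0}ᶜ)))).add
    (hs.mul (he.continuousAt.tendsto.mono_left (nhdsWithin_le_nhds (s := {0}ᶜ))))
  have := tendsto_nhds_unique (l1.congr' hcong) l2
  simp [eulerD, hn, hne] at this

theorem eq_of_eulerD_eq {g₁ g₂ p s : ℂ → ℂ} (h₁ : AnalyticAt ℂ g₁ 0) (h₂ : AnalyticAt ℂ g₂ 0)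
    (hp : Tendsto p (𝓝[≠] 0) (𝓝 0)) (hs : Tendsto s (𝓝[≠] 0) (𝓝 0))
    (hode₁ : ∀ᶠ t in 𝓝[≠] 0, eulerD (eulerD g₁) t = p t * eulerD g₁ t + s t * g₁ t)
    (hode₂ : ∀ᶠ t in 𝓝[≠] 0, eulerD (eulerD g₂) t = p t * eulerD g₂ t + s t * g₂ t)
    (h0 : g₁ 0 = g₂ 0) : ∀ᶠ t in 𝓝 0, g₁ t = g₂ t := by
  have hsub : eulerD (fun t => g₁ t - g₂ t) =ᶠ[𝓝 0] fun t => eulerD g₁ t - eulerD g₂ t := by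
    filter_upwards [h₁.eventually_analyticAt, h₂.eventually_analyticAt] with t a b
    rw [eulerD, deriv_fun_sub a.differentiableAt b.differentiableAt, eulerD, eulerD]; ring
  have hsub2 : eulerD (eulerD (fun t => g₁ t - g₂ t)) =ᶠ[𝓝 0]
      fun t => eulerD (eulerD g₁) t - eulerD (eulerD g₂) t := by
    refine (eulerD_congr hsub).trans ?_
    filter_upwards [(analyticAt_eulerD h₁).eventually_analyticAt,
      (analyticAt_eulerD h₂).eventually_analyticAt] with t a b
    rw [eulerD, deriv_fun_sub a.differentiableAt b.differentiableAt, eulerD, eulerD]; ring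
  have := eq_zero_of_eulerD_eq (g := fun t => g₁ t - g₂ t) (h₁.sub h₂) hp hs (by
    filter_upwards [hode₁, hode₂, hsub.filter_mono nhdsWithin_le_nhds,
      hsub2.filter_mono nhdsWithin_le_nhds] with t a b c d
    rw [d, c, a, b]; ring) (by simp [h0])
  filter_upwards [this] with t ht using sub_eq_zero.mp ht

end GenusZero

/-! ### Pullbacks of the hypergeometric equation -/

namespace GenusZero

open Filter

theorem eulerD_mul {f g : ℂ → ℂ} {t : ℂ} (hf : DifferentiableAt ℂ f t)
    (hg : DifferentiableAt ℂ g t) :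
    eulerD (fun x => f x * g x) t = eulerD f t * g t + f t * eulerD g t := by
  simp only [eulerD, deriv_fun_mul hf hg]; ring

theorem eulerD_add {f g : ℂ → ℂ} {t : ℂ} (hf : DifferentiableAt ℂ f t)
    (hg : DifferentiableAt ℂ g t) :
    eulerD (fun x => f x + g x) t = eulerD f t + eulerD g t := by
  simp only [eulerD, deriv_fun_add hf hg]; ring

theorem eulerD_hyp_comp {R : ℂ → ℂ} {t r : ℂ} (hR : DifferentiableAt ℂ R t)
    (hn : ‖R t‖ < 1) (hr : eulerD R t = r * R t) :
    eulerD (fun x => hyp (R x)) t = r * eulerD hyp (R t) := by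
  have h1 : HasDerivAt (fun x => hyp (R x)) (deriv hyp (R t) * deriv R t) t :=
    (analyticAt_hyp hn).differentiableAt.hasDerivAt.comp t hR.hasDerivAt
  rw [eulerD, h1.deriv, eulerD]
  rw [eulerD] at hr
  linear_combination deriv hyp (R t) * hr

/-- In terms of `θ` the hypergeometric equation is `(1 - z) θ²F = z (θF / 2 + 5/144 F)`. Here `k`
stands for `z / (1 - z)` at `z = R t`, and the chain rule contributes `r`. -/
theorem eulerD_eulerD_hyp_comp {R : ℂ → ℂ} {t r k : ℂ} (hR : DifferentiableAt ℂ R t)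
    (hn : ‖R t‖ < 1) (hr : eulerD R t = r * R t) (hk : k * (1 - R t) = R t) :
    eulerD (fun x => eulerD hyp (R x)) t =
      r * k * (eulerD hyp (R t) / 2 + 5 / 144 * hyp (R t)) := by
  have ha := analyticAt_hyp hn
  have h1 : HasDerivAt (fun x => eulerD hyp (R x)) (deriv (eulerD hyp) (R t) * deriv R t) t :=
    (analyticAt_eulerD ha).differentiableAt.hasDerivAt.comp t hR.hasDerivAt
  have h2 : deriv (eulerD hyp) (R t) = deriv hyp (R t) + R t * deriv (deriv hyp) (R t) := by
    have := ((hasDerivAt_id (R t)).mul ha.deriv.differentiableAt.hasDerivAt).deriv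
    simpa [eulerD, Function.comp_def] using! this
  have h3 := hyp_ode hn
  have hR1 : 1 - R t ≠ 0 := by
    intro h
    have : R t = 1 := by linear_combination -h
    simp [this] at hn
  rw [eulerD, h1.deriv, h2, eulerD]
  rw [eulerD] at hr
  apply mul_left_cancel₀ hR1
  linear_combination (1 - R t) * (deriv hyp (R t) + R t * deriv (deriv hyp) (R t)) * hr
    + r * R t * h3 - r * (R t * deriv hyp (R t) / 2 + 5 / 144 * hyp (R t)) * hk

/-- If `θR = rR` and `θA = αA` for `θ = t d/dt`, then `A · (hyp ∘ R)` satisfies a second order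
equation with coefficients given by `r` and `α`. -/
theorem pullback_ode {R A r α p s k : ℂ → ℂ} (hR : AnalyticAt ℂ R 0) (hR0 : R 0 = 0)
    (hA : AnalyticAt ℂ A 0) (hr : AnalyticAt ℂ r 0) (hα : AnalyticAt ℂ α 0)
    (hRr : ∀ᶠ t in 𝓝 0, eulerD R t = r t * R t) (hAα : ∀ᶠ t in 𝓝 0, eulerD A t = α t * A t)
    (hk : ∀ᶠ t in 𝓝 0, k t * (1 - R t) = R t)
    (hp : ∀ᶠ t in 𝓝 0, 2 * α t * r t + eulerD r t + r t ^ 2 * k t / 2 = p t * r t)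
    (hs : ∀ᶠ t in 𝓝 0, eulerD α t + α t ^ 2 + 5 / 144 * r t ^ 2 * k t = p t * α t + s t) :
    AnalyticAt ℂ (fun t => A t * hyp (R t)) 0 ∧
    ∀ᶠ t in 𝓝 0, eulerD (eulerD fun t => A t * hyp (R t)) t =
      p t * eulerD (fun t => A t * hyp (R t)) t + s t * (A t * hyp (R t)) := by
  have hn : ∀ᶠ t in 𝓝 0, ‖R t‖ < 1 :=
    hR.continuousAt.norm.eventually_lt continuousAt_const (by simp [hR0])
  have hF : AnalyticAt ℂ (fun t => hyp (R t)) 0 :=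
    (analyticAt_hyp (by simp [hR0])).fun_comp_of_eq hR rfl
  have hG : AnalyticAt ℂ (fun t => eulerD hyp (R t)) 0 :=
    (analyticAt_eulerD (analyticAt_hyp (by simp [hR0]))).fun_comp_of_eq hR rfl
  refine ⟨hA.mul hF, ?_⟩
  have e1 : eulerD (fun t => A t * hyp (R t)) =ᶠ[𝓝 0]
      fun t => α t * (A t * hyp (R t)) + r t * (A t * eulerD hyp (R t)) := by
    filter_upwards [hn, hRr, hAα, hR.eventually_analyticAt, hA.eventually_analyticAt,
      hF.eventually_analyticAt] with t h1 h2 h3 h4 h5 h6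
    rw [eulerD_mul h5.differentiableAt h6.differentiableAt, h3,
      eulerD_hyp_comp h4.differentiableAt h1 h2]
    ring
  filter_upwards [eulerD_congr e1, e1, hn, hRr, hAα, hk, hp, hs, hR.eventually_analyticAt,
    hA.eventually_analyticAt, hF.eventually_analyticAt, hG.eventually_analyticAt,
    hr.eventually_analyticAt, hα.eventually_analyticAt]
    with t g1 g2 h1 h2 h3 h4 h5 h6 a1 a2 a3 a4 a5 a6
  have b1 := eulerD_mul a2.differentiableAt a3.differentiableAt
  have b2 := eulerD_mul a2.differentiableAt a4.differentiableAt
  have d1 : DifferentiableAt ℂ (fun t => A t * hyp (R t)) t := (a2.mul a3).differentiableAt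
  have d2 : DifferentiableAt ℂ (fun t => A t * eulerD hyp (R t)) t := (a2.mul a4).differentiableAt
  rw [g1, g2, eulerD_add (a6.differentiableAt.fun_mul d1) (a5.differentiableAt.fun_mul d2),
    eulerD_mul a6.differentiableAt d1, eulerD_mul a5.differentiableAt d2, b1, b2, h3,
    eulerD_hyp_comp a1.differentiableAt h1 h2, eulerD_eulerD_hyp_comp a1.differentiableAt h1 h2 h4]
  -- After reduction everything is a combination of `A (θF)(R)` and `A F(R)`; `hp` equates the first
  -- coefficients and `hs` the second ones.
  linear_combination (A t * eulerD hyp (R t)) * h5 + (A t * hyp (R t)) * h6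

theorem eulerD_of_hasDerivAt {f : ℂ → ℂ} {t f' : ℂ} (h : HasDerivAt f f' t) :
    eulerD f t = t * f' := by rw [eulerD, h.deriv]

theorem eulerD_div_of_hasDerivAt {f g f' g' : ℂ → ℂ} (hf : ∀ t, HasDerivAt f (f' t) t)
    (hg : ∀ t, HasDerivAt g (g' t) t) {t : ℂ} (h : g t ≠ 0) :
    eulerD (fun t => f t / g t) t = t * (f' t * g t - f t * g' t) / g t ^ 2 := by
  rw [eulerD_of_hasDerivAt ((hf t).fun_div (hg t) h)]
  ring

theorem analyticAt_of_hasDerivAt {f f' : ℂ → ℂ} (hf : ∀ t, HasDerivAt f (f' t) t) (t : ℂ) :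
    AnalyticAt ℂ f t :=
  Complex.analyticAt_iff_eventually_differentiableAt.2
    (Eventually.of_forall fun t => (hf t).differentiableAt)

/-- The pullback equation for `R = 1728 tᵃ / G` and `A = (B / B(0))^(-1/4)`. -/
theorem pullback_ode_rational (a : ℕ) (ha : a ≠ 0)
    {G G' B B' rN rN' rD rD' αN αN' p s k : ℂ → ℂ}
    (hG : ∀ t, HasDerivAt G (G' t) t) (hB : ∀ t, HasDerivAt B (B' t) t)
    (hrN : ∀ t, HasDerivAt rN (rN' t) t) (hrD : ∀ t, HasDerivAt rD (rD' t) t)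
    (hαN : ∀ t, HasDerivAt αN (αN' t) t)
    (hG0 : G 0 ≠ 0) (hB0 : B 0 ≠ 0) (hD0 : rD 0 ≠ 0)
    -- The logarithmic derivative `θR / R = a - t G' / G`, reduced to `rN / rD`.
    (hr : ∀ t, rN t * G t = (a * G t - t * G' t) * rD t)
    (hα : ∀ t, αN t = -(1 / 4) * (t * B' t))
    (hk : ∀ᶠ t in 𝓝 0, k t * (G t - 1728 * t ^ a) = 1728 * t ^ a)
    (hp : ∀ᶠ t in 𝓝 0, 2 * (αN t / B t) * (rN t / rD t)
      + t * (rN' t * rD t - rN t * rD' t) / rD t ^ 2 + (rN t / rD t) ^ 2 * k t / 2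
        = p t * (rN t / rD t))
    (hs : ∀ᶠ t in 𝓝 0, t * (αN' t * B t - αN t * B' t) / B t ^ 2 + (αN t / B t) ^ 2
      + 5 / 144 * (rN t / rD t) ^ 2 * k t = p t * (αN t / B t) + s t) :
    AnalyticAt ℂ (fun t => (B t / B 0) ^ (-1 / 4 : ℂ) * hyp (1728 * t ^ a / G t)) 0 ∧
    ∀ᶠ t in 𝓝 0,
      eulerD (eulerD fun t => (B t / B 0) ^ (-1 / 4 : ℂ) * hyp (1728 * t ^ a / G t)) t =
      p t * eulerD (fun t => (B t / B 0) ^ (-1 / 4 : ℂ) * hyp (1728 * t ^ a / G t)) t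
        + s t * ((B t / B 0) ^ (-1 / 4 : ℂ) * hyp (1728 * t ^ a / G t)) := by
  have aG := analyticAt_of_hasDerivAt hG 0
  have aB := analyticAt_of_hasDerivAt hB 0
  have arN := analyticAt_of_hasDerivAt hrN 0
  have arD := analyticAt_of_hasDerivAt hrD 0
  have aα := analyticAt_of_hasDerivAt hαN 0
  have hGe := aG.continuousAt.eventually_ne hG0
  have hBe := aB.continuousAt.eventually_ne hB0
  have hDe := arD.continuousAt.eventually_ne hD0
  have hslit : ∀ᶠ t in 𝓝 0, B t / B 0 ∈ Complex.slitPlane :=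
    (aB.continuousAt.div_const (B 0)).eventually_mem
      (by simpa [div_self hB0] using Complex.isOpen_slitPlane.mem_nhds Complex.one_mem_slitPlane)
  refine pullback_ode (R := fun t => 1728 * t ^ a / G t) (A := fun t => (B t / B 0) ^ (-1 / 4 : ℂ))
    (r := fun t => rN t / rD t) (α := fun t => αN t / B t) (k := k)
    ((by fun_prop : AnalyticAt ℂ (fun t : ℂ => 1728 * t ^ a) 0).fun_div aG hG0) (by simp [ha])
    ?_ (arN.fun_div arD hD0) (aα.fun_div aB hB0) ?_ ?_ ?_ ?_ ?_
  · exact (aB.fun_div analyticAt_const hB0).cpow analyticAt_const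
      (by simp [div_self hB0])
  · filter_upwards [hGe, hDe] with t h1 h2
    have h3 : ∀ t, HasDerivAt (fun t : ℂ => 1728 * t ^ a) (1728 * (a * t ^ (a - 1))) t :=
      fun t => (hasDerivAt_pow a t).const_mul 1728
    rw [eulerD_div_of_hasDerivAt h3 hG h1]
    have h4 : t * t ^ (a - 1) = t ^ a := by
      rw [← pow_succ', Nat.sub_add_cancel (Nat.one_le_iff_ne_zero.2 ha)]
    field_simp
    linear_combination rD t * a * G t * h4 - t ^ a * hr t
  · filter_upwards [hBe, hslit] with t h1 h2
    rw [eulerD_of_hasDerivAt (((hB t).div_const (B 0)).cpow_const (c := (-1 / 4 : ℂ)) h2),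
      Complex.cpow_sub _ _ (Complex.slitPlane_ne_zero h2), hα]
    simp only [Complex.cpow_one]
    field_simp
  · filter_upwards [hk, hGe] with t h1 h2
    field_simp
    linear_combination h1
  · filter_upwards [hp, hDe] with t h1 h2
    rw [eulerD_div_of_hasDerivAt hrN hrD h2]
    exact h1
  · filter_upwards [hs, hBe] with t h1 h2
    rw [eulerD_div_of_hasDerivAt hαN hB h2]
    exact h1

theorem eventually_ne_zero_of_differentiable {f : ℂ → ℂ} (hf : Differentiable ℂ f) (h : f 0 ≠ 0) :
    ∀ᶠ t in 𝓝 0, f t ≠ 0 := hf.continuous.continuousAt.eventually_ne h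

theorem tendsto_zero_of_continuousAt {f : ℂ → ℂ} (hf : ContinuousAt f 0) (h : f 0 = 0) :
    Tendsto f (𝓝[≠] 0) (𝓝 0) := by
  simpa [h] using hf.tendsto.mono_left (nhdsWithin_le_nhds (s := {0}ᶜ))

theorem hasDerivAt_mul_add (a b t : ℂ) : HasDerivAt (fun t : ℂ => a * t + b) a t := by
  simpa using ((hasDerivAt_id' t).const_mul a).add_const b

theorem hasDerivAt_add (b t : ℂ) : HasDerivAt (fun t : ℂ => t + b) 1 t :=
  (hasDerivAt_id' t).add_const b

theorem hasDerivAt_mul_left (b t : ℂ) : HasDerivAt (fun t : ℂ => b * t) b t := by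
  simpa using (hasDerivAt_id' t).const_mul b

theorem hasDerivAt_quadratic (a b c t : ℂ) :
    HasDerivAt (fun t : ℂ => a * t ^ 2 + b * t + c) (a * (2 * t) + b) t := by
  simpa using (((hasDerivAt_pow 2 t).const_mul a).fun_add (hasDerivAt_mul_left b t)).add_const c

theorem hasDerivAt_monic_quadratic (b c t : ℂ) :
    HasDerivAt (fun t : ℂ => t ^ 2 + b * t + c) (2 * t + b) t := by
  simpa using hasDerivAt_quadratic 1 b c t

theorem eventually_add_ne_zero {c : ℂ} (hc : c ≠ 0) : ∀ᶠ t in 𝓝 (0 : ℂ), t + c ≠ 0 :=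
  eventually_ne_zero_of_differentiable (f := fun t => t + c) (by fun_prop) (by simpa using hc)

theorem eventually_quadratic_ne_zero (b : ℂ) {c : ℂ} (hc : c ≠ 0) :
    ∀ᶠ t in 𝓝 (0 : ℂ), t * (t + b) + c ≠ 0 :=
  eventually_ne_zero_of_differentiable (f := fun t => t * (t + b) + c) (by fun_prop)
    (by simpa using hc)

/-! ### Transformations of degrees two, three and five -/

/-- The degree two transformation of `hyp`. -/
theorem hyp_transform_two : ∀ᶠ t in 𝓝 (0 : ℂ),
    ((t + 16) / (0 + 16)) ^ (-1 / 4 : ℂ) * hyp (1728 * t ^ 1 / (t + 16) ^ 3) =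
    ((t + 256) / (0 + 256)) ^ (-1 / 4 : ℂ) * hyp (1728 * t ^ 2 / (t + 256) ^ 3) := by
  have hc (b t : ℂ) : HasDerivAt (fun t : ℂ => (t + b) ^ 3) (3 * (t + b) ^ 2) t := by
    simpa using (hasDerivAt_add b t).fun_pow 3
  have n1 := eventually_add_ne_zero (c := 64) (by norm_num)
  have n2 := eventually_add_ne_zero (c := -8) (by norm_num)
  have n3 := eventually_add_ne_zero (c := 16) (by norm_num)
  have n4 := eventually_add_ne_zero (c := -512) (by norm_num)
  have n5 := eventually_add_ne_zero (c := 256) (by norm_num)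
  have h1 := pullback_ode_rational 1 one_ne_zero (G := fun t => (t + 16) ^ 3)
    (p := fun t => -(t / 2) / (t + 64)) (s := fun t => -(t / 16) / (t + 64))
    -- `(t + 16)³ - 1728 t = (t + 64)(t - 8)²`, the numerator of `j - 1728`. The double zero at `8`
    -- cancels against `rN²`, so `p` and `s` have a pole only at `-64`.
    (k := fun t => 1728 * t / ((t + 64) * (t + -8) ^ 2))
    (hc 16) (hasDerivAt_add 16) (hasDerivAt_mul_add (-2) 16) (hasDerivAt_add 16)
    (hasDerivAt_mul_left (-(1 / 4))) (by norm_num) (by norm_num)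
    (by norm_num) (fun t => by push_cast; ring) (fun t => by ring)
    (by filter_upwards [n1, n2] with t h1 h2; field_simp; ring)
    (by filter_upwards [n1, n2, n3] with t h1 h2 h3; field_simp; ring)
    (by filter_upwards [n1, n2, n3] with t h1 h2 h3; field_simp; ring)
  have h2 := pullback_ode_rational 2 two_ne_zero (G := fun t => (t + 256) ^ 3)
    (p := fun t => -(t / 2) / (t + 64)) (s := fun t => -(t / 16) / (t + 64))
    -- `(t + 256)³ - 1728 t² = (t + 64)(t - 512)²` for `j(2τ)`. The simple zero is again `-64`, and
    -- `p`, `s` are the same as before.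
    (k := fun t => 1728 * t ^ 2 / ((t + 64) * (t + -512) ^ 2))
    (hc 256) (hasDerivAt_add 256) (hasDerivAt_mul_add (-1) 512) (hasDerivAt_add 256)
    (hasDerivAt_mul_left (-(1 / 4))) (by norm_num) (by norm_num)
    (by norm_num) (fun t => by push_cast; ring) (fun t => by ring)
    (by filter_upwards [n1, n4] with t h1 h2; field_simp; ring)
    (by filter_upwards [n1, n4, n5] with t h1 h2 h3; field_simp; ring)
    (by filter_upwards [n1, n4, n5] with t h1 h2 h3; field_simp; ring)
  exact eq_of_eulerD_eq h1.1 h2.1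
    (tendsto_zero_of_continuousAt (by fun_prop (disch := norm_num)) (by norm_num))
    (tendsto_zero_of_continuousAt (by fun_prop (disch := norm_num)) (by norm_num))
    (h1.2.filter_mono nhdsWithin_le_nhds) (h2.2.filter_mono nhdsWithin_le_nhds)
    (by norm_num [hyp_zero])

/-- The degree three transformation of `hyp`. -/
theorem hyp_transform_three : ∀ᶠ t in 𝓝 (0 : ℂ),
    ((t + 3) / (0 + 3)) ^ (-1 / 4 : ℂ) * hyp (1728 * t ^ 1 / ((t + 27) * (t + 3) ^ 3)) =
    ((t + 243) / (0 + 243)) ^ (-1 / 4 : ℂ) *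
      hyp (1728 * t ^ 3 / ((t + 27) * (t + 243) ^ 3)) := by
  have hc (b t : ℂ) : HasDerivAt (fun t : ℂ => (t + 27) * (t + b) ^ 3)
      ((t + b) ^ 3 + (t + 27) * (3 * (t + b) ^ 2)) t := by
    simpa using (hasDerivAt_add 27 t).fun_mul ((hasDerivAt_add b t).fun_pow 3)
  have hd (b t : ℂ) : HasDerivAt (fun t : ℂ => (t + 27) * (t + b)) ((t + b) + (t + 27)) t := by
    simpa using (hasDerivAt_add 27 t).fun_mul (hasDerivAt_add b t)
  have n1 := eventually_add_ne_zero (c := 27) (by norm_num)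
  have n2 := eventually_quadratic_ne_zero 18 (c := -27) (by norm_num)
  have n3 := eventually_add_ne_zero (c := 3) (by norm_num)
  have n4 := eventually_quadratic_ne_zero (-486) (c := -19683) (by norm_num)
  have n5 := eventually_add_ne_zero (c := 243) (by norm_num)
  -- The factor `(t + 27)^(-1/12)` would be common to both sides and is left out. Now `j - 1728` has
  -- the square numerator `(t² + 18 t - 27)²`, and `p`, `s` are singular at `-27` instead.
  have h1 := pullback_ode_rational 1 one_ne_zero (G := fun t => (t + 27) * (t + 3) ^ 3)
    (p := fun t => -(t / 2) / (t + 27)) (s := fun t => -(t * (t + 12) / 16) / (t + 27) ^ 2)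
    (k := fun t => 1728 * t / (t ^ 2 + 18 * t + -27) ^ 2)
    (hc 3) (hasDerivAt_add 3) (hasDerivAt_quadratic (-3) (-54) 81) (hd 3)
    (hasDerivAt_mul_left (-(1 / 4))) (by norm_num) (by norm_num)
    (by norm_num) (fun t => by push_cast; ring) (fun t => by ring)
    (by filter_upwards [n2] with t h2; field_simp; ring)
    (by filter_upwards [n1, n2, n3] with t h1 h2 h3; field_simp; ring)
    (by filter_upwards [n1, n2, n3] with t h1 h2 h3; field_simp; ring)
  have h2 := pullback_ode_rational 3 three_ne_zero (G := fun t => (t + 27) * (t + 243) ^ 3)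
    (p := fun t => -(t / 2) / (t + 27)) (s := fun t => -(t * (t + 12) / 16) / (t + 27) ^ 2)
    (k := fun t => 1728 * t ^ 3 / (t ^ 2 + -486 * t + -19683) ^ 2)
    (hc 243) (hasDerivAt_add 243) (hasDerivAt_quadratic (-1) 486 19683) (hd 243)
    (hasDerivAt_mul_left (-(1 / 4))) (by norm_num) (by norm_num)
    (by norm_num) (fun t => by push_cast; ring) (fun t => by ring)
    (by filter_upwards [n4] with t h2; field_simp; ring)
    (by filter_upwards [n1, n4, n5] with t h1 h2 h3; field_simp; ring)
    (by filter_upwards [n1, n4, n5] with t h1 h2 h3; field_simp; ring)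
  exact eq_of_eulerD_eq h1.1 h2.1
    (tendsto_zero_of_continuousAt (by fun_prop (disch := norm_num)) (by norm_num))
    (tendsto_zero_of_continuousAt (by fun_prop (disch := norm_num)) (by norm_num))
    (h1.2.filter_mono nhdsWithin_le_nhds) (h2.2.filter_mono nhdsWithin_le_nhds)
    (by norm_num [hyp_zero])

/-- The degree five transformation of `hyp`. -/
theorem hyp_transform_five : ∀ᶠ t in 𝓝 (0 : ℂ),
    ((t ^ 2 + 10 * t + 5) / (0 ^ 2 + 10 * 0 + 5)) ^ (-1 / 4 : ℂ) *
      hyp (1728 * t ^ 1 / (t ^ 2 + 10 * t + 5) ^ 3) =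
    ((t ^ 2 + 250 * t + 3125) / (0 ^ 2 + 250 * 0 + 3125)) ^ (-1 / 4 : ℂ) *
      hyp (1728 * t ^ 5 / (t ^ 2 + 250 * t + 3125) ^ 3) := by
  have hc (b c t : ℂ) : HasDerivAt (fun t : ℂ => (t ^ 2 + b * t + c) ^ 3)
      (3 * (t ^ 2 + b * t + c) ^ 2 * (2 * t + b)) t := by
    simpa using (hasDerivAt_monic_quadratic b c t).fun_pow 3
  have n1 := eventually_quadratic_ne_zero 22 (c := 125) (by norm_num)
  have n2 := eventually_quadratic_ne_zero 4 (c := -1) (by norm_num)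
  have n3 := eventually_quadratic_ne_zero 10 (c := 5) (by norm_num)
  have n4 := eventually_quadratic_ne_zero (-500) (c := -15625) (by norm_num)
  have n5 := eventually_quadratic_ne_zero 250 (c := 3125) (by norm_num)
  have h1 := pullback_ode_rational 1 one_ne_zero (G := fun t => (t ^ 2 + 10 * t + 5) ^ 3)
    (p := fun t => -(t * (t + 11)) / (t ^ 2 + 22 * t + 125))
    (s := fun t => -(t * (t + 10) / 4) / (t ^ 2 + 22 * t + 125))
    -- `(t² + 10 t + 5)³ - 1728 t = (t² + 22 t + 125)(t² + 4 t - 1)²`; the quadratic `t² + 22 t +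
    -- 125` is shared with the equation for `j(5τ)`.
    (k := fun t => 1728 * t / ((t ^ 2 + 22 * t + 125) * (t ^ 2 + 4 * t + -1) ^ 2))
    (hc 10 5) (hasDerivAt_monic_quadratic 10 5) (hasDerivAt_quadratic (-5) (-20) 5)
    (hasDerivAt_monic_quadratic 10 5)
    (hasDerivAt_quadratic (-(1 / 2)) (-(5 / 2)) 0) (by norm_num) (by norm_num)
    (by norm_num) (fun t => by push_cast; ring) (fun t => by ring)
    (by filter_upwards [n1, n2] with t h1 h2; field_simp; ring)
    (by filter_upwards [n1, n2, n3] with t h1 h2 h3; field_simp; ring)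
    (by filter_upwards [n1, n2, n3] with t h1 h2 h3; field_simp; ring)
  have h2 := pullback_ode_rational 5 (by norm_num) (G := fun t => (t ^ 2 + 250 * t + 3125) ^ 3)
    (p := fun t => -(t * (t + 11)) / (t ^ 2 + 22 * t + 125))
    (s := fun t => -(t * (t + 10) / 4) / (t ^ 2 + 22 * t + 125))
    (k := fun t => 1728 * t ^ 5 /
      ((t ^ 2 + 22 * t + 125) * (t ^ 2 + -500 * t + -15625) ^ 2))
    (hc 250 3125) (hasDerivAt_monic_quadratic 250 3125) (hasDerivAt_quadratic (-1) 500 15625)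
    (hasDerivAt_monic_quadratic 250 3125)
    (hasDerivAt_quadratic (-(1 / 2)) (-(125 / 2)) 0) (by norm_num) (by norm_num)
    (by norm_num) (fun t => by push_cast; ring) (fun t => by ring)
    (by filter_upwards [n1, n4] with t h1 h2; field_simp; ring)
    (by filter_upwards [n1, n4, n5] with t h1 h2 h3; field_simp; ring)
    (by filter_upwards [n1, n4, n5] with t h1 h2 h3; field_simp; ring)
  exact eq_of_eulerD_eq h1.1 h2.1
    (tendsto_zero_of_continuousAt (by fun_prop (disch := norm_num)) (by norm_num))
    (tendsto_zero_of_continuousAt (by fun_prop (disch := norm_num)) (by norm_num))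
    (h1.2.filter_mono nhdsWithin_le_nhds) (h2.2.filter_mono nhdsWithin_le_nhds)
    (by norm_num [hyp_zero])

end GenusZero

/-! ### Modular equations for twelfth powers -/

namespace GenusZero

open Filter

/-- The power that makes a principal root rational; it holds for every `x`, so no branch has to be
followed. -/
theorem cpow_neg_div_pow (x : ℂ) (n k : ℕ) (hn : n ≠ 0) :
    (x ^ (-1 / n : ℂ)) ^ (n * k) = (x ^ k)⁻¹ := by
  have hn' : (n : ℂ) ≠ 0 := by exact_mod_cast hn
  rw [pow_mul, ← Complex.cpow_nat_mul, mul_div_cancel₀ _ hn', Complex.cpow_neg_one, inv_pow]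

/-- The twelfth power of `h₂`. -/
noncomputable def hpow₂ (s : ℂ) : ℂ := (16 / (s + 16)) ^ 3 * hyp (1728 * s / (s + 16) ^ 3) ^ 12

/-- The twelfth power of `h₃`. -/
noncomputable def hpow₃ (s : ℂ) : ℂ :=
  27 / (s + 27) * (3 / (s + 3)) ^ 3 * hyp (1728 * s / ((s + 27) * (s + 3) ^ 3)) ^ 12

/-- The twelfth power of `h₅`. -/
noncomputable def hpow₅ (s : ℂ) : ℂ :=
  (5 / (s ^ 2 + 10 * s + 5)) ^ 3 * hyp (1728 * s / (s ^ 2 + 10 * s + 5) ^ 3) ^ 12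

/-- The left side belongs to `j(τ)` and the right side to `j(2τ)`, both in terms of `s = t_2(τ)`. -/
theorem hpow₂_eq : ∀ᶠ s in 𝓝 (0 : ℂ), hpow₂ s =
    (256 / (s + 256)) ^ 3 * hyp (1728 * s ^ 2 / (s + 256) ^ 3) ^ 12 := by
  filter_upwards [hyp_transform_two] with s hs
  have := congrArg (· ^ (4 * 3)) hs
  simp only [mul_pow] at this
  have h4 (x : ℂ) := cpow_neg_div_pow x 4 3 (by norm_num)
  push_cast at h4
  rw [h4, h4, ← inv_pow, ← inv_pow, inv_div, inv_div] at this
  simpa [hpow₂] using this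

theorem hpow₃_eq : ∀ᶠ s in 𝓝 (0 : ℂ), hpow₃ s = 27 / (s + 27) * (243 / (s + 243)) ^ 3 *
    hyp (1728 * s ^ 3 / ((s + 27) * (s + 243) ^ 3)) ^ 12 := by
  filter_upwards [hyp_transform_three] with s hs
  have := congrArg (· ^ (4 * 3)) hs
  simp only [mul_pow] at this
  have h4 (x : ℂ) := cpow_neg_div_pow x 4 3 (by norm_num)
  push_cast at h4
  rw [h4, h4, ← inv_pow, ← inv_pow, inv_div, inv_div] at this
  -- The factor `27 / (s + 27)` left out of `hyp_transform_three` is common to both sides.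
  rw [hpow₃, mul_assoc, mul_assoc]
  congr 1
  simpa using this

theorem hpow₅_eq : ∀ᶠ s in 𝓝 (0 : ℂ), hpow₅ s = (3125 / (s ^ 2 + 250 * s + 3125)) ^ 3 *
    hyp (1728 * s ^ 5 / (s ^ 2 + 250 * s + 3125) ^ 3) ^ 12 := by
  filter_upwards [hyp_transform_five] with s hs
  have := congrArg (· ^ (4 * 3)) hs
  simp only [mul_pow] at this
  have h4 (x : ℂ) := cpow_neg_div_pow x 4 3 (by norm_num)
  push_cast at h4
  rw [h4, h4, ← inv_pow, ← inv_pow, inv_div, inv_div] at this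
  simpa [hpow₅] using this

theorem eventually_comp {p : ℂ → Prop} (h : ∀ᶠ s in 𝓝 (0 : ℂ), p s) {u : ℂ → ℂ}
    (hu : ContinuousAt u 0) (h0 : u 0 = 0) : ∀ᶠ t in 𝓝 (0 : ℂ), p (u t) := by
  have : Tendsto u (𝓝 0) (𝓝 0) := by simpa [ContinuousAt, h0] using hu
  exact this.eventually h

/-- Homogeneous form: with arguments of `hyp` written as quotients of polynomials in `N` and `D`,
arguments that come from different levels can be matched by `ring`. -/
theorem hpow₂_div {N D E : ℂ} (hD : D ≠ 0) (hE : N + 16 * D = E) :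
    hpow₂ (N / D) = (16 * D / E) ^ 3 * hyp (1728 * N * D ^ 2 / E ^ 3) ^ 12 := by
  have e : N / D + 16 = E / D := by rw [← hE]; field_simp
  have e2 : 1728 * (N / D) / (E / D) ^ 3 = 1728 * N * D ^ 2 / E ^ 3 := by
    rcases eq_or_ne E 0 with rfl | h
    · simp
    · field_simp
  rw [hpow₂, e, e2, div_div_eq_mul_div]

theorem hpow₃_div {N D E E' : ℂ} (hD : D ≠ 0) (hE : N + 27 * D = E) (hE' : N + 3 * D = E') :
    hpow₃ (N / D) = 27 * D / E * (3 * D / E') ^ 3 *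
      hyp (1728 * N * D ^ 3 / (E * E' ^ 3)) ^ 12 := by
  have e : N / D + 27 = E / D := by rw [← hE]; field_simp
  have e' : N / D + 3 = E' / D := by rw [← hE']; field_simp
  have e2 : 1728 * (N / D) / (E / D * (E' / D) ^ 3) = 1728 * N * D ^ 3 / (E * E' ^ 3) := by
    rcases eq_or_ne E 0 with rfl | h
    · simp
    rcases eq_or_ne E' 0 with rfl | h'
    · simp
    · field_simp
  rw [hpow₃, e, e', e2, div_div_eq_mul_div, div_div_eq_mul_div]

theorem hpow₅_div {N D E : ℂ} (hD : D ≠ 0) (hE : N ^ 2 + 10 * N * D + 5 * D ^ 2 = E) :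
    hpow₅ (N / D) = (5 * D ^ 2 / E) ^ 3 * hyp (1728 * N * D ^ 5 / E ^ 3) ^ 12 := by
  have e : (N / D) ^ 2 + 10 * (N / D) + 5 = E / D ^ 2 := by rw [← hE]; field_simp
  have e2 : 1728 * (N / D) / (E / D ^ 2) ^ 3 = 1728 * N * D ^ 5 / E ^ 3 := by
    rcases eq_or_ne E 0 with rfl | h
    · simp
    · field_simp
  rw [hpow₅, e, e2, div_div_eq_mul_div]

/-- The degree two transformation freed of its level two prefactors, so that it serves every level
at which `t_2(τ) = N / D` is known. `E` and `E'` are variables in order that factored forms can be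
supplied. -/
theorem hyp_pow_two : ∀ᶠ s in 𝓝 (0 : ℂ), ∀ N D E E' : ℂ, D ≠ 0 → N / D = s →
    N + 16 * D = E → N + 256 * D = E' → E ≠ 0 ∧ E' ≠ 0 ∧
    hyp (1728 * N * D ^ 2 / E ^ 3) ^ 12 =
      (16 * E / E') ^ 3 * hyp (1728 * N ^ 2 * D / E' ^ 3) ^ 12 := by
  filter_upwards [hpow₂_eq, eventually_add_ne_zero (c := 16) (by norm_num),
    eventually_add_ne_zero (c := 256) (by norm_num)] with s hs h1 h2 N D E E' hD hs' hE hE'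
  subst hs'
  have e : N / D + 16 = E / D := by rw [← hE]; field_simp
  have e' : N / D + 256 = E' / D := by rw [← hE']; field_simp
  rw [e] at h1
  rw [e'] at h2
  have hE0 : E ≠ 0 := fun h => h1 (by simp [h])
  have hE0' : E' ≠ 0 := fun h => h2 (by simp [h])
  refine ⟨hE0, hE0', ?_⟩
  have e3 : 1728 * (N / D) ^ 2 / (E' / D) ^ 3 = 1728 * N ^ 2 * D / E' ^ 3 := by field_simp
  rw [hpow₂_div hD hE, e', e3] at hs
  have : (16 * D / E) ^ 3 ≠ 0 := by simp [hD, hE0]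
  apply mul_left_cancel₀ this
  rw [hs]
  field_simp
  ring

theorem hyp_pow_three : ∀ᶠ s in 𝓝 (0 : ℂ), ∀ N D E E₁ E₂ : ℂ, D ≠ 0 → N / D = s →
    N + 27 * D = E → N + 3 * D = E₁ → N + 243 * D = E₂ → E ≠ 0 ∧ E₁ ≠ 0 ∧ E₂ ≠ 0 ∧
    hyp (1728 * N * D ^ 3 / (E * E₁ ^ 3)) ^ 12 =
      (81 * E₁ / E₂) ^ 3 * hyp (1728 * N ^ 3 * D / (E * E₂ ^ 3)) ^ 12 := by
  filter_upwards [hpow₃_eq, eventually_add_ne_zero (c := 27) (by norm_num),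
    eventually_add_ne_zero (c := 3) (by norm_num),
    eventually_add_ne_zero (c := 243) (by norm_num)] with s hs h0 h1 h2 N D E E₁ E₂ hD hs' hE hE₁ hE₂
  subst hs'
  have e : N / D + 27 = E / D := by rw [← hE]; field_simp
  have e₁ : N / D + 3 = E₁ / D := by rw [← hE₁]; field_simp
  have e₂ : N / D + 243 = E₂ / D := by rw [← hE₂]; field_simp
  rw [e] at h0
  rw [e₁] at h1
  rw [e₂] at h2
  have hE0 : E ≠ 0 := fun h => h0 (by simp [h])
  have hE1 : E₁ ≠ 0 := fun h => h1 (by simp [h])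
  have hE2 : E₂ ≠ 0 := fun h => h2 (by simp [h])
  refine ⟨hE0, hE1, hE2, ?_⟩
  have e3 : 1728 * (N / D) ^ 3 / (E / D * (E₂ / D) ^ 3) = 1728 * N ^ 3 * D / (E * E₂ ^ 3) := by
    field_simp
  rw [hpow₃_div hD hE hE₁, e, e₂, e3] at hs
  have : 27 * D / E * (3 * D / E₁) ^ 3 ≠ 0 := by simp [hD, hE0, hE1]
  apply mul_left_cancel₀ this
  rw [hs]
  field_simp
  ring

theorem hyp_pow_five : ∀ᶠ s in 𝓝 (0 : ℂ), ∀ N D E E' : ℂ, D ≠ 0 → N / D = s →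
    N ^ 2 + 10 * N * D + 5 * D ^ 2 = E → N ^ 2 + 250 * N * D + 3125 * D ^ 2 = E' →
    E ≠ 0 ∧ E' ≠ 0 ∧ hyp (1728 * N * D ^ 5 / E ^ 3) ^ 12 =
      (625 * E / E') ^ 3 * hyp (1728 * N ^ 5 * D / E' ^ 3) ^ 12 := by
  filter_upwards [hpow₅_eq, eventually_quadratic_ne_zero 10 (c := 5) (by norm_num),
    eventually_quadratic_ne_zero 250 (c := 3125) (by norm_num)] with s hs h1 h2 N D E E' hD hs' hE hE'
  subst hs'
  have e : (N / D) ^ 2 + 10 * (N / D) + 5 = E / D ^ 2 := by rw [← hE]; field_simp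
  have e' : (N / D) ^ 2 + 250 * (N / D) + 3125 = E' / D ^ 2 := by rw [← hE']; field_simp
  have hE0 : E ≠ 0 := fun h => h1 (by rw [h] at e; linear_combination e)
  have hE0' : E' ≠ 0 := fun h => h2 (by rw [h] at e'; linear_combination e')
  refine ⟨hE0, hE0', ?_⟩
  have e3 : 1728 * (N / D) ^ 5 / (E' / D ^ 2) ^ 3 = 1728 * N ^ 5 * D / E' ^ 3 := by field_simp
  rw [hpow₅_div hD hE, e', e3] at hs
  have : (5 * D ^ 2 / E) ^ 3 ≠ 0 := by simp [hD, hE0]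
  apply mul_left_cancel₀ this
  rw [hs]
  field_simp
  ring

/-! ### Modular equations of prime level and prime degree -/

theorem hpow_two_two : ∀ᶠ t in 𝓝 (0 : ℂ),
    hpow₂ (t * (t + 16)) = 2 ^ 12 / (t + 16) ^ 3 * hpow₂ (t ^ 2 / (t + 16)) := by
  filter_upwards [eventually_comp hyp_pow_two (u := fun t => t * (t + 16) / 1)
      (by fun_prop (disch := norm_num)) (by simp), 
    eventually_add_ne_zero (c := 16) (by norm_num)]
    with t h h1
  obtain ⟨hE, hE', hK⟩ := h _ _ _ _ one_ne_zero rfl rfl rfl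
  rw [← div_one (t * (t + 16)), hpow₂_div one_ne_zero rfl, hK,
    hpow₂_div h1 (E := t * (t + 16) + 256 * 1) (by ring),
    show 1728 * t ^ 2 * (t + 16) ^ 2 = 1728 * (t * (t + 16)) ^ 2 * 1 by ring]
  generalize hyp _ = H
  generalize t * (t + 16) + 16 * 1 = A at *
  generalize t * (t + 16) + 256 * 1 = B at *
  field_simp
  ring

/-- A degree three statement compares `j(τ)` with `j(3τ)`, so the degree three transformation is
applied at `t_3(τ) = t (t + 9)² / (t + 8)` with `t = t_6(τ)`. Expressing `j` through `t_2` or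
through `t_3` gives the same function of `t`, so the arguments of `hyp` coincide. -/
theorem hpow_two_three : ∀ᶠ t in 𝓝 (0 : ℂ),
    hpow₂ (t * (t + 8) ^ 3 / (t + 9)) = 3 ^ 12 / (t + 9) ^ 6 * hpow₂ (t ^ 3 * (t + 8) / (t + 9) ^ 3) := by
  filter_upwards [eventually_comp hyp_pow_three (u := fun t => t * (t + 9) ^ 2 / (t + 8))
      (by fun_prop (disch := norm_num)) (by simp), 
    eventually_add_ne_zero (c := 9) (by norm_num), 
    eventually_add_ne_zero (c := 8) (by norm_num)]
    with t h h1 h2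
  -- `t_3 + 27 = (t + 6)³ / (t + 8)`, while `t + 6` and the first cubic multiply to the numerator of
  -- `t_2 + 16`; this is how the two forms of `j` agree.
  obtain ⟨hE, hE₁, hE₂, hK⟩ := h _ _ ((t + 6) ^ 3) (t ^ 3 + 18 * t ^ 2 + 84 * t + 24)
    (t ^ 3 + 18 * t ^ 2 + 324 * t + 1944) h2 rfl (by ring) (by ring) (by ring)
  have h6 : t + 6 ≠ 0 := fun h => hE (by simp [h])
  rw [hpow₂_div h1 (E := (t + 6) * (t ^ 3 + 18 * t ^ 2 + 84 * t + 24)) (by ring),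
    hpow₂_div (pow_ne_zero 3 h1) (E := (t + 6) * (t ^ 3 + 18 * t ^ 2 + 324 * t + 1944)) (by ring),
    mul_pow (t + 6), mul_pow (t + 6),
    show 1728 * (t * (t + 8) ^ 3) * (t + 9) ^ 2 = 1728 * (t * (t + 9) ^ 2) * (t + 8) ^ 3 by ring,
    show 1728 * (t ^ 3 * (t + 8)) * ((t + 9) ^ 3) ^ 2 =
      1728 * (t * (t + 9) ^ 2) ^ 3 * (t + 8) by ring, hK]
  generalize hyp _ = H
  generalize t ^ 3 + 18 * t ^ 2 + 84 * t + 24 = A at *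
  generalize t ^ 3 + 18 * t ^ 2 + 324 * t + 1944 = C at *
  field_simp
  ring

theorem hpow_two_five : ∀ᶠ t in 𝓝 (0 : ℂ),
    hpow₂ (t * (t + 4) ^ 5 / (t + 5)) = 5 ^ 12 / (t + 5) ^ 12 * hpow₂ (t ^ 5 * (t + 4) / (t + 5) ^ 5) := by
  filter_upwards [eventually_comp hyp_pow_five (u := fun t => t * (t + 5) ^ 2 / (t + 4))
      (by fun_prop (disch := norm_num)) (by simp), 
    eventually_add_ne_zero (c := 5) (by norm_num), 
    eventually_add_ne_zero (c := 4) (by norm_num)]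
    with t h h1 h2
  obtain ⟨hE, hE', hK⟩ := h _ _ (t * (t + 4) ^ 5 + 16 * (t + 5))
    (t ^ 5 * (t + 4) + 16 * (t + 5) ^ 5) h2 rfl (by ring) (by ring)
  rw [hpow₂_div h1 rfl, hpow₂_div (pow_ne_zero 5 h1) rfl,
    show 1728 * (t * (t + 4) ^ 5) * (t + 5) ^ 2 = 1728 * (t * (t + 5) ^ 2) * (t + 4) ^ 5 by ring,
    show 1728 * (t ^ 5 * (t + 4)) * ((t + 5) ^ 5) ^ 2 =
      1728 * (t * (t + 5) ^ 2) ^ 5 * (t + 4) by ring, hK]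
  generalize hyp _ = H
  generalize t * (t + 4) ^ 5 + 16 * (t + 5) = A at *
  generalize t ^ 5 * (t + 4) + 16 * (t + 5) ^ 5 = C at *
  field_simp
  ring

/-- The roles of `2` and `3` are exchanged: the degree two transformation at `t_2(τ)`, written in
`t_6`. -/
theorem hpow_three_two : ∀ᶠ t in 𝓝 (0 : ℂ),
    hpow₃ (t * (t + 9) ^ 2 / (t + 8)) = 2 ^ 12 / (t + 8) ^ 4 * hpow₃ (t ^ 2 * (t + 9) / (t + 8) ^ 2) := by
  filter_upwards [eventually_comp hyp_pow_two (u := fun t => t * (t + 8) ^ 3 / (t + 9))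
      (by fun_prop (disch := norm_num)) (by simp), 
    eventually_add_ne_zero (c := 9) (by norm_num), 
    eventually_add_ne_zero (c := 8) (by norm_num)]
    with t h h1 h2
  obtain ⟨hE, hE', hK⟩ := h _ _ ((t + 6) * (t ^ 3 + 18 * t ^ 2 + 84 * t + 24))
    ((t + 12) * (t ^ 3 + 12 * t ^ 2 + 48 * t + 192)) h1 rfl (by ring) (by ring)
  obtain ⟨h6, hA⟩ := mul_ne_zero_iff.1 hE
  obtain ⟨h12, hC⟩ := mul_ne_zero_iff.1 hE'
  rw [hpow₃_div h2 (E := (t + 6) ^ 3) (E' := t ^ 3 + 18 * t ^ 2 + 84 * t + 24) (by ring) (by ring),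
    hpow₃_div (pow_ne_zero 2 h2) (E := (t + 12) ^ 3) (E' := t ^ 3 + 12 * t ^ 2 + 48 * t + 192)
      (by ring) (by ring), ← mul_pow (t + 6), ← mul_pow (t + 12),
    show 1728 * (t * (t + 9) ^ 2) * (t + 8) ^ 3 = 1728 * (t * (t + 8) ^ 3) * (t + 9) ^ 2 by ring,
    show 1728 * (t ^ 2 * (t + 9)) * ((t + 8) ^ 2) ^ 3 =
      1728 * (t * (t + 8) ^ 3) ^ 2 * (t + 9) by ring, hK]
  generalize hyp _ = H
  generalize t ^ 3 + 18 * t ^ 2 + 84 * t + 24 = A at *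
  generalize t ^ 3 + 12 * t ^ 2 + 48 * t + 192 = C at *
  field_simp
  ring

/-- When the degree equals the level, the transformation is applied at `u(t)` itself; `v(t)` enters
through the expression of `j(3τ)` in `t_3(3τ)`. -/
theorem hpow_three_three : ∀ᶠ t in 𝓝 (0 : ℂ),
    hpow₃ (t * (t ^ 2 + 9 * t + 27)) = 3 ^ 12 / (t ^ 2 + 9 * t + 27) ^ 4 * hpow₃ (t ^ 3 / (t ^ 2 + 9 * t + 27)) := by
  filter_upwards [eventually_comp hyp_pow_three (u := fun t => t * (t ^ 2 + 9 * t + 27) / 1)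
      (by fun_prop (disch := norm_num)) (by simp), 
    eventually_ne_zero_of_differentiable (f := fun t => t ^ 2 + 9 * t + 27) (by fun_prop) (by norm_num)]
    with t h h1
  obtain ⟨hE, hE₁, hE₂, hK⟩ := h _ _ ((t + 3) ^ 3) (t * (t ^ 2 + 9 * t + 27) + 3)
    ((t + 9) * (t ^ 2 + 27)) one_ne_zero rfl (by ring) (by ring) (by ring)
  obtain ⟨h9, hC⟩ := mul_ne_zero_iff.1 hE₂
  have h3 : t + 3 ≠ 0 := fun h => hE (by simp [h])
  rw [← div_one (t * (t ^ 2 + 9 * t + 27)), hpow₃_div one_ne_zero (E := (t + 3) ^ 3)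
      (E' := t * (t ^ 2 + 9 * t + 27) + 3) (by ring) (by ring),
    hpow₃_div h1 (E := (t + 9) ^ 3) (E' := (t + 3) * (t ^ 2 + 27)) (by ring) (by ring),
    show (t + 9) ^ 3 * ((t + 3) * (t ^ 2 + 27)) ^ 3 =
      (t + 3) ^ 3 * ((t + 9) * (t ^ 2 + 27)) ^ 3 by ring,
    show 1728 * t ^ 3 * (t ^ 2 + 9 * t + 27) ^ 3 =
      1728 * (t * (t ^ 2 + 9 * t + 27)) ^ 3 * 1 by ring, hK]
  generalize hyp _ = H
  generalize t ^ 2 + 27 = C at *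
  generalize t * (t ^ 2 + 9 * t + 27) + 3 = A at *
  generalize t ^ 2 + 9 * t + 27 = B at *
  field_simp
  ring

theorem hpow_five_two : ∀ᶠ t in 𝓝 (0 : ℂ),
    hpow₅ (t * (t + 5) ^ 2 / (t + 4)) = 2 ^ 12 / (t + 4) ^ 6 * hpow₅ (t ^ 2 * (t + 5) / (t + 4) ^ 2) := by
  filter_upwards [eventually_comp hyp_pow_two (u := fun t => t * (t + 4) ^ 5 / (t + 5))
      (by fun_prop (disch := norm_num)) (by simp), 
    eventually_add_ne_zero (c := 5) (by norm_num), 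
    eventually_add_ne_zero (c := 4) (by norm_num)]
    with t h h1 h2
  obtain ⟨hE, hE', hK⟩ := h _ _ (t * (t + 4) ^ 5 + 16 * (t + 5))
    (t * (t + 4) ^ 5 + 256 * (t + 5)) h1 rfl (by ring) (by ring)
  rw [hpow₅_div h2 (E := t * (t + 4) ^ 5 + 16 * (t + 5)) (by ring),
    hpow₅_div (pow_ne_zero 2 h2) (E := t * (t + 4) ^ 5 + 256 * (t + 5)) (by ring),
    show 1728 * (t * (t + 5) ^ 2) * (t + 4) ^ 5 = 1728 * (t * (t + 4) ^ 5) * (t + 5) ^ 2 by ring,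
    show 1728 * (t ^ 2 * (t + 5)) * ((t + 4) ^ 2) ^ 5 =
      1728 * (t * (t + 4) ^ 5) ^ 2 * (t + 5) by ring, hK]
  generalize hyp _ = H
  generalize t * (t + 4) ^ 5 + 16 * (t + 5) = A at *
  generalize t * (t + 4) ^ 5 + 256 * (t + 5) = C at *
  field_simp
  ring

theorem hpow_five_five : ∀ᶠ t in 𝓝 (0 : ℂ),
    hpow₅ (t * (t ^ 4 + 5 * t ^ 3 + 15 * t ^ 2 + 25 * t + 25)) = 5 ^ 12 / (t ^ 4 + 5 * t ^ 3 + 15 * t ^ 2 + 25 * t + 25) ^ 6 * hpow₅ (t ^ 5 / (t ^ 4 + 5 * t ^ 3 + 15 * t ^ 2 + 25 * t + 25)) := by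
  filter_upwards [eventually_comp hyp_pow_five (u := fun t => t * (t ^ 4 + 5 * t ^ 3 + 15 * t ^ 2 + 25 * t + 25) / 1)
      (by fun_prop (disch := norm_num)) (by simp), 
    eventually_ne_zero_of_differentiable (f := fun t => t ^ 4 + 5 * t ^ 3 + 15 * t ^ 2 + 25 * t + 25) (by fun_prop) (by norm_num)]
    with t h h1
  obtain ⟨hE, hE', hK⟩ := h _ _ _
    ((t ^ 5) ^ 2 + 10 * t ^ 5 * (t ^ 4 + 5 * t ^ 3 + 15 * t ^ 2 + 25 * t + 25) +
      5 * (t ^ 4 + 5 * t ^ 3 + 15 * t ^ 2 + 25 * t + 25) ^ 2) one_ne_zero rfl rfl (by ring)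
  rw [← div_one (t * (t ^ 4 + 5 * t ^ 3 + 15 * t ^ 2 + 25 * t + 25)), hpow₅_div one_ne_zero rfl,
    hpow₅_div h1 rfl,
    show 1728 * t ^ 5 * (t ^ 4 + 5 * t ^ 3 + 15 * t ^ 2 + 25 * t + 25) ^ 5 =
      1728 * (t * (t ^ 4 + 5 * t ^ 3 + 15 * t ^ 2 + 25 * t + 25)) ^ 5 * 1 by ring, hK]
  generalize hyp _ = H
  generalize (t ^ 5) ^ 2 + 10 * t ^ 5 * (t ^ 4 + 5 * t ^ 3 + 15 * t ^ 2 + 25 * t + 25) +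
    5 * (t ^ 4 + 5 * t ^ 3 + 15 * t ^ 2 + 25 * t + 25) ^ 2 = C at *
  generalize (t * (t ^ 4 + 5 * t ^ 3 + 15 * t ^ 2 + 25 * t + 25)) ^ 2 +
    10 * (t * (t ^ 4 + 5 * t ^ 3 + 15 * t ^ 2 + 25 * t + 25)) * 1 + 5 * 1 ^ 2 = A at *
  generalize t ^ 4 + 5 * t ^ 3 + 15 * t ^ 2 + 25 * t + 25 = B at *
  field_simp
  ring

end GenusZero

/-! ### The maps of prime degree and their commutation relations -/

namespace GenusZero

open Filter

/-- The map `t_4 ↦ t_2(τ)`. -/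
noncomputable def u22 (t : ℂ) : ℂ := t * (t + 16)

/-- The map `t_4 ↦ t_2(2τ)`. -/
noncomputable def v22 (t : ℂ) : ℂ := t ^ 2 / (t + 16)

/-- The map `t_6 ↦ t_2(τ)`. -/
noncomputable def u23 (t : ℂ) : ℂ := t * (t + 8) ^ 3 / (t + 9)

/-- The map `t_6 ↦ t_2(3τ)`. -/
noncomputable def v23 (t : ℂ) : ℂ := t ^ 3 * (t + 8) / (t + 9) ^ 3

/-- The map `t_10 ↦ t_2(τ)`. -/
noncomputable def u25 (t : ℂ) : ℂ := t * (t + 4) ^ 5 / (t + 5)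

/-- The map `t_10 ↦ t_2(5τ)`. -/
noncomputable def v25 (t : ℂ) : ℂ := t ^ 5 * (t + 4) / (t + 5) ^ 5

/-- The map `t_6 ↦ t_3(τ)`. -/
noncomputable def u32 (t : ℂ) : ℂ := t * (t + 9) ^ 2 / (t + 8)

/-- The map `t_6 ↦ t_3(2τ)`. -/
noncomputable def v32 (t : ℂ) : ℂ := t ^ 2 * (t + 9) / (t + 8) ^ 2

/-- The map `t_9 ↦ t_3(τ)`. -/
noncomputable def u33 (t : ℂ) : ℂ := t * (t ^ 2 + 9 * t + 27)

/-- The map `t_9 ↦ t_3(3τ)`. -/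
noncomputable def v33 (t : ℂ) : ℂ := t ^ 3 / (t ^ 2 + 9 * t + 27)

/-- The map `t_8 ↦ t_4(τ)`. -/
noncomputable def u42 (t : ℂ) : ℂ := t * (t + 8)

/-- The map `t_8 ↦ t_4(2τ)`. -/
noncomputable def v42 (t : ℂ) : ℂ := t ^ 2 / (t + 4)

/-- The map `t_12 ↦ t_4(τ)`. -/
noncomputable def u43 (t : ℂ) : ℂ := t * (t + 4) ^ 3 / (t + 3)

/-- The map `t_12 ↦ t_4(3τ)`. -/
noncomputable def v43 (t : ℂ) : ℂ := t ^ 3 * (t + 4) / (t + 3) ^ 3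

/-- The map `t_10 ↦ t_5(τ)`. -/
noncomputable def u52 (t : ℂ) : ℂ := t * (t + 5) ^ 2 / (t + 4)

/-- The map `t_10 ↦ t_5(2τ)`. -/
noncomputable def v52 (t : ℂ) : ℂ := t ^ 2 * (t + 5) / (t + 4) ^ 2

/-- The map `t_25 ↦ t_5(τ)`. -/
noncomputable def u55 (t : ℂ) : ℂ := t * (t ^ 4 + 5 * t ^ 3 + 15 * t ^ 2 + 25 * t + 25)

/-- The map `t_25 ↦ t_5(5τ)`. -/
noncomputable def v55 (t : ℂ) : ℂ := t ^ 5 / (t ^ 4 + 5 * t ^ 3 + 15 * t ^ 2 + 25 * t + 25)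

/-- The map `t_12 ↦ t_6(τ)`. -/
noncomputable def u62 (t : ℂ) : ℂ := t * (t + 6)

/-- The map `t_12 ↦ t_6(2τ)`. -/
noncomputable def v62 (t : ℂ) : ℂ := t ^ 2 / (t + 2)

/-- The map `t_18 ↦ t_6(τ)`. -/
noncomputable def u63 (t : ℂ) : ℂ := t * (t ^ 2 + 6 * t + 12)

/-- The map `t_18 ↦ t_6(3τ)`. -/
noncomputable def v63 (t : ℂ) : ℂ := t ^ 3 / (t ^ 2 + 3 * t + 3)

/-- The map `t_16 ↦ t_8(τ)`. -/
noncomputable def u82 (t : ℂ) : ℂ := t * (t + 4)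

/-- The map `t_16 ↦ t_8(2τ)`. -/
noncomputable def v82 (t : ℂ) : ℂ := t ^ 2 / (t + 2)

/-- The map `t_18 ↦ t_9(τ)`. -/
noncomputable def u92 (t : ℂ) : ℂ := t * (t + 3) ^ 2 / (t + 2)

/-- The map `t_18 ↦ t_9(2τ)`. -/
noncomputable def v92 (t : ℂ) : ℂ := t ^ 2 * (t + 3) / (t + 2) ^ 2

/-! ### Factorizations of shifted maps, and commutation relations -/

theorem u42_add_sixteen {t : ℂ} : u42 t + 16 = (t + 4) ^ 2 := by
  rw [u42]
  ring

theorem v42_add_sixteen {t : ℂ} (h4 : t + 4 ≠ 0) : v42 t + 16 = (t + 8) ^ 2 / (t + 4) := by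
  rw [v42]
  field_simp
  ring

theorem u43_add_sixteen {t : ℂ} (h3 : t + 3 ≠ 0) : u43 t + 16 = (t + 2) ^ 3 * (t + 6) / (t + 3) := by
  rw [u43]
  field_simp
  ring

theorem v43_add_sixteen {t : ℂ} (h3 : t + 3 ≠ 0) : v43 t + 16 = (t + 2) * (t + 6) ^ 3 / (t + 3) ^ 3 := by
  rw [v43]
  field_simp
  ring

theorem u62_add_nine {t : ℂ} : u62 t + 9 = (t + 3) ^ 2 := by
  rw [u62]
  ring

theorem v62_add_nine {t : ℂ} (h2 : t + 2 ≠ 0) : v62 t + 9 = (t + 3) * (t + 6) / (t + 2) := by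
  rw [v62]
  field_simp
  ring

theorem u62_add_eight {t : ℂ} : u62 t + 8 = (t + 2) * (t + 4) := by
  rw [u62]
  ring

theorem v62_add_eight {t : ℂ} (h2 : t + 2 ≠ 0) : v62 t + 8 = (t + 4) ^ 2 / (t + 2) := by
  rw [v62]
  field_simp
  ring

theorem u63_add_nine {t : ℂ} : u63 t + 9 = (t + 3) * (t ^ 2 + 3 * t + 3) := by
  rw [u63]
  ring

theorem v63_add_nine {t : ℂ} (hq1 : t ^ 2 + 3 * t + 3 ≠ 0) : v63 t + 9 = (t + 3) ^ 3 / (t ^ 2 + 3 * t + 3) := by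
  have hq1' : t * (t + 3) + 3 ≠ 0 := by convert hq1 using 1; ring
  rw [v63]
  field_simp
  ring

theorem u63_add_eight {t : ℂ} : u63 t + 8 = (t + 2) ^ 3 := by
  rw [u63]
  ring

theorem v63_add_eight {t : ℂ} (hq1 : t ^ 2 + 3 * t + 3 ≠ 0) : v63 t + 8 = (t + 2) * (t ^ 2 + 6 * t + 12) / (t ^ 2 + 3 * t + 3) := by
  have hq1' : t * (t + 3) + 3 ≠ 0 := by convert hq1 using 1; ring
  rw [v63]
  field_simp
  ring

theorem u82_add_four {t : ℂ} : u82 t + 4 = (t + 2) ^ 2 := by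
  rw [u82]
  ring

theorem v82_add_four {t : ℂ} (h2 : t + 2 ≠ 0) : v82 t + 4 = (t ^ 2 + 4 * t + 8) / (t + 2) := by
  rw [v82]
  field_simp
  ring

theorem u82_add_eight {t : ℂ} : u82 t + 8 = t ^ 2 + 4 * t + 8 := by
  rw [u82]
  ring

theorem v82_add_eight {t : ℂ} (h2 : t + 2 ≠ 0) : v82 t + 8 = (t + 4) ^ 2 / (t + 2) := by
  rw [v82]
  field_simp
  ring

theorem u92_quadratic {t : ℂ} (h2 : t + 2 ≠ 0) : u92 t ^ 2 + 9 * u92 t + 27 =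
      (t ^ 2 + 3 * t + 3) ^ 2 * (t ^ 2 + 6 * t + 12) / (t + 2) ^ 2 := by
  rw [u92]
  field_simp
  ring

theorem v92_quadratic {t : ℂ} (h2 : t + 2 ≠ 0) : v92 t ^ 2 + 9 * v92 t + 27 =
      (t ^ 2 + 3 * t + 3) * (t ^ 2 + 6 * t + 12) ^ 2 / (t + 2) ^ 4 := by
  rw [v92]
  field_simp
  ring

/-- Both sides are `t_2(2τ)` as a function of `t_8`. Each relation below likewise writes one
function `t_M(dτ)` in two ways; the proofs are identities of rational functions, reduced to
monomials by the factorizations above. -/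
theorem v22_u42 {t : ℂ} (h4 : t + 4 ≠ 0) : v22 (u42 t) = u22 (v42 t) := by
  simp only [v22, u22, u42_add_sixteen]
  rw [u42, v42]
  field_simp
  ring

theorem u22_u43 {t : ℂ} (h3 : t + 3 ≠ 0) : u22 (u43 t) = u23 (u62 t) := by
  simp only [u22, u23, u43_add_sixteen h3, u62_add_nine, u62_add_eight]
  rw [u43, u62]
  field_simp

theorem v22_u43 {t : ℂ} (h2 : t + 2 ≠ 0) (h3 : t + 3 ≠ 0) (h6 : t + 6 ≠ 0) : v22 (u43 t) = u23 (v62 t) := by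
  simp only [v22, u23, u43_add_sixteen h3, v62_add_eight h2, v62_add_nine h2]
  rw [u43, v62]
  field_simp

theorem v23_u62 {t : ℂ} (h3 : t + 3 ≠ 0) : v23 (u62 t) = u22 (v43 t) := by
  simp only [v23, u22, u62_add_nine, u62_add_eight, v43_add_sixteen h3]
  rw [u62, v43]
  field_simp

theorem v22_v43 {t : ℂ} (h2 : t + 2 ≠ 0) (h3 : t + 3 ≠ 0) (h6 : t + 6 ≠ 0) : v22 (v43 t) = v23 (v62 t) := by
  simp only [v22, v23, v43_add_sixteen h3, v62_add_eight h2, v62_add_nine h2]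
  rw [v43, v62]
  field_simp

theorem v23_u63 {t : ℂ} (h3 : t + 3 ≠ 0) (hq1 : t ^ 2 + 3 * t + 3 ≠ 0) : v23 (u63 t) = u23 (v63 t) := by
  simp only [v23, u23, u63_add_nine, u63_add_eight, v63_add_eight hq1, v63_add_nine hq1]
  rw [u63, v63]
  field_simp

theorem v32_u62 {t : ℂ} (h2 : t + 2 ≠ 0) (h4 : t + 4 ≠ 0) : v32 (u62 t) = u32 (v62 t) := by
  simp only [v32, u32, u62_add_nine, u62_add_eight, v62_add_eight h2, v62_add_nine h2]
  rw [u62, v62]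
  field_simp

theorem v33_u92 {t : ℂ} (h2 : t + 2 ≠ 0) (hq1 : t ^ 2 + 3 * t + 3 ≠ 0) : v33 (u92 t) = u32 (v63 t) := by
  simp only [v33, u32, u92_quadratic h2, v63_add_eight hq1, v63_add_nine hq1]
  rw [u92, v63]
  field_simp

theorem v33_v92 {t : ℂ} (h2 : t + 2 ≠ 0) (hq1 : t ^ 2 + 3 * t + 3 ≠ 0) : v33 (v92 t) = v32 (v63 t) := by
  simp only [v33, v32, v92_quadratic h2, v63_add_eight hq1, v63_add_nine hq1]
  rw [v92, v63]
  field_simp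

theorem u33_u92 {t : ℂ} (h2 : t + 2 ≠ 0) : u33 (u92 t) = u32 (u63 t) := by
  simp only [u33, u32, u92_quadratic h2, u63_add_eight, u63_add_nine]
  rw [u92, u63]
  field_simp

theorem v32_u63 {t : ℂ} (h2 : t + 2 ≠ 0) : v32 (u63 t) = u33 (v92 t) := by
  simp only [v32, u33, v92_quadratic h2, u63_add_eight, u63_add_nine]
  rw [u63, v92]
  field_simp

theorem v42_u82 {t : ℂ} (h2 : t + 2 ≠ 0) : v42 (u82 t) = u42 (v82 t) := by
  simp only [v42, u42, u82_add_four, v82_add_eight h2]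
  rw [u82, v82]
  field_simp

end GenusZero

/-! ### Modular equations of composite level and degree -/

namespace GenusZero

open Filter

/-- The twelfth power of `h₄`. -/
noncomputable def hpow₄ (s : ℂ) : ℂ := hpow₂ (u22 s)

/-- The twelfth power of `h₈`. -/
noncomputable def hpow₈ (s : ℂ) : ℂ := hpow₄ (u42 s)

/-- The twelfth power of `h₉`. -/
noncomputable def hpow₉ (s : ℂ) : ℂ := hpow₃ (u33 s)

/-- The twelfth power of `h₆`. -/
noncomputable def hpow₆ (s : ℂ) : ℂ := (9 / (s + 9)) ^ 3 * hpow₂ (u23 s)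

theorem hpow₂_u22 : ∀ᶠ t in 𝓝 (0 : ℂ), hpow₂ (u22 t) = 2 ^ 12 / (t + 16) ^ 3 * hpow₂ (v22 t) :=
  hpow_two_two

theorem hpow₂_u23 : ∀ᶠ t in 𝓝 (0 : ℂ), hpow₂ (u23 t) = 3 ^ 12 / (t + 9) ^ 6 * hpow₂ (v23 t) :=
  hpow_two_three

theorem hpow₂_u25 : ∀ᶠ t in 𝓝 (0 : ℂ), hpow₂ (u25 t) = 5 ^ 12 / (t + 5) ^ 12 * hpow₂ (v25 t) :=
  hpow_two_five

theorem hpow₃_u32 : ∀ᶠ t in 𝓝 (0 : ℂ), hpow₃ (u32 t) = 2 ^ 12 / (t + 8) ^ 4 * hpow₃ (v32 t) :=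
  hpow_three_two

theorem hpow₃_u33 : ∀ᶠ t in 𝓝 (0 : ℂ),
    hpow₃ (u33 t) = 3 ^ 12 / (t ^ 2 + 9 * t + 27) ^ 4 * hpow₃ (v33 t) :=
  hpow_three_three

theorem hpow₅_u52 : ∀ᶠ t in 𝓝 (0 : ℂ), hpow₅ (u52 t) = 2 ^ 12 / (t + 4) ^ 6 * hpow₅ (v52 t) :=
  hpow_five_two

theorem hpow₅_u55 : ∀ᶠ t in 𝓝 (0 : ℂ), hpow₅ (u55 t) =
    5 ^ 12 / (t ^ 4 + 5 * t ^ 3 + 15 * t ^ 2 + 25 * t + 25) ^ 6 * hpow₅ (v55 t) :=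
  hpow_five_five

theorem tendsto_u22 : Tendsto u22 (𝓝 0) (𝓝 0) := by
  have h : ContinuousAt u22 0 := by
    unfold u22
    fun_prop (disch := norm_num)
  simpa [ContinuousAt, u22] using h

theorem tendsto_v22 : Tendsto v22 (𝓝 0) (𝓝 0) := by
  have h : ContinuousAt v22 0 := by
    unfold v22
    fun_prop (disch := norm_num)
  simpa [ContinuousAt, v22] using h

theorem tendsto_u23 : Tendsto u23 (𝓝 0) (𝓝 0) := by
  have h : ContinuousAt u23 0 := by
    unfold u23
    fun_prop (disch := norm_num)
  simpa [ContinuousAt, u23] using h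

theorem tendsto_v23 : Tendsto v23 (𝓝 0) (𝓝 0) := by
  have h : ContinuousAt v23 0 := by
    unfold v23
    fun_prop (disch := norm_num)
  simpa [ContinuousAt, v23] using h

theorem tendsto_u25 : Tendsto u25 (𝓝 0) (𝓝 0) := by
  have h : ContinuousAt u25 0 := by
    unfold u25
    fun_prop (disch := norm_num)
  simpa [ContinuousAt, u25] using h

theorem tendsto_v25 : Tendsto v25 (𝓝 0) (𝓝 0) := by
  have h : ContinuousAt v25 0 := by
    unfold v25
    fun_prop (disch := norm_num)
  simpa [ContinuousAt, v25] using h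

theorem tendsto_u32 : Tendsto u32 (𝓝 0) (𝓝 0) := by
  have h : ContinuousAt u32 0 := by
    unfold u32
    fun_prop (disch := norm_num)
  simpa [ContinuousAt, u32] using h

theorem tendsto_v32 : Tendsto v32 (𝓝 0) (𝓝 0) := by
  have h : ContinuousAt v32 0 := by
    unfold v32
    fun_prop (disch := norm_num)
  simpa [ContinuousAt, v32] using h

theorem tendsto_u33 : Tendsto u33 (𝓝 0) (𝓝 0) := by
  have h : ContinuousAt u33 0 := by
    unfold u33
    fun_prop (disch := norm_num)
  simpa [ContinuousAt, u33] using h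

theorem tendsto_v33 : Tendsto v33 (𝓝 0) (𝓝 0) := by
  have h : ContinuousAt v33 0 := by
    unfold v33
    fun_prop (disch := norm_num)
  simpa [ContinuousAt, v33] using h

theorem tendsto_u42 : Tendsto u42 (𝓝 0) (𝓝 0) := by
  have h : ContinuousAt u42 0 := by
    unfold u42
    fun_prop (disch := norm_num)
  simpa [ContinuousAt, u42] using h

theorem tendsto_v42 : Tendsto v42 (𝓝 0) (𝓝 0) := by
  have h : ContinuousAt v42 0 := by
    unfold v42
    fun_prop (disch := norm_num)
  simpa [ContinuousAt, v42] using h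

theorem tendsto_u43 : Tendsto u43 (𝓝 0) (𝓝 0) := by
  have h : ContinuousAt u43 0 := by
    unfold u43
    fun_prop (disch := norm_num)
  simpa [ContinuousAt, u43] using h

theorem tendsto_v43 : Tendsto v43 (𝓝 0) (𝓝 0) := by
  have h : ContinuousAt v43 0 := by
    unfold v43
    fun_prop (disch := norm_num)
  simpa [ContinuousAt, v43] using h

theorem tendsto_u52 : Tendsto u52 (𝓝 0) (𝓝 0) := by
  have h : ContinuousAt u52 0 := by
    unfold u52
    fun_prop (disch := norm_num)
  simpa [ContinuousAt, u52] using h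

theorem tendsto_v52 : Tendsto v52 (𝓝 0) (𝓝 0) := by
  have h : ContinuousAt v52 0 := by
    unfold v52
    fun_prop (disch := norm_num)
  simpa [ContinuousAt, v52] using h

theorem tendsto_u55 : Tendsto u55 (𝓝 0) (𝓝 0) := by
  have h : ContinuousAt u55 0 := by
    unfold u55
    fun_prop (disch := norm_num)
  simpa [ContinuousAt, u55] using h

theorem tendsto_v55 : Tendsto v55 (𝓝 0) (𝓝 0) := by
  have h : ContinuousAt v55 0 := by
    unfold v55
    fun_prop (disch := norm_num)
  simpa [ContinuousAt, v55] using h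

theorem tendsto_u62 : Tendsto u62 (𝓝 0) (𝓝 0) := by
  have h : ContinuousAt u62 0 := by
    unfold u62
    fun_prop (disch := norm_num)
  simpa [ContinuousAt, u62] using h

theorem tendsto_v62 : Tendsto v62 (𝓝 0) (𝓝 0) := by
  have h : ContinuousAt v62 0 := by
    unfold v62
    fun_prop (disch := norm_num)
  simpa [ContinuousAt, v62] using h

theorem tendsto_u63 : Tendsto u63 (𝓝 0) (𝓝 0) := by
  have h : ContinuousAt u63 0 := by
    unfold u63
    fun_prop (disch := norm_num)
  simpa [ContinuousAt, u63] using h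

theorem tendsto_v63 : Tendsto v63 (𝓝 0) (𝓝 0) := by
  have h : ContinuousAt v63 0 := by
    unfold v63
    fun_prop (disch := norm_num)
  simpa [ContinuousAt, v63] using h

theorem tendsto_u82 : Tendsto u82 (𝓝 0) (𝓝 0) := by
  have h : ContinuousAt u82 0 := by
    unfold u82
    fun_prop (disch := norm_num)
  simpa [ContinuousAt, u82] using h

theorem tendsto_v82 : Tendsto v82 (𝓝 0) (𝓝 0) := by
  have h : ContinuousAt v82 0 := by
    unfold v82
    fun_prop (disch := norm_num)
  simpa [ContinuousAt, v82] using h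

theorem tendsto_u92 : Tendsto u92 (𝓝 0) (𝓝 0) := by
  have h : ContinuousAt u92 0 := by
    unfold u92
    fun_prop (disch := norm_num)
  simpa [ContinuousAt, u92] using h

theorem tendsto_v92 : Tendsto v92 (𝓝 0) (𝓝 0) := by
  have h : ContinuousAt v92 0 := by
    unfold v92
    fun_prop (disch := norm_num)
  simpa [ContinuousAt, v92] using h

/-- The degree two equation of level `2` at `u42 t`, carried to level `4` by the commutation
relation for `t_2(2τ)`. -/
theorem hpow₄_u42 : ∀ᶠ t in 𝓝 (0 : ℂ), hpow₄ (u42 t) = 2 ^ 12 / (t + 4) ^ 6 * hpow₄ (v42 t) := by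
  filter_upwards [tendsto_u42.eventually hpow₂_u22, eventually_add_ne_zero (c := 4) (by norm_num)]
    with t e1 h4
  rw [hpow₄, hpow₄, e1, u42_add_sixteen, v22_u42 h4]
  field_simp

/-- The route from `t_12` to `t_2` is changed from `t_4` to `t_6`, where the degree three equation
of level `2` applies. -/
theorem hpow₄_u43 : ∀ᶠ t in 𝓝 (0 : ℂ), hpow₄ (u43 t) = 3 ^ 12 / (t + 3) ^ 12 * hpow₄ (v43 t) := by
  filter_upwards [tendsto_u62.eventually hpow₂_u23, eventually_add_ne_zero (c := 3) (by norm_num)]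
    with t e1 h3
  rw [hpow₄, hpow₄, u22_u43 h3, e1, u62_add_nine, v23_u62 h3]
  field_simp

/-- The opposite change of route, from `t_6` to `t_4`, gives access to the degree two equation. -/
theorem hpow₆_u62 : ∀ᶠ t in 𝓝 (0 : ℂ), hpow₆ (u62 t) = 2 ^ 12 / (t + 2) ^ 12 * hpow₆ (v62 t) := by
  filter_upwards [tendsto_u43.eventually hpow₂_u22, eventually_add_ne_zero (c := 2) (by norm_num), eventually_add_ne_zero (c := 3) (by norm_num), eventually_add_ne_zero (c := 6) (by norm_num)]
    with t e1 h2 h3 h6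
  rw [hpow₆, hpow₆, ← u22_u43 h3, e1, u43_add_sixteen h3, u62_add_nine, v62_add_nine h2, v22_u43 h2 h3 h6]
  field_simp

theorem hpow₆_u63 : ∀ᶠ t in 𝓝 (0 : ℂ), hpow₆ (u63 t) = 3 ^ 12 / (t ^ 2 + 3 * t + 3) ^ 12 * hpow₆ (v63 t) := by
  filter_upwards [tendsto_u63.eventually hpow₂_u23, eventually_add_ne_zero (c := 3) (by norm_num), eventually_quadratic_ne_zero 3 (c := 3) (by norm_num)]
    with t e1 h3 q1
  have hq1 : t ^ 2 + 3 * t + 3 ≠ 0 := by convert q1 using 1; ring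
  rw [hpow₆, hpow₆, e1, u63_add_nine, v63_add_nine hq1, v23_u63 h3 hq1]
  field_simp

theorem hpow₈_u82 : ∀ᶠ t in 𝓝 (0 : ℂ), hpow₈ (u82 t) = 2 ^ 12 / (t + 2) ^ 12 * hpow₈ (v82 t) := by
  filter_upwards [tendsto_u82.eventually hpow₄_u42, eventually_add_ne_zero (c := 2) (by norm_num)]
    with t e1 h2
  rw [hpow₈, hpow₈, e1, u82_add_four, v42_u82 h2]
  field_simp

/-- `t_3(τ)` is reached from `t_18` through `t_6` instead of `t_9`, so that the degree two equation
of level `3` applies. -/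
theorem hpow₉_u92 : ∀ᶠ t in 𝓝 (0 : ℂ), hpow₉ (u92 t) = 2 ^ 12 / (t + 2) ^ 12 * hpow₉ (v92 t) := by
  filter_upwards [tendsto_u63.eventually hpow₃_u32, eventually_add_ne_zero (c := 2) (by norm_num)]
    with t e1 h2
  rw [hpow₉, hpow₉, u33_u92 h2, e1, u63_add_eight, v32_u63 h2]
  field_simp

/-! ### Composite degrees, by chaining equations of smaller degree -/

theorem hpow₂_u24 : ∀ᶠ t in 𝓝 (0 : ℂ), 
    hpow₂ (u22 (u42 t)) = 4 ^ 12 / ((t + 4) ^ 3 * (t + 8) ^ 6) * hpow₂ (v22 (v42 t)) := by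
  filter_upwards [tendsto_u42.eventually hpow₂_u22, tendsto_v42.eventually hpow₂_u22, eventually_add_ne_zero (c := 4) (by norm_num), eventually_add_ne_zero (c := 8) (by norm_num)]
    with t e1 e2 h4 h8
  rw [e1, u42_add_sixteen, v22_u42 h4, e2, v42_add_sixteen h4]
  field_simp
  ring

/-- The chain runs through `t_2(τ)`, `t_2(3τ)`, `t_2(6τ)`; the middle value is both `v23 (u62 t)`
and `u22 (v43 t)`, where the degree three step ends and the degree two step starts. -/
theorem hpow₂_u26 : ∀ᶠ t in 𝓝 (0 : ℂ), hpow₂ (u23 (u62 t)) =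
    6 ^ 12 / ((t + 2) ^ 3 * (t + 3) ^ 3 * (t + 6) ^ 9) * hpow₂ (v23 (v62 t)) := by
  filter_upwards [tendsto_u62.eventually hpow₂_u23, tendsto_v43.eventually hpow₂_u22, eventually_add_ne_zero (c := 2) (by norm_num), eventually_add_ne_zero (c := 3) (by norm_num), eventually_add_ne_zero (c := 6) (by norm_num)]
    with t e1 e2 h2 h3 h6
  rw [e1, u62_add_nine, v23_u62 h3, e2, v43_add_sixteen h3, v22_v43 h2 h3 h6]
  field_simp
  ring

theorem hpow₂_u26' : ∀ᶠ t in 𝓝 (0 : ℂ), hpow₂ (u22 (u43 t)) =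
    6 ^ 12 / ((t + 2) ^ 3 * (t + 3) ^ 3 * (t + 6) ^ 9) * hpow₂ (v22 (v43 t)) := by
  filter_upwards [hpow₂_u26, eventually_add_ne_zero (c := 2) (by norm_num), eventually_add_ne_zero (c := 3) (by norm_num), eventually_add_ne_zero (c := 6) (by norm_num)]
    with t e1 h2 h3 h6
  rw [u22_u43 h3, e1, v22_v43 h2 h3 h6]

theorem hpow₂_u28 : ∀ᶠ t in 𝓝 (0 : ℂ), hpow₂ (u22 (u42 (u82 t))) =
    8 ^ 12 / ((t + 2) ^ 3 * (t + 4) ^ 12 * (t ^ 2 + 4 * t + 8) ^ 3) * hpow₂ (v22 (v42 (v82 t))) := by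
  filter_upwards [tendsto_u82.eventually hpow₂_u24, tendsto_v82.eventually (tendsto_v42.eventually hpow₂_u22), eventually_add_ne_zero (c := 2) (by norm_num), eventually_add_ne_zero (c := 4) (by norm_num), eventually_quadratic_ne_zero 4 (c := 8) (by norm_num)]
    with t e1 e2 h2 h4 q3
  have hq3 : t ^ 2 + 4 * t + 8 ≠ 0 := by convert q3 using 1; ring
  have h5 : v82 t + 4 ≠ 0 := by
    rw [v82_add_four h2]
    exact div_ne_zero hq3 h2
  rw [e1, u82_add_four, u82_add_eight, v42_u82 h2, v22_u42 h5, e2,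
    v42_add_sixteen h5, v82_add_four h2, v82_add_eight h2]
  field_simp
  ring

theorem hpow₂_u29 : ∀ᶠ t in 𝓝 (0 : ℂ), hpow₂ (u23 (u63 t)) = 9 ^ 12 / (t + 3) ^ 24 * hpow₂ (v23 (v63 t)) := by
  filter_upwards [tendsto_u63.eventually hpow₂_u23, tendsto_v63.eventually hpow₂_u23, eventually_add_ne_zero (c := 3) (by norm_num), eventually_quadratic_ne_zero 3 (c := 3) (by norm_num)]
    with t e1 e2 h3 q1
  have hq1 : t ^ 2 + 3 * t + 3 ≠ 0 := by convert q1 using 1; ring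
  rw [e1, u63_add_nine, v23_u63 h3 hq1, e2, v63_add_nine hq1]
  field_simp
  ring

theorem hpow₃_u34 : ∀ᶠ t in 𝓝 (0 : ℂ), hpow₃ (u32 (u62 t)) = 4 ^ 12 / (t + 4) ^ 12 * hpow₃ (v32 (v62 t)) := by
  filter_upwards [tendsto_u62.eventually hpow₃_u32, tendsto_v62.eventually hpow₃_u32, eventually_add_ne_zero (c := 2) (by norm_num), eventually_add_ne_zero (c := 4) (by norm_num)]
    with t e1 e2 h2 h4
  rw [e1, u62_add_eight, v32_u62 h2 h4, e2, v62_add_eight h2]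
  field_simp
  ring

/-- The chain runs through `t_3(τ)`, `t_3(3τ)`, `t_3(6τ)`, with middle value `v33 (u92 t) = u32 (v63
t)`. -/
theorem hpow₃_u36 : ∀ᶠ t in 𝓝 (0 : ℂ), hpow₃ (u33 (u92 t)) =
    6 ^ 12 / ((t ^ 2 + 3 * t + 3) * (t ^ 2 + 6 * t + 12) ^ 2 / (t + 2)) ^ 4 *
      hpow₃ (v33 (v92 t)) := by
  filter_upwards [tendsto_u92.eventually hpow₃_u33, tendsto_v63.eventually hpow₃_u32, eventually_add_ne_zero (c := 2) (by norm_num), eventually_quadratic_ne_zero 3 (c := 3) (by norm_num), eventually_quadratic_ne_zero 6 (c := 12) (by norm_num)]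
    with t e1 e2 h2 q1 q2
  have hq1 : t ^ 2 + 3 * t + 3 ≠ 0 := by convert q1 using 1; ring
  have hq2 : t ^ 2 + 6 * t + 12 ≠ 0 := by convert q2 using 1; ring
  rw [e1, u92_quadratic h2, v33_u92 h2 hq1, e2, v63_add_eight hq1, v33_v92 h2 hq1]
  field_simp
  ring

theorem hpow₃_u36' : ∀ᶠ t in 𝓝 (0 : ℂ), hpow₃ (u32 (u63 t)) =
    6 ^ 12 / ((t ^ 2 + 3 * t + 3) * (t ^ 2 + 6 * t + 12) ^ 2 / (t + 2)) ^ 4 *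
      hpow₃ (v32 (v63 t)) := by
  filter_upwards [hpow₃_u36, eventually_add_ne_zero (c := 2) (by norm_num), eventually_quadratic_ne_zero 3 (c := 3) (by norm_num)]
    with t e1 h2 q1
  have hq1 : t ^ 2 + 3 * t + 3 ≠ 0 := by convert q1 using 1; ring
  rw [← u33_u92 h2, e1, v33_v92 h2 hq1]

theorem hpow₄_u44 : ∀ᶠ t in 𝓝 (0 : ℂ), hpow₄ (u42 (u82 t)) =
    4 ^ 12 / ((t + 2) * (t ^ 2 + 4 * t + 8)) ^ 6 * hpow₄ (v42 (v82 t)) := by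
  filter_upwards [tendsto_u82.eventually hpow₄_u42, tendsto_v82.eventually hpow₄_u42, eventually_add_ne_zero (c := 2) (by norm_num), eventually_quadratic_ne_zero 4 (c := 8) (by norm_num)]
    with t e1 e2 h2 q3
  have hq3 : t ^ 2 + 4 * t + 8 ≠ 0 := by convert q3 using 1; ring
  rw [e1, u82_add_four, v42_u82 h2, e2, v82_add_four h2]
  field_simp
  ring

end GenusZero

/-! ### From twelfth powers to the functions `h_M` -/

namespace GenusZero

open Filter Polynomial

/-- Continuous branches of the same twelfth power agree near a point where both are `1`. -/
theorem eventually_eq_of_pow_twelve {X Y : ℂ → ℂ} (hX : ContinuousAt X 0) (hY : ContinuousAt Y 0)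
    (hX0 : X 0 = 1) (hY0 : Y 0 = 1) (h : ∀ᶠ t in 𝓝 (0 : ℂ), X t ^ 12 = Y t ^ 12) :
    ∀ᶠ t in 𝓝 (0 : ℂ), X t = Y t := by
  -- `X^12 - Y^12` is `X - Y` times this sum, which is `12` at `t = 0` and hence nonzero nearby.
  have hS : ContinuousAt (fun t => ∑ i ∈ Finset.range 12, X t ^ i * Y t ^ (12 - 1 - i)) 0 := by
    fun_prop
  have hS0 : (fun t => ∑ i ∈ Finset.range 12, X t ^ i * Y t ^ (12 - 1 - i)) 0 ≠ 0 := by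
    simp [hX0, hY0]
  filter_upwards [h, hS.eventually_ne hS0] with t ht hne
  have := geom_sum₂_mul (X t) (Y t) 12
  rw [ht, sub_self] at this
  exact sub_eq_zero.mp ((mul_eq_zero.mp this).resolve_left hne)

/-- Since `a ≥ 0`, the principal root of `a ^ n` is `a`; this makes the multipliers of the table
equal to `1` at `t = 0`. -/
theorem pow_cpow_neg_inv (a n : ℕ) (hn : n ≠ 0) :
    (((a : ℂ) ^ n) ^ (-1 / n : ℂ)) = (a : ℂ)⁻¹ := by
  have harg : (a : ℂ).arg = 0 := by
    rw [← Complex.ofReal_natCast]; exact Complex.arg_ofReal_of_nonneg (Nat.cast_nonneg a)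
  have hpi : 0 < Real.pi / n := by positivity
  rw [neg_div, one_div, Complex.cpow_neg, Complex.pow_cpow_nat_inv hn (by rw [harg]; linarith)
    (by rw [harg]; linarith)]

theorem hFun_eq_hyp (P Q : ℂ[X]) (t : ℂ) : hFun P Q t =
    (P.eval t / P.eval 0) ^ (-1 / 12 : ℂ) * hyp (1728 * Q.eval t / P.eval t) := by
  have e : (1728 : ℂ) = 12 ^ 3 := by norm_num
  rw [e]
  rfl

theorem hFun_zero {P Q : ℂ[X]} (hP : P.eval 0 ≠ 0) (hQ : Q.eval 0 = 0) : hFun P Q 0 = 1 := by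
  simp [hFun_eq_hyp, hP, hQ, hyp_zero]

theorem continuousAt_hFun {P Q : ℂ[X]} (hP : P.eval 0 ≠ 0) (hQ : Q.eval 0 = 0) :
    ContinuousAt (hFun P Q) 0 := by
  have h1 : ContinuousAt (fun t : ℂ => 1728 * Q.eval t / P.eval t) 0 := by
    fun_prop (disch := exact hP)
  have h2 : ContinuousAt hyp (1728 * Q.eval 0 / P.eval 0) := by
    rw [hQ, mul_zero, zero_div]
    exact (analyticAt_hyp (by simp)).continuousAt
  have h3 : ContinuousAt (fun t : ℂ => P.eval t / P.eval 0) 0 := by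
    fun_prop (disch := exact hP)
  have h4 : ContinuousAt (fun t : ℂ => (P.eval t / P.eval 0) ^ (-1 / 12 : ℂ)) 0 := by
    refine ContinuousAt.cpow h3 continuousAt_const ?_
    rw [div_self hP]
    exact Complex.one_mem_slitPlane
  rw [funext (hFun_eq_hyp P Q)]
  exact h4.mul (ContinuousAt.comp (f := fun t : ℂ => 1728 * Q.eval t / P.eval t) h2 h1)

theorem hFun_pow_twelve (P Q : ℂ[X]) (t : ℂ) :
    hFun P Q t ^ 12 = P.eval 0 / P.eval t * hyp (1728 * Q.eval t / P.eval t) ^ 12 := by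
  have h := cpow_neg_div_pow (P.eval t / P.eval 0) 12 1 (by norm_num)
  rw [pow_one, inv_div, Nat.cast_ofNat] at h
  rw [hFun_eq_hyp, mul_pow, ← h]

/-- A modular equation for `h_M` follows from its twelfth power. -/
theorem hFun_eq_of_pow {P Q : ℂ[X]} (hP : P.eval 0 ≠ 0) (hQ : Q.eval 0 = 0) {u v m G μ : ℂ → ℂ}
    (hu : Tendsto u (𝓝 0) (𝓝 0)) (hv : Tendsto v (𝓝 0) (𝓝 0))
    (hm : ContinuousAt m 0) (hm0 : m 0 = 1)
    (hG : ∀ᶠ t in 𝓝 (0 : ℂ), hFun P Q t ^ 12 = G t)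
    (hmμ : ∀ t, m t ^ 12 = μ t) (h : ∀ᶠ t in 𝓝 (0 : ℂ), G (u t) = μ t * G (v t)) :
    ∀ᶠ t in 𝓝 (0 : ℂ), hFun P Q (u t) = m t * hFun P Q (v t) := by
  have hu0 : u 0 = 0 := tendsto_nhds_unique_of_eventuallyEq
    (tendsto_pure_nhds u 0) (hu.mono_left (pure_le_nhds 0)) EventuallyEq.rfl
  have hv0 : v 0 = 0 := tendsto_nhds_unique_of_eventuallyEq
    (tendsto_pure_nhds v 0) (hv.mono_left (pure_le_nhds 0)) EventuallyEq.rfl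
  have hF := continuousAt_hFun hP hQ
  have hc (w : ℂ → ℂ) (hw : Tendsto w (𝓝 0) (𝓝 0)) (hw0 : w 0 = 0) :
      ContinuousAt (fun t => hFun P Q (w t)) 0 := by
    have hw' : ContinuousAt w 0 := by rw [ContinuousAt, hw0]; exact hw
    exact ContinuousAt.comp (g := hFun P Q) (by rwa [hw0]) hw'
  refine eventually_eq_of_pow_twelve (hc u hu hu0) (hm.mul (hc v hv hv0)) ?_ ?_ ?_
  · rw [hu0, hFun_zero hP hQ]
  · rw [hm0, hv0, hFun_zero hP hQ, one_mul]
  · filter_upwards [h, hu.eventually hG, hv.eventually hG] with t ht htu htv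
    rw [mul_pow, htu, htv, hmμ, ht]

/-- For the rows with a fractional power. The value `f 0 = a ^ n` both normalizes the multiplier and
keeps `f` off the branch cut near `0`. -/
theorem hFun_eq_of_pow_cpow {P Q : ℂ[X]} (hP : P.eval 0 ≠ 0) (hQ : Q.eval 0 = 0) {u v f G : ℂ → ℂ}
    (a n k : ℕ) (ha : a ≠ 0) (hnk : n * k = 12) (hu : Tendsto u (𝓝 0) (𝓝 0))
    (hv : Tendsto v (𝓝 0) (𝓝 0)) (hf : ContinuousAt f 0) (hf0 : f 0 = (a : ℂ) ^ n)
    (hG : ∀ᶠ t in 𝓝 (0 : ℂ), hFun P Q t ^ 12 = G t)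
    (h : ∀ᶠ t in 𝓝 (0 : ℂ), G (u t) = a ^ 12 / f t ^ k * G (v t)) :
    ∀ᶠ t in 𝓝 (0 : ℂ), hFun P Q (u t) = a * f t ^ (-1 / n : ℂ) * hFun P Q (v t) := by
  have hn : n ≠ 0 := by rintro rfl; simp at hnk
  refine hFun_eq_of_pow hP hQ hu hv (m := fun t => a * f t ^ (-1 / n : ℂ)) ?_ ?_ hG (fun t => ?_) h
  · refine continuousAt_const.mul (ContinuousAt.cpow hf continuousAt_const ?_)
    rw [hf0, ← Nat.cast_pow]
    exact Complex.natCast_mem_slitPlane.mpr (pow_ne_zero _ ha)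
  · rw [hf0, pow_cpow_neg_inv _ _ hn, mul_inv_cancel₀ (Nat.cast_ne_zero.mpr ha)]
  · rw [mul_pow, ← hnk, cpow_neg_div_pow _ _ _ hn, div_eq_mul_inv]

theorem hFun_eq_of_pow_inv {P Q : ℂ[X]} (hP : P.eval 0 ≠ 0) (hQ : Q.eval 0 = 0) {u v f G : ℂ → ℂ}
    (a : ℕ) (ha : a ≠ 0) (hu : Tendsto u (𝓝 0) (𝓝 0))
    (hv : Tendsto v (𝓝 0) (𝓝 0)) (hf : ContinuousAt f 0) (hf0 : f 0 = a)
    (hG : ∀ᶠ t in 𝓝 (0 : ℂ), hFun P Q t ^ 12 = G t)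
    (h : ∀ᶠ t in 𝓝 (0 : ℂ), G (u t) = a ^ 12 / f t ^ 12 * G (v t)) :
    ∀ᶠ t in 𝓝 (0 : ℂ), hFun P Q (u t) = a * (f t)⁻¹ * hFun P Q (v t) := by
  have ha' : (a : ℂ) ≠ 0 := Nat.cast_ne_zero.mpr ha
  refine hFun_eq_of_pow hP hQ hu hv (m := fun t => a * (f t)⁻¹) ?_ ?_ hG (fun t => ?_) h
  · exact continuousAt_const.mul (hf.inv₀ (by rwa [hf0]))
  · rw [hf0, mul_inv_cancel₀ ha']
  · rw [mul_pow, inv_pow, div_eq_mul_inv]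

theorem hFun_C_mul (P Q : ℂ[X]) {c : ℂ} (hc : c ≠ 0) : hFun (C c * P) (C c * Q) = hFun P Q := by
  funext t
  have : (12 : ℂ) ^ 3 * (c * Q.eval t) / (c * P.eval t) = 12 ^ 3 * Q.eval t / P.eval t := by
    rw [mul_left_comm, mul_div_mul_left _ _ hc]
  simp only [hFun, eval_mul, eval_C, mul_div_mul_left _ _ hc, this]

/-- `j` determines `P / Q`, hence `h_M`. -/
theorem IsCovering.hFun_eq {M : ℕ} {P Q P₀ Q₀ : ℂ[X]} (h : IsCovering M P Q)
    (h₀ : IsCovering M P₀ Q₀) (hP₀ : P₀ ≠ 0)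
    (hinf : (Set.range fun τ : ℍ => hauptmodul M τ).Infinite) : hFun P Q = hFun P₀ Q₀ := by
  -- Cross-multiplication with `j` holds at every value of `t_M`, hence identically. Coprimality on
  -- both sides then makes `P` and `P₀` associated.
  have key : P * Q₀ = P₀ * Q := by
    refine Polynomial.eq_of_infinite_eval_eq _ _ (hinf.mono ?_)
    rintro _ ⟨τ, rfl⟩
    simp only [Set.mem_ofPred_eq, eval_mul, ← h.2 τ, ← h₀.2 τ]
    ring
  have d1 : P ∣ P₀ := h.1.dvd_of_dvd_mul_right (Dvd.intro _ key)
  have d2 : P₀ ∣ P := h₀.1.dvd_of_dvd_mul_right (Dvd.intro _ key.symm)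
  obtain ⟨e, rfl⟩ := associated_of_dvd_dvd d2 d1
  obtain ⟨c, hc, he⟩ := Polynomial.isUnit_iff.mp e.isUnit
  have hQ : Q = C c * Q₀ := by
    apply mul_left_cancel₀ hP₀
    rw [← key, ← he]; ring
  rw [← he, mul_comm, hQ, hFun_C_mul _ _ hc.ne_zero]

theorem isCoprime_of_eval {P Q : ℂ[X]} (h : ∀ z, Q.eval z = 0 → P.eval z ≠ 0) : IsCoprime P Q := by
  rw [Polynomial.isCoprime_iff_aeval_ne_zero_of_isAlgClosed (k := ℂ) (K := ℂ)]
  intro z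
  by_cases hz : Q.eval z = 0
  · exact Or.inl (by simpa using h z hz)
  · exact Or.inr (by simpa using hz)

end GenusZero

/-! ### The modular equations for `h_M` -/

namespace GenusZero

open Filter Polynomial

/-- The numerator of `j` as a rational function of `t_M`. -/
noncomputable def coverP : ℕ → ℂ[X]
  | 2 => (X + 16) ^ 3
  | 3 => (X + 27) * (X + 3) ^ 3
  | 4 => (X * (X + 16) + 16) ^ 3
  | 5 => (X ^ 2 + 10 * X + 5) ^ 3
  | 6 => (X * (X + 8) ^ 3 + 16 * (X + 9)) ^ 3
  | 8 => (X * (X + 8) * (X * (X + 8) + 16) + 16) ^ 3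
  | 9 => (X * (X ^ 2 + 9 * X + 27) + 27) * (X * (X ^ 2 + 9 * X + 27) + 3) ^ 3
  | _ => 0

/-- The denominator of `j` as a rational function of `t_M`. -/
noncomputable def coverQ : ℕ → ℂ[X]
  | 2 => X
  | 3 => X
  | 4 => X * (X + 16)
  | 5 => X
  | 6 => X * (X + 8) ^ 3 * (X + 9) ^ 2
  | 8 => X * (X + 8) * (X * (X + 8) + 16)
  | 9 => X * (X ^ 2 + 9 * X + 27)
  -- The default pair `0`, `1` is coprime, so `isCoprime_cover` holds for every `M`.
  | _ => 1

theorem isCoprime_cover (M : ℕ) : IsCoprime (coverP M) (coverQ M) := by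
  refine isCoprime_of_eval fun z => ?_
  unfold coverP coverQ
  split <;> simp only [eval_add, eval_mul, eval_pow, eval_X, eval_ofNat, eval_one, eval_zero]
  all_goals intro hz
  · norm_num [hz]
  · norm_num [hz]
  · norm_num [hz]
  · norm_num [hz]
  · simp only [mul_eq_zero, pow_eq_zero_iff (show 3 ≠ 0 by norm_num),
      pow_eq_zero_iff (show 2 ≠ 0 by norm_num)] at hz
    rcases hz with (rfl | h) | h
    · norm_num
    · rw [eq_neg_of_add_eq_zero_left h]; norm_num
    · rw [eq_neg_of_add_eq_zero_left h]; norm_num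
  · norm_num [hz]
  · norm_num [hz]
  · simp at hz

theorem hFun_cover_2 (t : ℂ) : hFun (coverP 2) (coverQ 2) t ^ 12 = hpow₂ t := by
  rw [hFun_pow_twelve]
  simp only [coverP, coverQ, eval_add, eval_pow, eval_X, eval_ofNat, hpow₂]
  congr 1
  norm_num [div_pow, div_mul_div_comm]

theorem hFun_cover_3 (t : ℂ) : hFun (coverP 3) (coverQ 3) t ^ 12 = hpow₃ t := by
  rw [hFun_pow_twelve]
  simp only [coverP, coverQ, eval_add, eval_mul, eval_pow, eval_X, eval_ofNat, hpow₃]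
  congr 1
  norm_num [div_pow, div_mul_div_comm]

theorem hFun_cover_4 (t : ℂ) : hFun (coverP 4) (coverQ 4) t ^ 12 = hpow₄ t := by
  rw [hFun_pow_twelve]
  simp only [coverP, coverQ, eval_add, eval_mul, eval_pow, eval_X, eval_ofNat, hpow₄, u22, hpow₂]
  congr 1
  norm_num [div_pow, div_mul_div_comm]

theorem hFun_cover_5 (t : ℂ) : hFun (coverP 5) (coverQ 5) t ^ 12 = hpow₅ t := by
  rw [hFun_pow_twelve]
  simp only [coverP, coverQ, eval_add, eval_mul, eval_pow, eval_X, eval_ofNat, hpow₅]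
  congr 1
  norm_num [div_pow, div_mul_div_comm]

theorem hFun_cover_8 (t : ℂ) : hFun (coverP 8) (coverQ 8) t ^ 12 = hpow₈ t := by
  rw [hFun_pow_twelve]
  simp only [coverP, coverQ, eval_add, eval_mul, eval_pow, eval_X, eval_ofNat, hpow₈, hpow₄, u22, u42, hpow₂]
  congr 1
  norm_num [div_pow, div_mul_div_comm]

theorem hFun_cover_9 (t : ℂ) : hFun (coverP 9) (coverQ 9) t ^ 12 = hpow₉ t := by
  rw [hFun_pow_twelve]
  simp only [coverP, coverQ, eval_add, eval_mul, eval_pow, eval_X, eval_ofNat, hpow₉, u33, hpow₃]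
  congr 1
  norm_num [div_pow, div_mul_div_comm]

/-- `u23` has the denominator `t + 9`, so the numerator of `j` over `t_6` is `(t + 9)³` times the
numerator over `t_2` at `u23 t`; this accounts for the factor `(9 / (t + 9))³` in `hpow₆`. -/
theorem hFun_cover_6 : ∀ᶠ t in 𝓝 (0 : ℂ), hFun (coverP 6) (coverQ 6) t ^ 12 = hpow₆ t := by
  filter_upwards [eventually_add_ne_zero (c := 9) (by norm_num)] with t h9
  have e := hpow₂_div (N := t * (t + 8) ^ 3) h9 rfl
  have hP : (coverP 6).eval t = (t * (t + 8) ^ 3 + 16 * (t + 9)) ^ 3 := by simp [coverP]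
  have hP0 : (coverP 6).eval 0 = 144 ^ 3 := by norm_num [coverP]
  have hQ : (coverQ 6).eval t = t * (t + 8) ^ 3 * (t + 9) ^ 2 := by simp [coverQ]
  have hc : (9 / (t + 9)) * (16 * (t + 9) / (t * (t + 8) ^ 3 + 16 * (t + 9))) =
      144 / (t * (t + 8) ^ 3 + 16 * (t + 9)) := by
    rw [← mul_div_assoc]
    congr 1
    field_simp
    norm_num
  rw [hFun_pow_twelve, hpow₆, u23, e, hP, hP0, hQ, ← mul_assoc _ (_ ^ 3), ← mul_pow, hc, div_pow,
    ← mul_assoc (1728 : ℂ), ← mul_assoc (1728 : ℂ)]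

theorem eval_zero_coverP_2 : (coverP 2).eval 0 ≠ 0 := by
  norm_num [coverP]

theorem eval_zero_coverQ_2 : (coverQ 2).eval 0 = 0 := by
  simp [coverQ]

theorem eval_zero_coverP_3 : (coverP 3).eval 0 ≠ 0 := by
  norm_num [coverP]

theorem eval_zero_coverQ_3 : (coverQ 3).eval 0 = 0 := by
  simp [coverQ]

theorem eval_zero_coverP_4 : (coverP 4).eval 0 ≠ 0 := by
  norm_num [coverP]

theorem eval_zero_coverQ_4 : (coverQ 4).eval 0 = 0 := by
  simp [coverQ]

theorem eval_zero_coverP_5 : (coverP 5).eval 0 ≠ 0 := by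
  norm_num [coverP]

theorem eval_zero_coverQ_5 : (coverQ 5).eval 0 = 0 := by
  simp [coverQ]

theorem eval_zero_coverP_6 : (coverP 6).eval 0 ≠ 0 := by
  norm_num [coverP]

theorem eval_zero_coverQ_6 : (coverQ 6).eval 0 = 0 := by
  simp [coverQ]

theorem eval_zero_coverP_8 : (coverP 8).eval 0 ≠ 0 := by
  norm_num [coverP]

theorem eval_zero_coverQ_8 : (coverQ 8).eval 0 = 0 := by
  simp [coverQ]

theorem eval_zero_coverP_9 : (coverP 9).eval 0 ≠ 0 := by
  norm_num [coverP]

theorem eval_zero_coverQ_9 : (coverQ 9).eval 0 = 0 := by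
  simp [coverQ]

/-- The modular equation of a row holds for the explicit covering. -/
theorem TableRow.eventually_hFun_cover {M N : ℕ} {u v m : ℂ → ℂ} (h : TableRow M N u v m) :
    ∀ᶠ t in 𝓝 (0 : ℂ), hFun (coverP M) (coverQ M) (u t) =
      m t * hFun (coverP M) (coverQ M) (v t) := by
  match h with
  | r2_2 =>
    -- The numerals are the degree, the order of the root in the multiplier, and the cofactor with
    -- `4 * 3 = 12`; the other rows follow this pattern.
    have := hFun_eq_of_pow_cpow eval_zero_coverP_2 eval_zero_coverQ_2 2 4 3 (by norm_num) rfl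
      tendsto_u22 tendsto_v22 (f := fun t => (t + 16)) (by fun_prop (disch := norm_num)) (by norm_num)
      (Eventually.of_forall hFun_cover_2) (by simpa [mul_pow, ← pow_mul, div_pow] using hpow₂_u22)
    simp only [Nat.cast_ofNat] at this
    exact this
  | r2_3 =>
    have := hFun_eq_of_pow_cpow eval_zero_coverP_2 eval_zero_coverQ_2 3 2 6 (by norm_num) rfl
      tendsto_u23 tendsto_v23 (f := fun t => (t + 9)) (by fun_prop (disch := norm_num)) (by norm_num)
      (Eventually.of_forall hFun_cover_2) (by simpa [mul_pow, ← pow_mul, div_pow] using hpow₂_u23)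
    simp only [Nat.cast_ofNat] at this
    exact this
  | r2_4 =>
    have := hFun_eq_of_pow_cpow eval_zero_coverP_2 eval_zero_coverQ_2 4 4 3 (by norm_num) rfl
      (tendsto_u22.comp tendsto_u42) (tendsto_v22.comp tendsto_v42) (f := fun t => ((t + 4) * (t + 8) ^ 2)) (by fun_prop (disch := norm_num)) (by norm_num)
      (Eventually.of_forall hFun_cover_2) (by simpa [mul_pow, ← pow_mul, div_pow] using hpow₂_u24)
    simp only [Nat.cast_ofNat] at this
    exact this
  | r2_5 =>
    have := hFun_eq_of_pow_inv eval_zero_coverP_2 eval_zero_coverQ_2 5 (by norm_num)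
      tendsto_u25 tendsto_v25 (f := fun t => (t + 5)) (by fun_prop (disch := norm_num)) (by norm_num)
      (Eventually.of_forall hFun_cover_2) (by simpa [mul_pow, ← pow_mul, div_pow] using hpow₂_u25)
    simp only [Nat.cast_ofNat] at this
    exact this
  | r2_6 =>
    have := hFun_eq_of_pow_cpow eval_zero_coverP_2 eval_zero_coverQ_2 6 4 3 (by norm_num) rfl
      (tendsto_u23.comp tendsto_u62) (tendsto_v23.comp tendsto_v62) (f := fun t => ((t + 2) * (t + 3) * (t + 6) ^ 3)) (by fun_prop (disch := norm_num)) (by norm_num)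
      (Eventually.of_forall hFun_cover_2) (by simpa [mul_pow, ← pow_mul, div_pow] using hpow₂_u26)
    simp only [Nat.cast_ofNat] at this
    exact this
  | r2_6' =>
    have := hFun_eq_of_pow_cpow eval_zero_coverP_2 eval_zero_coverQ_2 6 4 3 (by norm_num) rfl
      (tendsto_u22.comp tendsto_u43) (tendsto_v22.comp tendsto_v43) (f := fun t => ((t + 2) * (t + 3) * (t + 6) ^ 3)) (by fun_prop (disch := norm_num)) (by norm_num)
      (Eventually.of_forall hFun_cover_2) (by simpa [mul_pow, ← pow_mul, div_pow] using hpow₂_u26')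
    simp only [Nat.cast_ofNat] at this
    exact this
  | r2_8 =>
    have := hFun_eq_of_pow_cpow eval_zero_coverP_2 eval_zero_coverQ_2 8 4 3 (by norm_num) rfl
      (tendsto_u22.comp (tendsto_u42.comp tendsto_u82)) (tendsto_v22.comp (tendsto_v42.comp tendsto_v82)) (f := fun t => ((t + 2) * (t + 4) ^ 4 * (t ^ 2 + 4 * t + 8))) (by fun_prop (disch := norm_num)) (by norm_num)
      (Eventually.of_forall hFun_cover_2) (by simpa [mul_pow, ← pow_mul, div_pow] using hpow₂_u28)
    simp only [Nat.cast_ofNat] at this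
    exact this
  | r2_9 =>
    have := hFun_eq_of_pow_inv eval_zero_coverP_2 eval_zero_coverQ_2 9 (by norm_num)
      (tendsto_u23.comp tendsto_u63) (tendsto_v23.comp tendsto_v63) (f := fun t => ((t + 3) ^ 2)) (by fun_prop (disch := norm_num)) (by norm_num)
      (Eventually.of_forall hFun_cover_2) (by simpa [mul_pow, ← pow_mul, div_pow] using hpow₂_u29)
    simp only [Nat.cast_ofNat] at this
    exact this
  | r3_2 =>
    have := hFun_eq_of_pow_cpow eval_zero_coverP_3 eval_zero_coverQ_3 2 3 4 (by norm_num) rfl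
      tendsto_u32 tendsto_v32 (f := fun t => (t + 8)) (by fun_prop (disch := norm_num)) (by norm_num)
      (Eventually.of_forall hFun_cover_3) (by simpa [mul_pow, ← pow_mul, div_pow] using hpow₃_u32)
    simp only [Nat.cast_ofNat] at this
    exact this
  | r3_3 =>
    have := hFun_eq_of_pow_cpow eval_zero_coverP_3 eval_zero_coverQ_3 3 3 4 (by norm_num) rfl
      tendsto_u33 tendsto_v33 (f := fun t => (t ^ 2 + 9 * t + 27)) (by fun_prop (disch := norm_num)) (by norm_num)
      (Eventually.of_forall hFun_cover_3) (by simpa [mul_pow, ← pow_mul, div_pow] using hpow₃_u33)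
    simp only [Nat.cast_ofNat] at this
    exact this
  | r3_4 =>
    have := hFun_eq_of_pow_inv eval_zero_coverP_3 eval_zero_coverQ_3 4 (by norm_num)
      (tendsto_u32.comp tendsto_u62) (tendsto_v32.comp tendsto_v62) (f := fun t => (t + 4)) (by fun_prop (disch := norm_num)) (by norm_num)
      (Eventually.of_forall hFun_cover_3) (by simpa [mul_pow, ← pow_mul, div_pow] using hpow₃_u34)
    simp only [Nat.cast_ofNat] at this
    exact this
  | r3_6 =>
    have := hFun_eq_of_pow_cpow eval_zero_coverP_3 eval_zero_coverQ_3 6 3 4 (by norm_num) rfl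
      (tendsto_u33.comp tendsto_u92) (tendsto_v33.comp tendsto_v92) (f := fun t => ((t ^ 2 + 3 * t + 3) * (t ^ 2 + 6 * t + 12) ^ 2 / (t + 2))) (by fun_prop (disch := norm_num)) (by norm_num)
      (Eventually.of_forall hFun_cover_3) (by simpa [mul_pow, ← pow_mul, div_pow] using hpow₃_u36)
    simp only [Nat.cast_ofNat] at this
    exact this
  | r3_6' =>
    have := hFun_eq_of_pow_cpow eval_zero_coverP_3 eval_zero_coverQ_3 6 3 4 (by norm_num) rfl
      (tendsto_u32.comp tendsto_u63) (tendsto_v32.comp tendsto_v63) (f := fun t => ((t ^ 2 + 3 * t + 3) * (t ^ 2 + 6 * t + 12) ^ 2 / (t + 2))) (by fun_prop (disch := norm_num)) (by norm_num)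
      (Eventually.of_forall hFun_cover_3) (by simpa [mul_pow, ← pow_mul, div_pow] using hpow₃_u36')
    simp only [Nat.cast_ofNat] at this
    exact this
  | r4_2 =>
    have := hFun_eq_of_pow_cpow eval_zero_coverP_4 eval_zero_coverQ_4 2 2 6 (by norm_num) rfl
      tendsto_u42 tendsto_v42 (f := fun t => (t + 4)) (by fun_prop (disch := norm_num)) (by norm_num)
      (Eventually.of_forall hFun_cover_4) (by simpa [mul_pow, ← pow_mul, div_pow] using hpow₄_u42)
    simp only [Nat.cast_ofNat] at this
    exact this
  | r4_3 =>
    have := hFun_eq_of_pow_inv eval_zero_coverP_4 eval_zero_coverQ_4 3 (by norm_num)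
      tendsto_u43 tendsto_v43 (f := fun t => (t + 3)) (by fun_prop (disch := norm_num)) (by norm_num)
      (Eventually.of_forall hFun_cover_4) (by simpa [mul_pow, ← pow_mul, div_pow] using hpow₄_u43)
    simp only [Nat.cast_ofNat] at this
    exact this
  | r4_4 =>
    have := hFun_eq_of_pow_cpow eval_zero_coverP_4 eval_zero_coverQ_4 4 2 6 (by norm_num) rfl
      (tendsto_u42.comp tendsto_u82) (tendsto_v42.comp tendsto_v82) (f := fun t => ((t + 2) * (t ^ 2 + 4 * t + 8))) (by fun_prop (disch := norm_num)) (by norm_num)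
      (Eventually.of_forall hFun_cover_4) (by simpa [mul_pow, ← pow_mul, div_pow] using hpow₄_u44)
    simp only [Nat.cast_ofNat] at this
    exact this
  | r5_2 =>
    have := hFun_eq_of_pow_cpow eval_zero_coverP_5 eval_zero_coverQ_5 2 2 6 (by norm_num) rfl
      tendsto_u52 tendsto_v52 (f := fun t => (t + 4)) (by fun_prop (disch := norm_num)) (by norm_num)
      (Eventually.of_forall hFun_cover_5) (by simpa [mul_pow, ← pow_mul, div_pow] using hpow₅_u52)
    simp only [Nat.cast_ofNat] at this
    exact this
  | r5_5 =>
    have := hFun_eq_of_pow_cpow eval_zero_coverP_5 eval_zero_coverQ_5 5 2 6 (by norm_num) rfl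
      tendsto_u55 tendsto_v55 (f := fun t => (t ^ 4 + 5 * t ^ 3 + 15 * t ^ 2 + 25 * t + 25)) (by fun_prop (disch := norm_num)) (by norm_num)
      (Eventually.of_forall hFun_cover_5) (by simpa [mul_pow, ← pow_mul, div_pow] using hpow₅_u55)
    simp only [Nat.cast_ofNat] at this
    exact this
  | r6_2 =>
    have := hFun_eq_of_pow_inv eval_zero_coverP_6 eval_zero_coverQ_6 2 (by norm_num)
      tendsto_u62 tendsto_v62 (f := fun t => (t + 2)) (by fun_prop (disch := norm_num)) (by norm_num)
      hFun_cover_6 (by simpa [mul_pow, ← pow_mul, div_pow] using hpow₆_u62)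
    simp only [Nat.cast_ofNat] at this
    exact this
  | r6_3 =>
    have := hFun_eq_of_pow_inv eval_zero_coverP_6 eval_zero_coverQ_6 3 (by norm_num)
      tendsto_u63 tendsto_v63 (f := fun t => (t ^ 2 + 3 * t + 3)) (by fun_prop (disch := norm_num)) (by norm_num)
      hFun_cover_6 (by simpa [mul_pow, ← pow_mul, div_pow] using hpow₆_u63)
    simp only [Nat.cast_ofNat] at this
    exact this
  | r8_2 =>
    have := hFun_eq_of_pow_inv eval_zero_coverP_8 eval_zero_coverQ_8 2 (by norm_num)
      tendsto_u82 tendsto_v82 (f := fun t => (t + 2)) (by fun_prop (disch := norm_num)) (by norm_num)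
      (Eventually.of_forall hFun_cover_8) (by simpa [mul_pow, ← pow_mul, div_pow] using hpow₈_u82)
    simp only [Nat.cast_ofNat] at this
    exact this
  | r9_2 =>
    have := hFun_eq_of_pow_inv eval_zero_coverP_9 eval_zero_coverQ_9 2 (by norm_num)
      tendsto_u92 tendsto_v92 (f := fun t => (t + 2)) (by fun_prop (disch := norm_num)) (by norm_num)
      (Eventually.of_forall hFun_cover_9) (by simpa [mul_pow, ← pow_mul, div_pow] using hpow₉_u92)
    simp only [Nat.cast_ofNat] at this
    exact this

end GenusZero

/-! ### The levels of genus zero -/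

namespace GenusZero

open Finset

/-- A divisor of `a b` splits into divisors of `a` and `b`, and the gcd with the complementary
divisor splits into coprime factors, on which `φ` is multiplicative. -/
theorem numCusps_mul {a b : ℕ} (h : a.Coprime b) : numCusps (a * b) = numCusps a * numCusps b := by
  rw [numCusps, numCusps, numCusps, sum_mul_sum, ← sum_product', Nat.divisors_mul, mul_def,
    sum_image h.mul_injOn_divisors]
  refine sum_congr rfl fun x hx => ?_
  obtain ⟨⟨⟨e, rfl⟩, ha⟩, ⟨f, rfl⟩, hb⟩ := by
    simpa only [mem_product, Nat.mem_divisors] using hx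
  have h1 : 0 < x.1 := Nat.pos_of_ne_zero (left_ne_zero_of_mul ha)
  have h2 : 0 < x.2 := Nat.pos_of_ne_zero (left_ne_zero_of_mul hb)
  rw [← Nat.div_mul_div_comm (Nat.dvd_mul_right _ _) (Nat.dvd_mul_right _ _),
    Nat.mul_div_cancel_left _ h1, Nat.mul_div_cancel_left _ h2]
  have hef : e.Coprime f := h.coprime_mul_left.coprime_mul_left_right
  have h1f : x.1.Coprime f := h.coprime_mul_right.coprime_mul_left_right
  have h2e : x.2.Coprime e := (h.coprime_mul_left.coprime_mul_right_right).symm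
  have h12 : x.1.Coprime x.2 := h.coprime_mul_right.coprime_mul_right_right
  rw [hef.gcd_mul, h2e.gcd_mul_right_cancel, h1f.gcd_mul_left_cancel, Nat.totient_mul]
  exact (h12.coprime_dvd_left (Nat.gcd_dvd_left _ _)).coprime_dvd_right (Nat.gcd_dvd_left _ _)

theorem numCusps_prime_pow {p : ℕ} (hp : p.Prime) (k : ℕ) :
    numCusps (p ^ k) = ∑ i ∈ range (k + 1), (p ^ min i (k - i)).totient := by
  rw [numCusps, Nat.sum_divisors_prime_pow hp]
  refine sum_congr rfl fun i hi => ?_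
  have hik : i ≤ k := Nat.lt_succ_iff.mp (mem_range.mp hi)
  rw [Nat.pow_div hik hp.pos]
  rcases le_total i (k - i) with h | h
  · rw [min_eq_left h, Nat.gcd_eq_left (pow_dvd_pow p h)]
  · rw [min_eq_right h, Nat.gcd_eq_right (pow_dvd_pow p h)]

/-- The inner terms acquire a factor `p`, and the two outer terms at each end add up to `2 (1 + (p -
1)) = p (1 + 1)`. The recursion starts at exponent `1`: from `p ^ 0` to `p ^ 2` it would fail, the
counts being `1` and `p + 1`. -/
theorem numCusps_prime_pow_add_three {p : ℕ} (hp : p.Prime) (k : ℕ) :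
    numCusps (p ^ (k + 3)) = p * numCusps (p ^ (k + 1)) := by
  have hS : ∑ i ∈ range k, (p ^ min (i + 2) (k + 1 - i)).totient =
      p * ∑ i ∈ range k, (p ^ min (i + 1) (k - i)).totient := by
    rw [mul_sum]
    refine sum_congr rfl fun i hi => ?_
    have hik := mem_range.mp hi
    obtain ⟨m, hm⟩ : ∃ m, min (i + 1) (k - i) = m + 1 := ⟨min (i + 1) (k - i) - 1, by omega⟩
    have hm' : min (i + 2) (k + 1 - i) = m + 1 + 1 := by omega
    rw [hm, hm', Nat.totient_prime_pow_succ hp, Nat.totient_prime_pow_succ hp]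
    ring
  have hp1 := hp.one_le
  rw [numCusps_prime_pow hp, numCusps_prime_pow hp, sum_range_succ, sum_range_succ, sum_range_succ',
    sum_range_succ', sum_range_succ, sum_range_succ']
  have e1 : ∀ i, k + 3 - (i + 1 + 1) = k + 1 - i := fun i => by omega
  have e2 : ∀ i, k + 1 - (i + 1) = k - i := fun i => by omega
  simp only [e1, e2, add_assoc, Nat.reduceAdd, hS]
  have e4 : min 1 (k + 3 - 1) = 1 := by omega
  have e5 : min (k + 2) (k + 1 - k) = 1 := by omega
  simp only [e4, e5, Nat.sub_self, _root_.min_zero, _root_.zero_min, pow_zero, Nat.totient_one,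
    pow_one, Nat.totient_prime hp, mul_add, mul_one]
  omega

theorem psi_prime_pow {p : ℕ} (hp : p.Prime) (k : ℕ) :
    psi (p ^ (k + 1)) = p ^ k * (p + 1) := by
  have hp0 : (p : ℚ) ≠ 0 := by exact_mod_cast hp.ne_zero
  rw [psi, Nat.primeFactors_prime_pow (Nat.succ_ne_zero k) hp, prod_singleton]
  push_cast
  field_simp
  ring

/-- For exponent one this is `4 p ≤ (p + 1)²`, for exponent two an equality, and raising the
exponent by two multiplies both sides by `p⁴`. -/
theorem numCusps_prime_pow_sq_le {p : ℕ} (hp : p.Prime) (k : ℕ) :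
    (numCusps (p ^ (k + 1)) : ℚ) ^ 2 * (p ^ (k + 1) : ℕ) ≤ psi (p ^ (k + 1)) ^ 2 := by
  have hp1 : 1 ≤ p := hp.one_le
  induction k using Nat.twoStepInduction with
  | zero =>
    rw [psi_prime_pow hp, numCusps_prime_pow hp]
    norm_num [sum_range_succ]
    nlinarith [sq_nonneg ((p : ℚ) - 1)]
  | one =>
    rw [psi_prime_pow hp, numCusps_prime_pow hp]
    norm_num [sum_range_succ, Nat.totient_prime hp, Nat.cast_sub hp1]
    apply le_of_eq; ring
  | more k ih _ =>
    rw [numCusps_prime_pow_add_three hp, psi_prime_pow hp]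
    rw [psi_prime_pow hp] at ih
    push_cast at ih ⊢
    calc _ = (p : ℚ) ^ 4 * ((numCusps (p ^ (k + 1)) : ℚ) ^ 2 * p ^ (k + 1)) := by ring
      _ ≤ (p : ℚ) ^ 4 * ((p : ℚ) ^ k * (p + 1)) ^ 2 := by gcongr
      _ = _ := by ring

theorem psi_mul {a b : ℕ} (h : a.Coprime b) : psi (a * b) = psi a * psi b := by
  rw [psi, psi, psi, h.primeFactors_mul, prod_union h.disjoint_primeFactors]
  push_cast
  ring

theorem numCusps_sq_mul_le (n : ℕ) : (numCusps n : ℚ) ^ 2 * n ≤ psi n ^ 2 := by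
  induction n using Nat.recOnPosPrimePosCoprime with
  | prime_pow p n hp hn =>
    obtain ⟨k, rfl⟩ := Nat.exists_eq_succ_of_ne_zero hn.ne'
    exact numCusps_prime_pow_sq_le hp k
  | zero => simp [psi]
  | one => simp [psi, numCusps]
  | coprime a b _ _ h iha ihb =>
    rw [numCusps_mul h, psi_mul h]
    push_cast
    calc _ = ((numCusps a : ℚ) ^ 2 * a) * ((numCusps b : ℚ) ^ 2 * b) := by ring
      _ ≤ psi a ^ 2 * psi b ^ 2 := by gcongr
      _ = _ := by ring

/-- Each prime power contributes at least the two cusps belonging to the divisors `1` and `p ^ k`.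
-/
theorem two_pow_card_primeFactors_le (n : ℕ) (hn : n ≠ 0) : 2 ^ #n.primeFactors ≤ numCusps n := by
  induction n using Nat.recOnPosPrimePosCoprime with
  | prime_pow p n hp hpos =>
    obtain ⟨k, rfl⟩ := Nat.exists_eq_succ_of_ne_zero hpos.ne'
    rw [Nat.primeFactors_prime_pow (Nat.succ_ne_zero k) hp, card_singleton, numCusps_prime_pow hp,
      sum_range_succ, sum_range_succ']
    simp
  | zero => simp at hn
  | one => simp [numCusps]
  | coprime a b ha hb h iha ihb =>
    rw [numCusps_mul h, h.primeFactors_mul, card_union_of_disjoint h.disjoint_primeFactors, pow_add]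
    exact Nat.mul_le_mul (iha (by omega)) (ihb (by omega))

theorem prod_one_add_le_two_pow (s : Finset ℕ) (f : ℕ → ℤ) (h0 : ∀ p, -1 ≤ f p) (h1 : ∀ p, f p ≤ 1) :
    ∏ p ∈ s, (1 + f p) ≤ 2 ^ #s := by
  refine (prod_le_prod (fun p _ => ?_) fun p _ => ?_).trans_eq (prod_const 2)
  · linarith [h0 p]
  · linarith [h1 p]

theorem numEllipticTwo_le (n : ℕ) : numEllipticTwo n ≤ 2 ^ #n.primeFactors := by
  rw [numEllipticTwo]
  split_ifs
  · positivity
  · refine prod_one_add_le_two_pow _ _ (fun p => ?_) fun p => ?_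
    · generalize (p : ZMod 4) = x; revert x; decide
    · generalize (p : ZMod 4) = x; revert x; decide

theorem numEllipticThree_le (n : ℕ) : numEllipticThree n ≤ 2 ^ #n.primeFactors := by
  rw [numEllipticThree]
  split_ifs
  · positivity
  · refine prod_one_add_le_two_pow _ _ (fun p => ?_) fun p => ?_
    · rcases jacobiSym.trichotomy p 3 with h | h | h <;> simp [h]
    · rcases jacobiSym.trichotomy p 3 with h | h | h <;> simp [h]

/-- Replacing both elliptic counts by `σ_∞` and using `1/2 + 1/4 + 1/3 = 13/12` gives `ψ < 13 σ_∞`;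
then `σ_∞² n ≤ ψ² < 169 σ_∞²`. -/
theorem lt_of_genus_eq_zero {n : ℕ} (h : genus n = 0) : n < 169 := by
  rcases Nat.eq_zero_or_pos n with rfl | hn
  · norm_num
  have h2 : (numEllipticTwo n : ℚ) ≤ numCusps n := by
    exact_mod_cast (numEllipticTwo_le n).trans
      (by exact_mod_cast two_pow_card_primeFactors_le n hn.ne' : (2 : ℤ) ^ #n.primeFactors ≤ numCusps n)
  have h3 : (numEllipticThree n : ℚ) ≤ numCusps n := by
    exact_mod_cast (numEllipticThree_le n).trans
      (by exact_mod_cast two_pow_card_primeFactors_le n hn.ne' : (2 : ℤ) ^ #n.primeFactors ≤ numCusps n)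
  have hc : (0 : ℚ) < numCusps n := by
    exact_mod_cast (pow_pos two_pos _).trans_le (two_pow_card_primeFactors_le n hn.ne')
  have hpsi : psi n < 13 * numCusps n := by
    rw [genus] at h
    linarith
  have hpsi0 : 0 ≤ psi n := by rw [psi]; positivity
  have key : (numCusps n : ℚ) ^ 2 * n < (numCusps n : ℚ) ^ 2 * 169 := by
    calc _ ≤ psi n ^ 2 := numCusps_sq_mul_le n
      _ < (13 * numCusps n) ^ 2 := by gcongr
      _ = _ := by ring
  exact_mod_cast lt_of_mul_lt_mul_left key (by positivity)

theorem genus_eq_zero {n : ℕ} (h : genus n = 0) :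
    n ∈ [1, 2, 3, 4, 5, 6, 7, 8, 9, 10, 12, 13, 16, 18, 25] := by
  have : ∀ n < 169, genus n = 0 → n ∈ [1, 2, 3, 4, 5, 6, 7, 8, 9, 10, 12, 13, 16, 18, 25] := by
    decide +kernel
  exact this n (lt_of_genus_eq_zero h) h

end GenusZero

/-! ### The multiplier of `η²` -/

namespace GenusZero

open UpperHalfPlane ModularGroup Matrix Matrix.SpecialLinearGroup
open scoped MatrixGroups

/-- The exponent of the multiplier of `η²`: `η²(γτ) = e^{2πi φ(γ)/12} (cτ + d) η²(τ)`. -/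
def etaExp {R : Type*} [CommRing R] (a b c d : R) : R :=
  (1 - c ^ 2) * (b * d + 3 * (c - 1) * d + c + 3) + c * (a + d - 3)

theorem map_etaExp {R S : Type*} [CommRing R] [CommRing S] (f : R →+* S) (a b c d : R) :
    f (etaExp a b c d) = etaExp (f a) (f b) (f c) (f d) := by
  simp [etaExp, map_ofNat]

/-- Reduction of `ZMod 12` modulo three. -/
def modThree : ZMod 12 →+* ZMod 3 := ZMod.castHom (by norm_num) _

/-- Reduction of `ZMod 12` modulo four. -/
def modFour : ZMod 12 →+* ZMod 4 := ZMod.castHom (by norm_num) _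

/-- The Chinese remainder theorem, which replaces enumeration of quadruples modulo `12` by
enumeration modulo `3` and `4`. -/
theorem zmod_twelve_ext {x y : ZMod 12} (h3 : modThree x = modThree y)
    (h4 : modFour x = modFour y) : x = y := by
  revert x y; decide

/-- Right multiplication by `T`, with `1` the exponent in `η²(τ + 1) = e^(2πi/12) η²(τ)`. -/
theorem etaExp_T {a b c d : ZMod 12} (h : a * d - b * c = 1) :
    etaExp a (a + b) c (c + d) = etaExp a b c d + 1 := by
  have e3 : ∀ a b c d : ZMod 3, a * d - b * c = 1 →
      etaExp a (a + b) c (c + d) = etaExp a b c d + 1 := by decide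
  have e4 : ∀ a b c d : ZMod 4, a * d - b * c = 1 →
      etaExp a (a + b) c (c + d) = etaExp a b c d + 1 := by decide +kernel
  apply zmod_twelve_ext
  · simpa [map_etaExp, map_ofNat] using e3 (modThree a) (modThree b) (modThree c) (modThree d)
      (by simpa using congrArg modThree h)
  · simpa [map_etaExp, map_ofNat] using e4 (modFour a) (modFour b) (modFour c) (modFour d)
      (by simpa using congrArg modFour h)

/-- Right multiplication by `S`, with `9` because `e^(2πi 9/12) = -i`. -/
theorem etaExp_S {a b c d : ZMod 12} (h : a * d - b * c = 1) :
    etaExp b (-a) d (-c) = etaExp a b c d + 9 := by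
  have e3 : ∀ a b c d : ZMod 3, a * d - b * c = 1 →
      etaExp b (-a) d (-c) = etaExp a b c d + 9 := by decide
  have e4 : ∀ a b c d : ZMod 4, a * d - b * c = 1 →
      etaExp b (-a) d (-c) = etaExp a b c d + 9 := by decide +kernel
  apply zmod_twelve_ext
  · simpa [map_etaExp, map_ofNat] using e3 (modThree a) (modThree b) (modThree c) (modThree d)
      (by simpa using congrArg modThree h)
  · simpa [map_etaExp, map_ofNat] using e4 (modFour a) (modFour b) (modFour c) (modFour d)
      (by simpa using congrArg modFour h)

/-- The exponent of the multiplier of `η²` as a function on the modular group. -/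
def etaExpSL (γ : SL(2, ℤ)) : ZMod 12 :=
  etaExp (γ 0 0 : ℤ) (γ 0 1 : ℤ) (γ 1 0 : ℤ) (γ 1 1 : ℤ)

theorem det_intCast {R : Type*} [CommRing R] (γ : SL(2, ℤ)) :
    ((γ 0 0 : ℤ) : R) * (γ 1 1 : ℤ) - (γ 0 1 : ℤ) * (γ 1 0 : ℤ) = 1 := by
  have := γ.det_coe
  rw [det_fin_two] at this
  exact_mod_cast congrArg (Int.cast : ℤ → R) this

theorem etaExpSL_mul_T (γ : SL(2, ℤ)) : etaExpSL (γ * T) = etaExpSL γ + 1 := by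
  rw [etaExpSL, etaExpSL, ← etaExp_T (det_intCast γ)]
  simp [coe_T, Matrix.mul_apply, Fin.sum_univ_two]

theorem etaExpSL_mul_S (γ : SL(2, ℤ)) : etaExpSL (γ * S) = etaExpSL γ + 9 := by
  rw [etaExpSL, etaExpSL, ← etaExp_S (det_intCast γ)]
  simp [coe_S, Matrix.mul_apply, Fin.sum_univ_two]

theorem eta_add_one (z : ℂ) : ModularForm.eta (z + 1) ^ 2 =
    ZMod.stdAddChar (1 : ZMod 12) * ModularForm.eta z ^ 2 := by
  have h1 : ZMod.stdAddChar (1 : ZMod 12) = Complex.exp (2 * Real.pi * Complex.I * (1 : ℤ) / (12 : ℕ)) := by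
    rw [← ZMod.stdAddChar_coe, Int.cast_one]
  have h2 : Function.Periodic.qParam 1 (z + 1) = Function.Periodic.qParam 1 z := by
    simp [Function.Periodic.qParam, mul_add, Complex.exp_add]
  simp only [ModularForm.eta, mul_pow, ModularForm.eta_q, h2, h1]
  rw [← mul_assoc]
  congr 1
  simp only [Function.Periodic.qParam, ← Complex.exp_nat_mul, ← Complex.exp_add]
  congr 1
  push_cast
  ring

theorem eta_neg_inv {z : ℂ} (hz : 0 < z.im) : ModularForm.eta (-1 / z) ^ 2 =
    ZMod.stdAddChar (9 : ZMod 12) * z * ModularForm.eta z ^ 2 := by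
  have h := ModularForm.eta_comp_eq_csqrt_I_inv hz
  have hs {w : ℂ} (hw : w ≠ 0) : Complex.sqrt w ^ 2 = w := by
    rw [sqrt_eq_exp hw, ← Complex.exp_nat_mul, Nat.cast_ofNat, mul_div_cancel₀ _ two_ne_zero,
      Complex.exp_log hw]
  have hz0 : z ≠ 0 := by rintro rfl; simp at hz
  have h9 : ZMod.stdAddChar (9 : ZMod 12) = -Complex.I := by
    have : ZMod.stdAddChar (9 : ZMod 12) = Complex.exp (2 * Real.pi * Complex.I * (9 : ℤ) / (12 : ℕ)) := by
      rw [← ZMod.stdAddChar_coe]; rfl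
    rw [this, show 2 * Real.pi * Complex.I * (9 : ℤ) / (12 : ℕ) =
      Real.pi * Complex.I + Real.pi / 2 * Complex.I by push_cast; ring, Complex.exp_add, Complex.exp_pi_mul_I, Complex.exp_pi_div_two_mul_I]
    ring
  simp only [Function.comp_apply, Pi.smul_apply, Pi.mul_apply, smul_eq_mul] at h
  rw [h, mul_pow, mul_pow, inv_pow, hs Complex.I_ne_zero, hs hz0, h9, Complex.inv_I]
  ring

/-- The automorphy factor `cτ + d`. -/
noncomputable def den (γ : SL(2, ℤ)) (τ : ℍ) : ℂ := (γ 1 0 : ℤ) * (τ : ℂ) + (γ 1 1 : ℤ)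

theorem coe_smul_eq (γ : SL(2, ℤ)) (τ : ℍ) :
    ((γ • τ : ℍ) : ℂ) = ((γ 0 0 : ℤ) * (τ : ℂ) + (γ 0 1 : ℤ)) / den γ τ := by
  rw [coe_specialLinearGroup_apply]
  simp [den]

theorem coe_T_smul (τ : ℍ) : ((T • τ : ℍ) : ℂ) = τ + 1 := by
  rw [modular_T_smul, coe_vadd, add_comm, Complex.ofReal_one]

theorem coe_S_smul (τ : ℍ) : ((S • τ : ℍ) : ℂ) = -1 / τ := by
  rw [modular_S_smul, coe_mk, inv_neg, neg_div, one_div]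

theorem den_mul_T (γ : SL(2, ℤ)) (τ : ℍ) : den (γ * T) τ = den γ (T • τ) * 1 := by
  rw [den, den, coe_T_smul]
  simp [coe_T, Matrix.mul_apply, Fin.sum_univ_two]
  ring

theorem den_mul_S (γ : SL(2, ℤ)) (τ : ℍ) : den (γ * S) τ = den γ (S • τ) * τ := by
  have := ne_zero τ
  rw [den, den, coe_S_smul]
  simp [coe_S, Matrix.mul_apply, Fin.sum_univ_two]
  field_simp
  ring

/-- The transformation law of `η²`. -/
theorem eta_smul_sq (γ : SL(2, ℤ)) (τ : ℍ) : ModularForm.eta (γ • τ : ℍ) ^ 2 =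
    ZMod.stdAddChar (etaExpSL γ) * den γ τ * ModularForm.eta τ ^ 2 := by
  let p : SL(2, ℤ) → Prop := fun γ => ∀ τ : ℍ, ModularForm.eta (γ • τ : ℍ) ^ 2 =
    ZMod.stdAddChar (etaExpSL γ) * den γ τ * ModularForm.eta τ ^ 2
  have step (g : SL(2, ℤ)) (e : ZMod 12) (k : ℍ → ℂ) (he : ∀ γ, etaExpSL (γ * g) = etaExpSL γ + e)
      (hd : ∀ γ τ, den (γ * g) τ = den γ (g • τ) * k τ)
      (hg : ∀ τ : ℍ, ModularForm.eta (g • τ : ℍ) ^ 2 =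
        ZMod.stdAddChar e * k τ * ModularForm.eta τ ^ 2) (γ : SL(2, ℤ)) :
      p (γ * g) ↔ p γ := by
    have key (τ : ℍ) : (ModularForm.eta ((γ * g) • τ : ℍ) ^ 2 =
        ZMod.stdAddChar (etaExpSL (γ * g)) * den (γ * g) τ * ModularForm.eta τ ^ 2) ↔
        (ModularForm.eta (γ • g • τ : ℍ) ^ 2 =
        ZMod.stdAddChar (etaExpSL γ) * den γ (g • τ) * ModularForm.eta (g • τ : ℍ) ^ 2) := by
      rw [hg, he, hd, AddChar.map_add_eq_mul, mul_smul]
      ring_nf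
    constructor
    · intro h τ
      have := (key (g⁻¹ • τ)).1 (h _)
      rwa [smul_inv_smul] at this
    · exact fun h τ => (key τ).2 (h _)
  have hT := step T 1 1 etaExpSL_mul_T den_mul_T (fun τ => by
    rw [coe_T_smul, eta_add_one, Pi.one_apply, mul_one])
  have hS := step S 9 _ etaExpSL_mul_S den_mul_S (fun τ => by
    rw [coe_S_smul, eta_neg_inv τ.2])
  have h : γ ∈ Subgroup.closure {S, T} := by simp [SpecialLinearGroup.SL2Z_generators]
  suffices p γ from this τ
  induction h using Subgroup.closure_induction_right with
  | one =>
    intro τ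
    simp [den, etaExpSL, etaExp]
  | mul_right x _ y hy ih =>
    rcases hy with rfl | rfl
    · exact (hS x).2 ih
    · exact (hT x).2 ih
  | mul_inv_cancel x _ y hy ih =>
    rcases hy with rfl | rfl
    · exact (hS _).1 (by rwa [inv_mul_cancel_right])
    · exact (hT _).1 (by rwa [inv_mul_cancel_right])

end GenusZero

/-! ### Functions invariant under `Γ₀(L)` -/

namespace GenusZero

open UpperHalfPlane ModularGroup Matrix Matrix.SpecialLinearGroup Filter
open scoped MatrixGroups Manifold ModularForm

/-- A holomorphic `Γ₀(L)`-invariant function that is bounded at all cusps is constant. -/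
theorem exists_eq_const_of_gamma0 {L : ℕ} (hL : L ≠ 0) {f : ℍ → ℂ} (hf : MDiff f)
    (hinv : ∀ γ : SL(2, ℤ), (L : ℤ) ∣ γ 1 0 → ∀ τ, f (γ • τ) = f τ)
    (hb : ∀ γ : SL(2, ℤ), IsBoundedAtImInfty fun τ => f (γ • τ)) : ∃ c, ∀ τ, f τ = c := by
  have : NeZero L := ⟨hL⟩
  let F : ModularForm ((CongruenceSubgroup.Gamma0 L : Subgroup SL(2, ℤ)) : Subgroup (GL (Fin 2) ℝ)) 0 :=
    { toFun := f
      slash_action_eq' := by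
        rintro _ ⟨γ, hγ, rfl⟩
        have hγ' : (L : ℤ) ∣ γ 1 0 := by
          rw [← ZMod.intCast_zmod_eq_zero_iff_dvd]
          exact CongruenceSubgroup.Gamma0_mem.mp hγ
        have h : f ∣[(0 : ℤ)] γ = f := by
          ext τ
          rw [ModularForm.SL_slash_apply, hinv γ hγ' τ]
          simp
        exact h
      holo' := hf
      bdd_at_cusps' := by
        intro c hc
        rw [Subgroup.IsArithmetic.isCusp_iff_isCusp_SL2Z] at hc
        rw [OnePoint.isBoundedAt_iff_forall_SL2Z hc]
        intro γ _
        have h : f ∣[(0 : ℤ)] γ = fun τ => f (γ • τ) := by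
          ext τ
          rw [ModularForm.SL_slash_apply]
          simp
        rw [h]
        exact hb γ }
  obtain ⟨c, hc⟩ := ModularForm.eq_const_of_weight_zero F
  exact ⟨c, fun τ => congrFun hc τ⟩

/-- The Fricke involution `τ ↦ -1 / (L τ)`. -/
noncomputable def fricke (L : ℕ) (hL : 0 < L) (τ : ℍ) : ℍ :=
  ⟨-1 / (L * τ), by
    have h : 0 < ((L : ℂ) * τ).im := by
      rw [← Complex.ofReal_natCast, Complex.im_ofReal_mul]
      exact mul_pos (Nat.cast_pos.mpr hL) τ.im_pos
    have h2 := (UpperHalfPlane.mk _ h).im_inv_neg_coe_pos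
    rwa [coe_mk, inv_neg, ← one_div, ← neg_div] at h2⟩

theorem coe_fricke (L : ℕ) (hL : 0 < L) (τ : ℍ) : ((fricke L hL τ : ℍ) : ℂ) = -1 / (L * τ) := rfl

/-- At a cusp equivalent to `0`, boundedness can be checked after the Fricke involution. -/
theorem isBoundedAtImInfty_of_fricke {L : ℕ} (hL : 0 < L) {f : ℍ → ℂ}
    (hinv : ∀ γ : SL(2, ℤ), (L : ℤ) ∣ γ 1 0 → ∀ τ, f (γ • τ) = f τ)
    (hF : IsBoundedAtImInfty fun τ => f (fricke L hL τ)) (γ : SL(2, ℤ))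
    (hγ : IsCoprime (γ 1 0) (L : ℤ)) : IsBoundedAtImInfty fun τ => f (γ • τ) := by
  obtain ⟨x, y, hxy⟩ := hγ
  -- In `γ = δ S T^k` the lower left entry of `δ` is `k c - d`; as `x c ≡ 1` modulo `L`, this choice
  -- makes it divisible by `L`.
  set k : ℤ := x * γ 1 1 with hk
  set δ : SL(2, ℤ) := γ * T ^ (-k) * S⁻¹ with hδ
  have hδL : (L : ℤ) ∣ δ 1 0 := by
    have : δ 1 0 = - γ 1 1 + k * γ 1 0 := by
      simp [hδ, coe_T_zpow, Matrix.mul_apply, Fin.sum_univ_two, coe_S,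
        Matrix.adjugate_fin_two]
      ring
    rw [this, hk]
    exact ⟨-y * γ 1 1, by linear_combination γ 1 1 * hxy⟩
  have hL' : (L : ℂ) ≠ 0 := Nat.cast_ne_zero.mpr hL.ne'
  -- `S T^k τ = -1 / (τ + k)` is the Fricke image of `σ = (τ + k) / L`.
  have key (τ : ℍ) : ∃ σ : ℍ, σ.im = τ.im / L ∧ f (γ • τ) = f (fricke L hL σ) := by
    have him : (((τ : ℂ) + k) / L).im = τ.im / L := by
      rw [← Complex.ofReal_natCast, Complex.div_ofReal_im]
      simp
    refine ⟨⟨((τ : ℂ) + k) / L, by rw [him]; exact div_pos τ.im_pos (Nat.cast_pos.mpr hL)⟩, him, ?_⟩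
    have e : γ • τ = δ • S • T ^ k • τ := by
      rw [hδ, smul_smul, smul_smul]
      congr 1
      group
    rw [e, hinv δ hδL]
    congr 1
    ext1
    rw [coe_S_smul, coe_fricke, coe_mk, mul_div_cancel₀ _ hL', modular_T_zpow_smul, coe_vadd,
      add_comm]
    simp
  rw [isBoundedAtImInfty_iff] at hF ⊢
  obtain ⟨M, A, h⟩ := hF
  refine ⟨M, L * A, fun τ hτ => ?_⟩
  obtain ⟨σ, hσ, e⟩ := key τ
  rw [e]
  refine h σ ?_
  rw [hσ, le_div_iff₀ (Nat.cast_pos.mpr hL)]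
  linarith

/-- A `Γ₀(L)`-invariant function that is bounded at the cusps other than `0` and vanishes at `0`
is zero. -/
theorem eq_zero_of_gamma0 {L : ℕ} (hL : 0 < L) {f : ℍ → ℂ} (hf : MDiff f)
    (hinv : ∀ γ : SL(2, ℤ), (L : ℤ) ∣ γ 1 0 → ∀ τ, f (γ • τ) = f τ)
    (hb : ∀ γ : SL(2, ℤ), ¬ IsCoprime (γ 1 0) (L : ℤ) → IsBoundedAtImInfty fun τ => f (γ • τ))
    (hF : IsZeroAtImInfty fun τ => f (fricke L hL τ)) (τ : ℍ) : f τ = 0 := by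
  obtain ⟨c, hc⟩ := exists_eq_const_of_gamma0 hL.ne' hf hinv fun γ => by
    by_cases h : IsCoprime (γ 1 0) (L : ℤ)
    · exact isBoundedAtImInfty_of_fricke hL hinv hF.isBoundedAtImInfty γ h
    · exact hb γ h
  have h0 : Tendsto (fun τ : ℍ => f (fricke L hL τ)) atImInfty (𝓝 0) := hF
  simp only [hc] at h0
  rw [hc, tendsto_nhds_unique h0 tendsto_const_nhds]

end GenusZero

/-! ### Eta quotients -/

namespace GenusZero

open UpperHalfPlane ModularGroup Matrix Matrix.SpecialLinearGroup Filter
open scoped MatrixGroups Manifold ModularForm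

/-- Euler's product `∏ (1 - q^n)`. -/
noncomputable def eulerE (q : ℂ) : ℂ := ∏' n : ℕ, (1 - q ^ (n + 1))

theorem eulerE_zero : eulerE 0 = 1 := by simp [eulerE]

theorem differentiableAt_eulerE {q : ℂ} (hq : ‖q‖ < 1) : DifferentiableAt ℂ eulerE q :=
  ModularForm.differentiableOn_tprod_one_sub_pow.differentiableAt
    (Metric.isOpen_ball.mem_nhds (by simpa using hq))

theorem natCast_mul_im_pos {d : ℕ} (hd : d ≠ 0) (τ : ℍ) : 0 < ((d : ℂ) * τ).im := by
  rw [← Complex.ofReal_natCast, Complex.im_ofReal_mul]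
  exact mul_pos (Nat.cast_pos.mpr (Nat.pos_of_ne_zero hd)) τ.im_pos

/-- The point `d τ`. -/
noncomputable def dilate {d : ℕ} (hd : d ≠ 0) (τ : ℍ) : ℍ := ⟨d * τ, natCast_mul_im_pos hd τ⟩

theorem etaMul_ne_zero {d : ℕ} (hd : d ≠ 0) (τ : ℍ) : etaMul d τ ≠ 0 :=
  ModularForm.eta_ne_zero (natCast_mul_im_pos hd τ)

/-- `∏_{d ∣ L} η(d z)^{r_d}`. -/
noncomputable def etaQuot (L : ℕ) (r : ℕ → ℤ) (z : ℂ) : ℂ := ∏ d ∈ L.divisors, etaMul d z ^ r d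

/-- `d · γτ = δ(dτ)` for `δ = diag(d, 1) γ diag(d, 1)⁻¹`, which is integral because `d` divides the
lower left entry of `γ`. -/
theorem etaMul_smul_sq {L d : ℕ} (hd : d ≠ 0) (hdL : d ∣ L) (γ : SL(2, ℤ)) {c : ℤ}
    (hγ : γ 1 0 = L * c) (τ : ℍ) : etaMul d (γ • τ : ℍ) ^ 2 =
      ZMod.stdAddChar (etaExp ((γ 0 0 : ℤ) : ZMod 12) (d * (γ 0 1 : ℤ)) ((L / d : ℕ) * c) (γ 1 1 : ℤ)) *
        den γ τ * etaMul d τ ^ 2 := by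
  obtain ⟨m, rfl⟩ := hdL
  rw [Nat.mul_div_cancel_left _ (Nat.pos_of_ne_zero hd)]
  let δ : SL(2, ℤ) := ⟨!![γ 0 0, d * γ 0 1; m * c, γ 1 1], by
    have := γ.det_coe
    rw [det_fin_two, hγ] at this
    rw [det_fin_two_of]
    push_cast at this
    linear_combination this⟩
  have hden : den δ (dilate hd τ) = den γ τ := by
    simp [den, δ, dilate, hγ]
    ring
  have hpt : ((δ • dilate hd τ : ℍ) : ℂ) = d * (γ • τ : ℍ) := by
    rw [coe_smul_eq, coe_smul_eq, hden]
    simp [δ, dilate]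
    ring
  have h := eta_smul_sq δ (dilate hd τ)
  rw [hpt, hden] at h
  rw [etaMul, h]
  simp [etaExpSL, δ, etaMul, dilate]

/-- Triviality of the character of `∏_{d ∣ L} η(d τ)^{2 r_d}` on `Γ₀(L)`, as a congruence. -/
def TrivialCharacter (R : Type*) [CommRing R] (L : ℕ) (r : ℕ → ℤ) : Prop :=
  ∀ a b c e : R, a * e - b * (L * c) = 1 →
    ∑ d ∈ L.divisors, (r d : R) * etaExp a (d * b) ((L / d : ℕ) * c) e = 0

theorem TrivialCharacter.of_three_four {L : ℕ} {r : ℕ → ℤ} (h3 : TrivialCharacter (ZMod 3) L r)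
    (h4 : TrivialCharacter (ZMod 4) L r) : TrivialCharacter (ZMod 12) L r := by
  intro a b c e h
  apply zmod_twelve_ext
  · simpa [map_etaExp, map_sum] using h3 (modThree a) (modThree b) (modThree c) (modThree e)
      (by simpa using congrArg modThree h)
  · simpa [map_etaExp, map_sum] using h4 (modFour a) (modFour b) (modFour c) (modFour e)
      (by simpa using congrArg modFour h)

theorem den_ne_zero (γ : SL(2, ℤ)) (τ : ℍ) : den γ τ ≠ 0 := by
  intro h
  apply ne_zero (γ • τ)
  rw [coe_smul_eq, h, div_zero]

theorem map_sum_eq_prod {A M ι : Type*} [AddCommMonoid A] [CommMonoid M] (χ : AddChar A M)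
    (s : Finset ι) (f : ι → A) : χ (∑ d ∈ s, f d) = ∏ d ∈ s, χ (f d) := by
  classical
  induction s using Finset.induction_on with
  | empty => simp
  | insert a s ha ih => rw [Finset.prod_insert ha, Finset.sum_insert ha, χ.map_add_eq_mul, ih]

theorem prod_zpow_const {K ι : Type*} [Field K] {x : K} (hx : x ≠ 0) (s : Finset ι) (r : ι → ℤ) :
    ∏ d ∈ s, x ^ r d = x ^ ∑ d ∈ s, r d := by
  classical
  induction s using Finset.induction_on with
  | empty => simp
  | insert a s ha ih => rw [Finset.prod_insert ha, Finset.sum_insert ha, ih, zpow_add₀ hx]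

/-- With doubled exponents the quotient is a product of powers of `η²`. The automorphy factors
cancel by `hr0`, the multipliers by `hr`. -/
theorem etaQuot_smul {L : ℕ} {r : ℕ → ℤ} (hr0 : ∑ d ∈ L.divisors, r d = 0)
    (hr : TrivialCharacter (ZMod 12) L r) (γ : SL(2, ℤ)) (hγ : (L : ℤ) ∣ γ 1 0) (τ : ℍ) :
    etaQuot L (fun d => 2 * r d) (γ • τ : ℍ) = etaQuot L (fun d => 2 * r d) τ := by
  obtain ⟨c, hc⟩ := hγ
  have hL : ∀ d ∈ L.divisors, d ≠ 0 := fun d hd => (Nat.pos_of_mem_divisors hd).ne'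
  have hdet := det_intCast (R := ZMod 12) γ
  rw [hc] at hdet
  push_cast at hdet
  have hsum := hr _ _ _ _ hdet
  have e (z : ℂ) : etaQuot L (fun d => 2 * r d) z = ∏ d ∈ L.divisors, (etaMul d z ^ 2) ^ r d :=
    Finset.prod_congr rfl fun d _ => by rw [_root_.zpow_mul]; rfl
  have hχ : ∏ d ∈ L.divisors, ZMod.stdAddChar (etaExp ((γ 0 0 : ℤ) : ZMod 12) (d * (γ 0 1 : ℤ))
      ((L / d : ℕ) * c) (γ 1 1 : ℤ)) ^ r d = 1 := by
    rw [← AddChar.map_zero_eq_one (ZMod.stdAddChar (N := 12)), ← hsum, map_sum_eq_prod]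
    exact Finset.prod_congr rfl fun d _ => by rw [← zsmul_eq_mul, AddChar.map_zsmul_eq_zpow]
  rw [e, e, Finset.prod_congr rfl fun d hd => by
    rw [etaMul_smul_sq (hL d hd) (Nat.dvd_of_mem_divisors hd) γ hc τ, mul_zpow, mul_zpow],
    Finset.prod_mul_distrib, Finset.prod_mul_distrib, prod_zpow_const (den_ne_zero γ τ), hr0, hχ,
    zpow_zero, one_mul, one_mul]

theorem etaQuot_mul (L : ℕ) (r r' : ℕ → ℤ) (τ : ℍ) :
    etaQuot L (fun d => r d + r' d) τ = etaQuot L r τ * etaQuot L r' τ := by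
  rw [etaQuot, etaQuot, etaQuot, ← Finset.prod_mul_distrib]
  exact Finset.prod_congr rfl fun d hd =>
    zpow_add₀ (etaMul_ne_zero (Nat.pos_of_mem_divisors hd).ne' τ) _ _

/-- If the exponents are not all even, this leaves a sign undetermined; conjugate factors remove it
later. -/
theorem etaQuot_smul_sq {L : ℕ} {r : ℕ → ℤ} (hr0 : ∑ d ∈ L.divisors, r d = 0)
    (hr : TrivialCharacter (ZMod 12) L r) (γ : SL(2, ℤ)) (hγ : (L : ℤ) ∣ γ 1 0) (τ : ℍ) :
    etaQuot L r (γ • τ : ℍ) ^ 2 = etaQuot L r τ ^ 2 := by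
  have := etaQuot_smul hr0 hr γ hγ τ
  simp only [two_mul, etaQuot_mul] at this
  rw [sq, sq, this]

theorem mdiff_of_differentiableAt {F : ℂ → ℂ} (hF : ∀ z : ℂ, 0 < z.im → DifferentiableAt ℂ F z) :
    MDiff (fun τ : ℍ => F τ) := by
  rw [UpperHalfPlane.mdifferentiable_iff]
  refine DifferentiableOn.congr (fun z hz => (hF z hz).differentiableWithinAt) fun z hz => ?_
  simp [ofComplex_apply_of_im_pos hz]

theorem differentiableAt_etaMul {d : ℕ} (hd : d ≠ 0) {z : ℂ} (hz : 0 < z.im) :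
    DifferentiableAt ℂ (etaMul d) z := by
  have h := ModularForm.differentiableAt_eta_of_mem_upperHalfPlaneSet (natCast_mul_im_pos hd ⟨z, hz⟩)
  exact DifferentiableAt.comp (g := ModularForm.eta) z h (by fun_prop)

theorem mdiff_etaQuot (L : ℕ) (r : ℕ → ℤ) : MDiff (fun τ : ℍ => etaQuot L r τ) := by
  refine mdiff_of_differentiableAt fun z hz => ?_
  unfold etaQuot
  refine DifferentiableAt.fun_finsetProd fun d hd => ?_
  have hd0 := (Nat.pos_of_mem_divisors hd).ne'
  exact (differentiableAt_etaMul hd0 hz).zpow (Or.inl (etaMul_ne_zero hd0 ⟨z, hz⟩))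

theorem etaMul_eq_eulerE (d : ℕ) (z : ℂ) : etaMul d z =
    Function.Periodic.qParam 24 z ^ d * eulerE (Function.Periodic.qParam 1 z ^ d) := by
  have h (h : ℝ) : Function.Periodic.qParam h (d * z) = Function.Periodic.qParam h z ^ d := by
    rw [Function.Periodic.qParam, Function.Periodic.qParam, ← Complex.exp_nat_mul]
    ring_nf
  rw [etaMul, ModularForm.eta, h, eulerE]
  simp only [ModularForm.eta_q, h]

/-- The multiplier has absolute value one, so it plays no role in growth at the cusps. -/
theorem norm_eta_smul (γ : SL(2, ℤ)) (τ : ℍ) :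
    ‖ModularForm.eta (γ • τ : ℍ)‖ ^ 2 = ‖den γ τ‖ * ‖ModularForm.eta τ‖ ^ 2 := by
  rw [← norm_pow, eta_smul_sq, norm_mul, norm_mul, AddChar.norm_apply, one_mul, norm_pow]

/-- `diag(d, 1) γ = γ' (g, b; 0, d / g)` with `g = (c, d)`. -/
theorem exists_dilate_smul {d : ℕ} (hd : d ≠ 0) (γ : SL(2, ℤ)) : ∃ (γ' : SL(2, ℤ)) (b : ℤ),
    ∀ τ : ℍ, ∃ w : ℍ, dilate hd (γ • τ) = γ' • w ∧
      (w : ℂ) = ((Int.gcd (γ 1 0) d : ℂ) * τ + b) / (d / Int.gcd (γ 1 0) d) ∧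
      den γ' w = den γ τ * (Int.gcd (γ 1 0) d / d) := by
  have hdz : (d : ℤ) ≠ 0 := Int.natCast_ne_zero.mpr hd
  have hdet := γ.det_coe
  rw [det_fin_two] at hdet
  set a := γ 0 0 with ha
  set b := γ 0 1 with hb
  set c := γ 1 0 with hc
  set e := γ 1 1 with he
  set g : ℕ := Int.gcd c d with hg
  have hg0 : (g : ℤ) ≠ 0 := by
    rw [hg]; exact Int.natCast_ne_zero.mpr (Int.gcd_ne_zero_right hdz)
  obtain ⟨y, hy⟩ : (g : ℤ) ∣ c := Int.gcd_dvd_left _ _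
  obtain ⟨m, hm⟩ : (g : ℤ) ∣ d := Int.gcd_dvd_right _ _
  have hbez : (g : ℤ) = c * Int.gcdA c d + d * Int.gcdB c d := Int.gcd_eq_gcd_ab c d
  set p := Int.gcdA c d
  set q := Int.gcdB c d
  have h1 : y * p + m * q = 1 := by
    apply mul_left_cancel₀ hg0
    linear_combination -p * hy - q * hm - hbez
  -- The first column of `diag(d, 1) γ` is `(d a, c) = g (m a, y)`. Its primitive part becomes the
  -- first column of `γ'`, completed by a Bézout relation.
  have hcop : IsCoprime (m * a) y :=
    IsCoprime.mul_left ⟨q, p, by linear_combination h1⟩ ⟨e, -b * g, by linear_combination hdet + b * hy⟩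
  obtain ⟨u, v, huv⟩ := hcop
  let γ' : SL(2, ℤ) := ⟨!![m * a, -v; y, u], by
    rw [det_fin_two_of]
    linear_combination huv⟩
  -- The integer is the upper right entry of `γ'⁻¹ diag(d, 1) γ`.
  refine ⟨γ', u * d * b + v * e, fun τ => ⟨γ'⁻¹ • dilate hd (γ • τ), by rw [smul_inv_smul], ?_⟩⟩
  have hinv : ((γ'⁻¹ : SL(2, ℤ)) : Matrix (Fin 2) (Fin 2) ℤ) = !![u, v; -y, m * a] := by
    rw [Matrix.SpecialLinearGroup.coe_inv]
    change adjugate !![m * a, -v; y, u] = _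
    rw [adjugate_fin_two_of, neg_neg]
  have hden := den_ne_zero γ τ
  have hP : ((dilate hd (γ • τ) : ℍ) : ℂ) = d * ((a * (τ : ℂ) + b) / den γ τ) := by
    rw [← coe_smul_eq]; rfl
  have hgC : (g : ℂ) ≠ 0 := by exact_mod_cast hg0
  have hdC : (d : ℂ) ≠ 0 := by exact_mod_cast hd
  have hmd : (d : ℂ) = g * m := by exact_mod_cast hm
  have hmC : (m : ℂ) ≠ 0 := by
    rintro h
    rw [hmd, h, mul_zero] at hdC
    exact hdC rfl
  have hyC : (c : ℂ) = g * y := by exact_mod_cast hy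
  have hdetC : (a : ℂ) * e - b * c = 1 := by exact_mod_cast hdet
  have huvC : (u : ℂ) * (m * a) + v * y = 1 := by exact_mod_cast huv
  have hdenE : den γ τ = c * (τ : ℂ) + e := rfl
  have hden' : den γ'⁻¹ (dilate hd (γ • τ)) = m / den γ τ := by
    have : den γ'⁻¹ (dilate hd (γ • τ)) = -y * (dilate hd (γ • τ) : ℍ) + m * a := by
      simp [den, hinv]
    rw [this, hP, eq_div_iff hden]
    field_simp
    rw [hdenE, hmd, hyC]
    rw [hyC] at hdetC
    linear_combination (m : ℂ) * hdetC
  have hw : ((γ'⁻¹ • dilate hd (γ • τ) : ℍ) : ℂ) = ((g : ℂ) * τ + (u * d * b + v * e : ℤ)) / (d / g) := by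
    rw [coe_smul_eq, hden', hP]
    have e1 : (((γ'⁻¹ : SL(2, ℤ)) 0 0 : ℤ) : ℂ) = u := by
      simp [hinv]
    have e2 : (((γ'⁻¹ : SL(2, ℤ)) 0 1 : ℤ) : ℂ) = v := by
      simp [hinv]
    rw [e1, e2, hmd]
    field_simp
    push_cast
    rw [hdenE, hmd]
    rw [hyC] at hdetC ⊢
    linear_combination (g : ℂ) * τ * huvC
  refine ⟨hw, ?_⟩
  have : den γ' (γ'⁻¹ • dilate hd (γ • τ)) = y * (γ'⁻¹ • dilate hd (γ • τ) : ℍ) + u := by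
    simp [den, γ']
  rw [this, hw, hdenE, hmd]
  field_simp
  push_cast
  rw [hmd]
  rw [hyC] at hdetC ⊢
  linear_combination (e : ℂ) * huvC - (u : ℂ) * m * hdetC

end GenusZero

/-! ### Eta quotients at the cusps -/

namespace GenusZero

open UpperHalfPlane ModularGroup Matrix Matrix.SpecialLinearGroup Filter
open scoped MatrixGroups Manifold ModularForm

theorem tendsto_eulerE_qParam {w : ℍ → ℂ} (hw : Tendsto (fun τ => (w τ).im) atImInfty atTop) :
    Tendsto (fun τ => eulerE (Function.Periodic.qParam 1 (w τ))) atImInfty (𝓝 1) := by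
  have h1 : ContinuousAt eulerE 0 := (differentiableAt_eulerE (by simp)).continuousAt
  have h2 : Tendsto (fun τ => Function.Periodic.qParam 1 (w τ)) atImInfty (𝓝 0) :=
    ((Function.Periodic.qParam_tendsto one_pos).mono_right nhdsWithin_le_nhds).comp
      (tendsto_comap_iff.mpr hw)
  have := h1.tendsto.comp h2
  rwa [eulerE_zero] at this

/-- The size of `η(dτ)` near the cusp `γ i∞`. -/
theorem exists_norm_etaMul_smul {d : ℕ} (hd : d ≠ 0) (γ : SL(2, ℤ)) :
    ∃ C : ℍ → ℝ, Tendsto C atImInfty (𝓝 (Int.gcd (γ 1 0) d / d : ℝ)) ∧ ∀ τ : ℍ,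
      ‖etaMul d (γ • τ : ℍ)‖ ^ 2 =
        ‖den γ τ‖ * Real.exp (-(Real.pi / 6 * ((Int.gcd (γ 1 0) d : ℝ) ^ 2 / d)) * τ.im) * C τ := by
  obtain ⟨γ', b, h⟩ := exists_dilate_smul hd γ
  set g := Int.gcd (γ 1 0) d with hg
  have hg0 : 0 < g := Nat.pos_of_ne_zero (Int.gcd_ne_zero_right (Int.natCast_ne_zero.mpr hd))
  have hd0 : (0 : ℝ) < d := Nat.cast_pos.mpr (Nat.pos_of_ne_zero hd)
  have hg1 : (0 : ℝ) < g := Nat.cast_pos.mpr hg0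
  choose w hw1 hw2 hw3 using h
  have him (τ : ℍ) : (w τ).im = (g : ℝ) ^ 2 / d * τ.im := by
    have e : (w τ : ℂ) = ((g : ℝ) ^ 2 / d : ℝ) * (τ : ℂ) + ((g * b / d : ℝ) : ℂ) := by
      rw [hw2]
      push_cast
      have : (d : ℂ) ≠ 0 := Nat.cast_ne_zero.mpr hd
      have : (g : ℂ) ≠ 0 := Nat.cast_ne_zero.mpr hg0.ne'
      field_simp
    rw [← coe_im, e, Complex.add_im, Complex.im_ofReal_mul, Complex.ofReal_im, add_zero, coe_im]
  refine ⟨fun τ => g / d * ‖eulerE (Function.Periodic.qParam 1 (w τ))‖ ^ 2, ?_, fun τ => ?_⟩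
  · have hinf : Tendsto (fun τ => (w τ : ℂ).im) atImInfty atTop := by
      simp only [coe_im, him]
      exact (tendsto_comap_iff.mp tendsto_id).const_mul_atTop (by positivity)
    simpa using (((tendsto_eulerE_qParam hinf).norm).pow 2).const_mul (g / d : ℝ)
  · have e1 : etaMul d (γ • τ : ℍ) = ModularForm.eta (γ' • w τ : ℍ) := by
      rw [← hw1]; rfl
    have e2 := etaMul_eq_eulerE 1 (w τ)
    rw [etaMul, Nat.cast_one, one_mul, pow_one, pow_one] at e2
    rw [e1, norm_eta_smul, hw3, e2, norm_mul, norm_mul, mul_pow, Function.Periodic.norm_qParam,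
      ← Real.exp_nat_mul, coe_im, him]
    have : ‖(g / d : ℂ)‖ = g / d := by
      rw [← Complex.ofReal_natCast, ← Complex.ofReal_natCast, ← Complex.ofReal_div,
        Complex.norm_real, Real.norm_of_nonneg (by positivity)]
    rw [this]
    have : ((2 : ℕ) : ℝ) * (-2 * Real.pi * (g ^ 2 / d * τ.im) / 24) =
        -(Real.pi / 6 * (g ^ 2 / d)) * τ.im := by
      push_cast; ring
    rw [this]
    ring

/-- The order at the cusp `γ i∞` is a positive multiple of `∑ r_d gcd(c, d)² / d`, here multiplied
by `L` to become an integer. The automorphy factors cancel because the exponents sum to zero. -/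
theorem isBoundedAtImInfty_etaQuot_smul {L : ℕ} {r : ℕ → ℤ} (hr0 : ∑ d ∈ L.divisors, r d = 0)
    (γ : SL(2, ℤ)) (hr : 0 ≤ ∑ d ∈ L.divisors, r d * ((Int.gcd (γ 1 0) d : ℤ) ^ 2 * (L / d : ℕ))) :
    IsBoundedAtImInfty fun τ => etaQuot L r (γ • τ : ℍ) := by
  have hL : ∀ d ∈ L.divisors, d ≠ 0 := fun d hd => (Nat.pos_of_mem_divisors hd).ne'
  have hex (d : ℕ) : ∃ C : ℍ → ℝ, d ≠ 0 → Tendsto C atImInfty (𝓝 (Int.gcd (γ 1 0) d / d : ℝ)) ∧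
      ∀ τ : ℍ, ‖etaMul d (γ • τ : ℍ)‖ ^ 2 =
        ‖den γ τ‖ * Real.exp (-(Real.pi / 6 * ((Int.gcd (γ 1 0) d : ℝ) ^ 2 / d)) * τ.im) * C τ := by
    by_cases hd : d = 0
    · exact ⟨0, fun h => absurd hd h⟩
    · obtain ⟨C, h⟩ := exists_norm_etaMul_smul hd γ
      exact ⟨C, fun _ => h⟩
  choose C hC using hex
  set s : ℝ := ∑ d ∈ L.divisors, r d * ((Int.gcd (γ 1 0) d : ℝ) ^ 2 / d) with hs
  have hs0 : 0 ≤ s := by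
    rcases Nat.eq_zero_or_pos L with rfl | hLpos
    · simp [hs]
    have hL' : (0 : ℝ) < L := Nat.cast_pos.mpr hLpos
    have : (L : ℝ) * s =
        (∑ d ∈ L.divisors, r d * ((Int.gcd (γ 1 0) d : ℤ) ^ 2 * (L / d : ℕ)) : ℤ) := by
      rw [hs, Finset.mul_sum]
      simp only [Int.cast_sum, Int.cast_mul, Int.cast_pow, Int.cast_natCast]
      refine Finset.sum_congr rfl fun d hd => ?_
      rw [Nat.cast_div (Nat.dvd_of_mem_divisors hd) (Nat.cast_ne_zero.mpr (hL d hd))]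
      ring
    exact nonneg_of_mul_nonneg_right (by rw [this]; exact_mod_cast hr) hL'
  have key (τ : ℍ) : ‖etaQuot L r (γ • τ : ℍ)‖ ^ 2 =
      Real.exp (-(Real.pi / 6 * s) * τ.im) * ∏ d ∈ L.divisors, C d τ ^ r d := by
    have hden : ‖den γ τ‖ ≠ 0 := norm_ne_zero_iff.mpr (den_ne_zero γ τ)
    rw [etaQuot, norm_prod, ← Finset.prod_pow, Finset.prod_congr rfl fun d hd => by
      rw [norm_zpow, ← zpow_natCast, ← _root_.zpow_mul, mul_comm, _root_.zpow_mul, zpow_natCast,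
        (hC d (hL d hd)).2 τ, mul_zpow, mul_zpow],
      Finset.prod_mul_distrib, Finset.prod_mul_distrib, prod_zpow_const hden, hr0, zpow_zero,
      one_mul]
    congr 1
    rw [Finset.prod_congr rfl fun d _ => by rw [← Real.rpow_intCast, ← Real.exp_mul], ← Real.exp_sum]
    congr 1
    rw [hs, Finset.mul_sum, ← Finset.sum_neg_distrib, Finset.sum_mul]
    exact Finset.sum_congr rfl fun d _ => by ring
  have hprod : Tendsto (fun τ => ∏ d ∈ L.divisors, C d τ ^ r d) atImInfty
      (𝓝 (∏ d ∈ L.divisors, (Int.gcd (γ 1 0) d / d : ℝ) ^ r d)) := by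
    refine tendsto_finsetProd _ fun d hd => ?_
    have hg0 : Int.gcd (γ 1 0) d ≠ 0 := Int.gcd_ne_zero_right (Int.natCast_ne_zero.mpr (hL d hd))
    exact (hC d (hL d hd)).1.zpow₀ (r d)
      (Or.inl (div_ne_zero (Nat.cast_ne_zero.mpr hg0) (Nat.cast_ne_zero.mpr (hL d hd))))
  have hev := hprod.eventually (eventually_lt_nhds (lt_add_one _))
  rw [isBoundedAtImInfty_iff]
  obtain ⟨A, hA⟩ := (atImInfty_mem _).mp hev
  refine ⟨√(∏ d ∈ L.divisors, (Int.gcd (γ 1 0) d / d : ℝ) ^ r d + 1), A, fun τ hτ => ?_⟩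
  refine Real.le_sqrt_of_sq_le ?_
  have hlt := hA τ hτ
  rw [Set.mem_ofPred_eq] at hlt
  have hexp : Real.exp (-(Real.pi / 6 * s) * τ.im) ≤ 1 := by
    rw [Real.exp_le_one_iff]
    have := mul_nonneg (mul_nonneg (by positivity : (0 : ℝ) ≤ Real.pi / 6) hs0) τ.im_pos.le
    linarith
  have hpos : 0 ≤ ∏ d ∈ L.divisors, C d τ ^ r d := by
    have h2 := sq_nonneg ‖etaQuot L r (γ • τ : ℍ)‖
    rw [key] at h2
    exact nonneg_of_mul_nonneg_right h2 (Real.exp_pos _)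
  rw [key]
  nlinarith

theorem sqrt_natCast_mul {m : ℕ} (hm : 0 < m) {z : ℂ} (hz : z ≠ 0) :
    Complex.sqrt (m * z) = (√(m : ℝ) : ℝ) * Complex.sqrt z := by
  have hm' : (0 : ℝ) < m := Nat.cast_pos.mpr hm
  have hmz : (m : ℂ) * z ≠ 0 := mul_ne_zero (Nat.cast_ne_zero.mpr hm.ne') hz
  rw [sqrt_eq_exp hmz, sqrt_eq_exp hz, ← Complex.ofReal_natCast, Complex.log_ofReal_mul hm' hz,
    add_div, Complex.exp_add, Real.sqrt_eq_rpow, Real.rpow_def_of_pos hm']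
  push_cast
  rw [mul_one_div]

/-- Multiplied by `L / d`, the point `-1 / (L τ)` becomes `-1 / (d τ)`, so inversion of `η`
interchanges `d` and `L / d`. The factors `√τ` cancel and `∏ √d ^ r` remains; `C` is given through
its square so that it can be verified in rational numbers. -/
theorem etaQuot_fricke {L : ℕ} (hL : 0 < L) {r : ℕ → ℤ} (hr0 : ∑ d ∈ L.divisors, r d = 0)
    {C : ℝ} (hC : 0 < C) (hC2 : C ^ 2 = ∏ d ∈ L.divisors, (d : ℝ) ^ r (L / d)) (τ : ℍ) :
    etaQuot L r (fricke L hL τ) = C * etaQuot L (fun d => r (L / d)) τ := by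
  have hC' : C = ∏ d ∈ L.divisors, √(d : ℝ) ^ r (L / d) := by
    rw [← Real.sqrt_sq hC.le, hC2, Real.sqrt_eq_iff_mul_self_eq
      (Finset.prod_nonneg fun d _ => zpow_nonneg (Nat.cast_nonneg d) _)
      (Finset.prod_nonneg fun d _ => zpow_nonneg (Real.sqrt_nonneg _) _),
      ← Finset.prod_mul_distrib]
    exact Finset.prod_congr rfl fun d _ => by rw [← mul_zpow, Real.mul_self_sqrt (Nat.cast_nonneg d)]
  have hr0' : ∑ d ∈ L.divisors, r (L / d) = 0 := by rw [Nat.sum_div_divisors, hr0]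
  have hI : Complex.sqrt Complex.I ≠ 0 := by simp [sqrt_eq_exp]
  have hτ : Complex.sqrt τ ≠ 0 := by simp [sqrt_eq_exp (ne_zero τ)]
  have h (d : ℕ) (hd : d ∈ L.divisors) : etaMul (L / d) (fricke L hL τ) =
      ((Complex.sqrt Complex.I)⁻¹ * Complex.sqrt τ) * (√(d : ℝ) : ℝ) * etaMul d τ := by
    obtain ⟨m, rfl⟩ := Nat.dvd_of_mem_divisors hd
    have hd0 := Nat.pos_of_mem_divisors hd
    have hdC : (d : ℂ) ≠ 0 := Nat.cast_ne_zero.mpr hd0.ne'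
    have hm0 : m ≠ 0 := by rintro rfl; simp at hL
    have hmC : (m : ℂ) ≠ 0 := Nat.cast_ne_zero.mpr hm0
    have e := ModularForm.eta_comp_eq_csqrt_I_inv (natCast_mul_im_pos hd0.ne' τ)
    simp only [Function.comp_apply, Pi.smul_apply, Pi.mul_apply, smul_eq_mul] at e
    rw [Nat.mul_div_cancel_left _ hd0, etaMul, coe_fricke, etaMul]
    have : (m : ℂ) * (-1 / ((d * m : ℕ) * τ)) = -1 / (d * τ) := by
      push_cast
      have := ne_zero τ
      field_simp
    rw [this, e, sqrt_natCast_mul hd0 (ne_zero τ)]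
    ring
  have e1 : etaQuot L r (fricke L hL τ) =
      ∏ d ∈ L.divisors, etaMul (L / d) (fricke L hL τ) ^ r (L / d) := by
    rw [etaQuot, Nat.prod_div_divisors L fun d => etaMul d (fricke L hL τ) ^ r d]
  rw [e1, Finset.prod_congr rfl fun d hd => by rw [h d hd, mul_zpow, mul_zpow],
    Finset.prod_mul_distrib, Finset.prod_mul_distrib,
    prod_zpow_const (mul_ne_zero (inv_ne_zero hI) hτ), hr0', zpow_zero, one_mul, hC', etaQuot]
  push_cast
  rfl

end GenusZero

/-! ### Truncated power series -/

namespace GenusZero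

open Filter Asymptotics

/-- The polynomial with the given list of coefficients. -/
def evalList : List ℤ → ℂ → ℂ
  | [], _ => 0
  | a :: l, q => a + q * evalList l q

/-- Sum of coefficient lists. -/
def addList : List ℤ → List ℤ → List ℤ
  | [], m => m
  | a :: l, [] => a :: l
  | a :: l, b :: m => (a + b) :: addList l m

/-- Product of coefficient lists. -/
def mulList : List ℤ → List ℤ → List ℤ
  | [], _ => []
  | a :: l, m => addList (m.map (a * ·)) (0 :: mulList l m)

/-- Substitution `q ↦ q ^ (d + 1)` in a coefficient list. -/
def expandList (d : ℕ) : List ℤ → List ℤ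
  | [] => []
  | a :: l => a :: (List.replicate d 0 ++ expandList d l)

/-- The first `k` coefficients vanish. -/
def vanishes (k : ℕ) (l : List ℤ) : Bool := (l.take k).all (· == 0)

@[simp] theorem evalList_nil (q : ℂ) : evalList [] q = 0 := rfl

@[simp] theorem evalList_cons (a : ℤ) (l : List ℤ) (q : ℂ) :
    evalList (a :: l) q = a + q * evalList l q := rfl

theorem evalList_add (l m : List ℤ) (q : ℂ) :
    evalList (addList l m) q = evalList l q + evalList m q := by
  induction l generalizing m with
  | nil => simp [addList]
  | cons a l ih =>
    cases m with
    | nil => simp [addList]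
    | cons b m => simp [addList, ih]; ring

theorem evalList_map_mul (c : ℤ) (l : List ℤ) (q : ℂ) :
    evalList (l.map (c * ·)) q = c * evalList l q := by
  induction l with
  | nil => simp
  | cons a l ih => simp [ih]; ring

theorem evalList_mul (l m : List ℤ) (q : ℂ) :
    evalList (mulList l m) q = evalList l q * evalList m q := by
  induction l with
  | nil => simp [mulList]
  | cons a l ih => simp [mulList, evalList_add, evalList_map_mul, ih]; ring

theorem evalList_append (l m : List ℤ) (q : ℂ) :
    evalList (l ++ m) q = evalList l q + q ^ l.length * evalList m q := by
  induction l with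
  | nil => simp
  | cons a l ih => simp [ih, pow_succ]; ring

theorem evalList_replicate (d : ℕ) (q : ℂ) : evalList (List.replicate d 0) q = 0 := by
  induction d with
  | zero => rfl
  | succ d ih => simp [List.replicate_succ, ih]

theorem evalList_expand (d : ℕ) (l : List ℤ) (q : ℂ) :
    evalList (expandList d l) q = evalList l (q ^ (d + 1)) := by
  induction l with
  | nil => rfl
  | cons a l ih => simp [expandList, evalList_append, evalList_replicate, ih, pow_succ]; ring

theorem continuous_evalList (l : List ℤ) : Continuous (evalList l) := by
  induction l with
  | nil => exact continuous_const
  | cons a l ih => exact continuous_const.add (continuous_id.mul ih)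

theorem evalList_zero (l : List ℤ) : evalList l 0 = l.headD 0 := by
  cases l <;> simp

theorem isBigO_one_evalList (l : List ℤ) : evalList l =O[𝓝[≠] 0] (1 : ℂ → ℂ) :=
  (((continuous_evalList l).tendsto 0).isBigO_one ℂ).mono nhdsWithin_le_nhds

theorem isBigO_pow_mul {f : ℂ → ℂ} (hf : f =O[𝓝[≠] 0] (1 : ℂ → ℂ)) (k : ℕ) :
    (fun q => q ^ k * f q) =O[𝓝[≠] 0] fun q => q ^ k := by
  simpa using (isBigO_refl (fun q : ℂ => q ^ k) (𝓝[≠] 0)).mul hf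

theorem isBigO_pow_of_le {f : ℂ → ℂ} {k m : ℕ} (hf : f =O[𝓝[≠] 0] fun q => q ^ m) (h : k ≤ m) :
    f =O[𝓝[≠] 0] fun q => q ^ k := by
  refine hf.trans ?_
  obtain ⟨n, rfl⟩ := Nat.exists_eq_add_of_le h
  have : (fun q : ℂ => q ^ n) =O[𝓝[≠] 0] (1 : ℂ → ℂ) :=
    (((continuous_pow n).tendsto 0).isBigO_one ℂ).mono nhdsWithin_le_nhds
  simpa only [pow_add] using isBigO_pow_mul this k

theorem isBigO_evalList_of_vanishes {k : ℕ} {l : List ℤ} (h : vanishes k l) :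
    evalList l =O[𝓝[≠] 0] fun q => q ^ k := by
  induction k generalizing l with
  | zero => exact (isBigO_one_evalList l).congr_right fun q => by simp
  | succ k ih =>
    cases l with
    | nil => exact isBigO_zero _ _
    | cons a l =>
      simp only [vanishes, List.take_succ_cons, List.all_cons, Bool.and_eq_true, beq_iff_eq] at h
      obtain ⟨rfl, h⟩ := h
      have := (isBigO_refl (fun q : ℂ => q) (𝓝[≠] 0)).mul (ih (l := l) h)
      exact this.congr (fun q => by simp) fun q => by rw [pow_succ']

/-- Serves to show that a function with a nonzero truncated expansion is not zero. -/
theorem vanishes_of_isBigO {k : ℕ} {l : List ℤ} (h : evalList l =O[𝓝[≠] 0] fun q => q ^ k) :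
    vanishes k l := by
  induction k generalizing l with
  | zero => simp [vanishes]
  | succ k ih =>
    cases l with
    | nil => simp [vanishes]
    | cons a l =>
      have h0 : Tendsto (evalList (a :: l)) (𝓝[≠] 0) (𝓝 0) := by
        refine h.trans_tendsto ?_
        have : Tendsto (fun q : ℂ => q ^ (k + 1)) (𝓝 0) (𝓝 0) := by
          simpa using (continuous_pow (k + 1)).tendsto (0 : ℂ)
        exact this.mono_left nhdsWithin_le_nhds
      have h1 := ((continuous_evalList (a :: l)).tendsto 0).mono_left
        (nhdsWithin_le_nhds (s := {0}ᶜ))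
      have ha := tendsto_nhds_unique h0 h1
      rw [evalList_zero] at ha
      have ha : a = 0 := by exact_mod_cast ha.symm
      subst ha
      have h2 : evalList l =O[𝓝[≠] 0] fun q => q ^ k := by
        have h3 := (isBigO_refl (fun q : ℂ => q⁻¹) (𝓝[≠] 0)).mul h
        refine (h3.congr' ?_ ?_)
        · filter_upwards [self_mem_nhdsWithin] with q (hq : q ≠ 0)
          simp [hq]
        · filter_upwards [self_mem_nhdsWithin] with q (hq : q ≠ 0)
          rw [pow_succ']
          field_simp
      simpa [vanishes] using ih h2

/-- `f(q)` agrees with the polynomial with coefficients `l` up to `O(q^k)` as `q → 0`. -/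
def HasExp (k : ℕ) (f : ℂ → ℂ) (l : List ℤ) : Prop :=
  (fun q => f q - evalList l q) =O[𝓝[≠] 0] fun q => q ^ k

namespace HasExp

variable {k : ℕ} {f g : ℂ → ℂ} {l m n : List ℤ}

theorem of_vanishes (hf : HasExp k f l) (h : vanishes k (addList l (m.map (-1 * ·)))) :
    HasExp k f m := by
  have := IsBigO.add hf (isBigO_evalList_of_vanishes h)
  refine this.congr_left fun q => ?_
  rw [evalList_add, evalList_map_mul]
  push_cast
  ring

theorem mono {k' : ℕ} (hf : HasExp k f l) (h : k' ≤ k) : HasExp k' f l := isBigO_pow_of_le hf h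

theorem isBigO_one (hf : HasExp k f l) : f =O[𝓝[≠] 0] (1 : ℂ → ℂ) := by
  have h := (isBigO_pow_of_le hf (Nat.zero_le k)).congr_right (g₂ := 1) fun q => by simp
  exact (h.add (isBigO_one_evalList l)).congr_left fun q => by ring

theorem take (hf : HasExp k f l) : HasExp k f (l.take k) := by
  have h : ∀ (k : ℕ) (l : List ℤ) (q : ℂ),
      evalList l q - evalList (l.take k) q = q ^ k * evalList (l.drop k) q := by
    intro k
    induction k with
    | zero => intro l q; simp
    | succ k ih =>
      intro l q
      cases l with
      | nil => simp
      | cons a l =>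
        simp only [List.take_succ_cons, List.drop_succ_cons, evalList_cons, pow_succ', mul_assoc,
          ← ih]
        ring
  have := IsBigO.add hf (isBigO_pow_mul (isBigO_one_evalList (l.drop k)) k)
  refine this.congr_left fun q => ?_
  rw [← h]
  ring

theorem add (hf : HasExp k f l) (hg : HasExp k g m) :
    HasExp k (fun q => f q + g q) (addList l m) := by
  refine (IsBigO.add hf hg).congr_left fun q => ?_
  rw [evalList_add]
  ring

theorem mul (hf : HasExp k f l) (hg : HasExp k g m) :
    HasExp k (fun q => f q * g q) ((mulList l m).take k) := by
  have h1 := (IsBigO.mul hf hg.isBigO_one).congr_right (g₂ := fun q => q ^ k) fun q => by simp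
  have h2 := (IsBigO.mul (isBigO_one_evalList l) hg).congr_right (g₂ := fun q => q ^ k)
    fun q => by simp
  refine take ((h1.add h2).congr_left fun q => ?_)
  rw [evalList_mul]
  ring

theorem const (k : ℕ) (c : ℤ) : HasExp k (fun _ => (c : ℂ)) [c] := by
  simpa [HasExp] using isBigO_zero _ _

/-- The precision is multiplied as well; for `E₄(2τ)` two known coefficients thus become precision
four. -/
theorem expand (hf : HasExp k f l) (d : ℕ) :
    HasExp (k * (d + 1)) (fun q => f (q ^ (d + 1))) (expandList d l) := by
  have ht : Tendsto (fun q : ℂ => q ^ (d + 1)) (𝓝[≠] 0) (𝓝[≠] 0) := by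
    refine tendsto_nhdsWithin_iff.mpr ⟨?_, ?_⟩
    · have : Tendsto (fun q : ℂ => q ^ (d + 1)) (𝓝 0) (𝓝 0) := by
        simpa using (continuous_pow (d + 1)).tendsto (0 : ℂ)
      exact this.mono_left nhdsWithin_le_nhds
    · filter_upwards [self_mem_nhdsWithin] with q (hq : q ≠ 0) using pow_ne_zero _ hq
  refine (IsBigO.comp_tendsto hf ht).congr (fun q => ?_) fun q => ?_
  · simp [evalList_expand]
  · simp [← pow_mul, mul_comm]

theorem tendsto (hf : HasExp k f l) (hk : 0 < k) : Tendsto f (𝓝[≠] 0) (𝓝 (l.headD 0 : ℤ)) := by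
  have h1 : Tendsto (fun q => f q - evalList l q) (𝓝[≠] 0) (𝓝 0) := by
    refine IsBigO.trans_tendsto hf ?_
    have : Tendsto (fun q : ℂ => q ^ k) (𝓝 0) (𝓝 0) := by
      simpa [hk.ne'] using (continuous_pow k).tendsto (0 : ℂ)
    exact this.mono_left nhdsWithin_le_nhds
  have h2 := ((continuous_evalList l).tendsto 0).mono_left (nhdsWithin_le_nhds (s := {0}ᶜ))
  rw [evalList_zero] at h2
  simpa using h1.add h2

/-- `m` acts as a certificate: only `l m ≡ 1` modulo `q ^ k` has to be checked, however `m` was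
found. -/
theorem inv (hf : HasExp k f l) (hk : 0 < k) (hl : l.headD 0 ≠ 0)
    (h : vanishes k (addList (mulList l m) [-1])) : HasExp k (fun q => (f q)⁻¹) m := by
  have ht := hf.tendsto hk
  have hl' : ((l.headD 0 : ℤ) : ℂ) ≠ 0 := Int.cast_ne_zero.mpr hl
  have h1 : (fun q => (f q)⁻¹) =O[𝓝[≠] 0] (1 : ℂ → ℂ) := (ht.inv₀ hl').isBigO_one ℂ
  have h2 : (fun q => f q * evalList m q - 1) =O[𝓝[≠] 0] fun q => q ^ k := by
    have := (IsBigO.mul hf (isBigO_one_evalList m)).congr_right (g₂ := fun q => q ^ k)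
      fun q => by simp
    refine (this.add (isBigO_evalList_of_vanishes h)).congr_left fun q => ?_
    rw [evalList_add, evalList_mul]
    simp
    ring
  have h3 := (h1.mul h2).neg_left
  refine h3.congr' ?_ (Eventually.of_forall fun q => by simp)
  filter_upwards [ht.eventually_ne hl'] with q hq
  field_simp
  ring

theorem not_eventuallyEq_zero (hf : HasExp k f l) (h : vanishes k l = false) :
    ¬ ∀ᶠ q in 𝓝[≠] 0, f q = 0 := by
  intro h0
  have : evalList l =O[𝓝[≠] 0] fun q => q ^ k := by
    refine (IsBigO.neg_left hf).congr' ?_ (EventuallyEq.refl _ _)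
    filter_upwards [h0] with q hq
    rw [hq]
    ring
  rw [vanishes_of_isBigO this] at h
  exact absurd h (by simp)

theorem isBigO (hf : HasExp k f l) (h : vanishes k l) : f =O[𝓝[≠] 0] fun q => q ^ k := by
  refine (IsBigO.add hf (isBigO_evalList_of_vanishes h)).congr_left fun q => ?_
  ring

end HasExp

end GenusZero

/-! ### Expansions of eta quotients at the cusp `0` -/

namespace GenusZero

open UpperHalfPlane ModularGroup Matrix Matrix.SpecialLinearGroup Filter Asymptotics
open scoped MatrixGroups Manifold ModularForm

/-- Power of a coefficient list, truncated to `k` coefficients. -/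
def powList (k : ℕ) (l : List ℤ) : ℕ → List ℤ
  | 0 => [1]
  | n + 1 => (mulList l (powList k l n)).take k

/-- Inverse of a coefficient list with constant term `1`, truncated to `k` coefficients, in `n`
iterations. -/
def invList (k : ℕ) (l : List ℤ) : ℕ → List ℤ
  | 0 => [1]
  | n + 1 => (addList [1] (mulList (addList [1] (l.map (-1 * ·))) (invList k l n))).take k

theorem HasExp.pow {k : ℕ} {f : ℂ → ℂ} {l : List ℤ} (hf : HasExp k f l) (n : ℕ) :
    HasExp k (fun q => f q ^ n) (powList k l n) := by
  induction n with
  | zero => simpa [powList] using HasExp.const k 1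
  | succ n ih => simpa only [pow_succ', powList] using hf.mul ih

theorem HasExp.congr' {k : ℕ} {f g : ℂ → ℂ} {l : List ℤ} (hf : HasExp k f l)
    (h : f =ᶠ[𝓝[≠] 0] g) : HasExp k g l :=
  IsBigO.congr' hf (h.sub (EventuallyEq.refl _ _)) (EventuallyEq.refl _ _)

/-- The equation pins down the list, which has to be evaluated in `hasExp_eulerE`. -/
theorem hasExp_prod_one_sub_pow (k n : ℕ) :
    ∃ l, HasExp k (fun q => ∏ i ∈ Finset.range n, (1 - q ^ (i + 1))) l ∧
      l = (List.range n).foldl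
        (fun acc i => (mulList acc (1 :: (List.replicate i 0 ++ [-1]))).take k) [1] := by
  induction n with
  | zero => exact ⟨_, by simpa using HasExp.const k 1, rfl⟩
  | succ n ih =>
    obtain ⟨l, hl, rfl⟩ := ih
    have h : HasExp k (fun q => 1 - q ^ (n + 1)) (1 :: (List.replicate n 0 ++ [-1])) := by
      refine (isBigO_zero _ _).congr_left fun q => ?_
      simp [evalList_append, evalList_replicate, pow_succ']
      ring
    refine ⟨_, by simpa only [Finset.prod_range_succ] using hl.mul h, ?_⟩
    rw [List.range_succ, List.foldl_append]
    rfl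

/-- `|∏ (1 + a_n) - 1| ≤ exp (∑ |a_n|) - 1`, and for `|q| ≤ 1/2` the geometric sum is at most `|q| ^
k`. -/
theorem hasExp_tprod_one_sub_pow (k : ℕ) :
    HasExp k (fun q => ∏' n : ℕ, (1 - q ^ (n + k + 1))) [1] := by
  have hle : ∀ q : ℂ, ‖q‖ ≤ 1 / 2 →
      ‖∏' n : ℕ, (1 - q ^ (n + k + 1)) - 1‖ ≤ Real.exp (‖q‖ ^ k) - 1 := by
    intro q hq
    have hm : Multipliable fun n : ℕ => 1 - q ^ (n + k + 1) := by
      simp_rw [sub_eq_add_neg]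
      refine multipliable_one_add_of_summable ?_
      simpa [add_assoc] using (summable_nat_add_iff (k + 1)).mpr
        (summable_geometric_of_lt_one (norm_nonneg q) (by linarith))
    refine le_of_tendsto ((hm.hasProd.tendsto_prod_nat.sub_const 1).norm) (.of_forall fun n => ?_)
    have h1 := (Finset.range n).norm_prod_one_add_sub_one_le fun n => -q ^ (n + k + 1)
    simp only [← sub_eq_add_neg, norm_neg, norm_pow] at h1
    refine h1.trans ?_
    have h2 : ∑ i ∈ Finset.range n, ‖q‖ ^ (i + k + 1) ≤ ‖q‖ ^ k := by
      have h3 : ∑ i ∈ Finset.range n, ‖q‖ ^ i ≤ 2 := by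
        have := Summable.sum_le_tsum (Finset.range n) (fun i _ => pow_nonneg (norm_nonneg q) i)
          (summable_geometric_of_lt_one (norm_nonneg q) (by linarith))
        rw [tsum_geometric_of_lt_one (norm_nonneg q) (by linarith)] at this
        refine this.trans ?_
        rw [inv_le_comm₀ (by linarith) two_pos]
        linarith
      have h4 : ∑ i ∈ Finset.range n, ‖q‖ ^ (i + k + 1) =
          ‖q‖ ^ k * (‖q‖ * ∑ i ∈ Finset.range n, ‖q‖ ^ i) := by
        rw [Finset.mul_sum, Finset.mul_sum]
        exact Finset.sum_congr rfl fun i _ => by ring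
      rw [h4]
      refine mul_le_of_le_one_right (by positivity) ?_
      nlinarith [norm_nonneg q]
    linarith [Real.exp_le_exp.mpr h2]
  have hexp : ∀ x : ℝ, 0 ≤ x → x ≤ 1 → Real.exp x - 1 ≤ 2 * x := fun x h0 h1 => by
    have := Real.abs_exp_sub_one_le (x := x) (by rwa [abs_of_nonneg h0])
    rw [abs_of_nonneg h0] at this
    exact (le_abs_self _).trans this
  refine IsBigO.of_bound 2 ?_
  have hb : ∀ᶠ q : ℂ in 𝓝[≠] 0, ‖q‖ ≤ 1 / 2 := by
    refine nhdsWithin_le_nhds ?_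
    filter_upwards [Metric.ball_mem_nhds (0 : ℂ) (by norm_num : (0 : ℝ) < 1 / 2)] with q hq
    simpa using (mem_ball_zero_iff.mp hq).le
  filter_upwards [hb] with q hq
  rw [norm_pow]
  simpa using (hle q hq).trans (hexp _ (by positivity) (pow_le_one₀ (norm_nonneg q) (by linarith)))

theorem eulerE_eq_mul {q : ℂ} (hq : ‖q‖ < 1) (k : ℕ) : eulerE q =
    (∏ i ∈ Finset.range k, (1 - q ^ (i + 1))) * ∏' n : ℕ, (1 - q ^ (n + k + 1)) := by
  have hm : Multipliable fun n : ℕ => 1 - q ^ (n + k + 1) := by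
    simp_rw [sub_eq_add_neg]
    refine multipliable_one_add_of_summable ?_
    simpa [add_assoc] using (summable_nat_add_iff (k + 1)).mpr
      (summable_geometric_of_lt_one (norm_nonneg q) hq)
  exact (Multipliable.prod_mul_tprod_nat_mul' (f := fun n => 1 - q ^ (n + 1)) hm).symm

/-- The start of the pentagonal number series, whose next exponent is `12`. Twelve coefficients
cover all later needs; the largest is eleven, in `hauptmodul_5_eq`. -/
theorem hasExp_eulerE : HasExp 12 eulerE [1, -1, -1, 0, 0, 1, 0, 1] := by
  obtain ⟨l, hl, rfl⟩ := hasExp_prod_one_sub_pow 12 12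
  have h := hl.mul (hasExp_tprod_one_sub_pow 12)
  refine (h.of_vanishes (m := [1, -1, -1, 0, 0, 1, 0, 1]) (by decide +kernel)).congr' ?_
  have hb : ∀ᶠ q : ℂ in 𝓝[≠] 0, ‖q‖ < 1 := by
    refine nhdsWithin_le_nhds ?_
    filter_upwards [Metric.ball_mem_nhds (0 : ℂ) one_pos] with q hq using mem_ball_zero_iff.mp hq
  filter_upwards [hb] with q hq
  rw [eulerE_eq_mul hq 12]

theorem hasExp_eulerE_pow {d : ℕ} (hd : d ≠ 0) : HasExp 12 (fun q => eulerE (q ^ d))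
    ((expandList (d - 1) [1, -1, -1, 0, 0, 1, 0, 1]).take 12) := by
  have := hasExp_eulerE.expand (d - 1)
  rw [Nat.sub_add_cancel (Nat.pos_of_ne_zero hd)] at this
  exact (this.mono (Nat.le_mul_of_pos_right _ (Nat.pos_of_ne_zero hd))).take

/-- Coefficients of `∏_{d ∈ s} eulerE (q ^ d) ^ r d` for natural exponents. -/
def eulerProdList (r : ℕ → ℕ) : List ℕ → List ℤ
  | [] => [1]
  | d :: s => (mulList (powList 12 ((expandList (d - 1) [1, -1, -1, 0, 0, 1, 0, 1]).take 12) (r d))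
      (eulerProdList r s)).take 12

theorem hasExp_eulerProdList (r : ℕ → ℕ) {s : List ℕ} (hs : 0 ∉ s) :
    HasExp 12 (fun q => (s.map fun d => eulerE (q ^ d) ^ r d).prod) (eulerProdList r s) := by
  induction s with
  | nil => simpa [eulerProdList] using HasExp.const 12 1
  | cons d s ih =>
    simp only [List.mem_cons, not_or] at hs
    simpa [eulerProdList] using ((hasExp_eulerE_pow (Ne.symm hs.1)).pow (r d)).mul (ih hs.2)

/-- Coefficients of `∏_{d ∈ s} eulerE (q ^ d) ^ r d`. -/
def eulerQuotList (r : ℕ → ℤ) (s : List ℕ) : List ℤ :=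
  (mulList (eulerProdList (fun d => (r d).toNat) s)
    (invList 12 (eulerProdList (fun d => (-r d).toNat) s) 12)).take 12

/-- Positive and negative exponents are expanded separately as polynomials, and the second product
is inverted by means of the certificate `hinv`. -/
theorem hasExp_eulerQuot (r : ℕ → ℤ) {s : List ℕ} (hs : 0 ∉ s)
    (hhead : (eulerProdList (fun d => (-r d).toNat) s).headD 0 ≠ 0)
    (hinv : vanishes 12 (addList (mulList (eulerProdList (fun d => (-r d).toNat) s)
      (invList 12 (eulerProdList (fun d => (-r d).toNat) s) 12)) [-1])) :
    HasExp 12 (fun q => (s.map fun d => eulerE (q ^ d) ^ r d).prod) (eulerQuotList r s) := by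
  have h1 := hasExp_eulerProdList (fun d => (r d).toNat) hs
  have h2 := (hasExp_eulerProdList (fun d => (-r d).toNat) hs).inv (by norm_num) hhead hinv
  refine (h1.mul h2).congr' ?_
  have hne : ∀ s : List ℕ, 0 ∉ s → ∀ᶠ q in 𝓝[≠] 0, ∀ d ∈ s, eulerE (q ^ d) ≠ 0 := by
    intro s
    induction s with
    | nil => exact fun _ => .of_forall fun q => by simp
    | cons d s ih =>
      intro hs
      simp only [List.mem_cons, not_or] at hs
      have ht := (hasExp_eulerE_pow (Ne.symm hs.1)).tendsto (by norm_num)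
      filter_upwards [ih hs.2, ht.eventually_ne (b₂ := 0) (by simp [expandList])] with q h1 h2
      simpa using ⟨h2, h1⟩
  filter_upwards [hne s hs] with q hq
  have key : ∀ s : List ℕ, (∀ d ∈ s, eulerE (q ^ d) ≠ 0) →
      (s.map fun d => eulerE (q ^ d) ^ (r d).toNat).prod *
        ((s.map fun d => eulerE (q ^ d) ^ (-r d).toNat).prod)⁻¹ =
      (s.map fun d => eulerE (q ^ d) ^ r d).prod := by
    intro s
    induction s with
    | nil => simp
    | cons d s ih =>
      intro hq
      simp only [List.mem_cons, forall_eq_or_imp] at hq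
      simp only [List.map_cons, List.prod_cons, mul_inv, ← ih hq.2]
      have e : eulerE (q ^ d) ^ r d =
          eulerE (q ^ d) ^ (r d).toNat * (eulerE (q ^ d) ^ (-r d).toNat)⁻¹ := by
        rw [← zpow_natCast _ (r d).toNat, ← zpow_natCast _ (-r d).toNat, ← _root_.zpow_neg, ← zpow_add₀ hq.1, ← sub_eq_add_neg,
          Int.toNat_sub_toNat_neg]
      rw [e]
      ring
  rw [key s hq]

/-! ### Functions with a known expansion at the cusp `0` -/

/-- `f` is holomorphic, bounded at the cusps of `Γ₀(L)` other than `0`, and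
`q^m f(-1 / (L τ))` has the expansion `l`. -/
structure HasFrickeExp (L : ℕ) (hL : 0 < L) (k : ℕ) (f : ℍ → ℂ) (m : ℕ) (l : List ℤ) : Prop where
  mdiff : MDiff f
  bounded : ∀ γ : SL(2, ℤ), ¬ IsCoprime (γ 1 0) (L : ℤ) → IsBoundedAtImInfty fun τ => f (γ • τ)
  exists_hasExp : ∃ F, (∀ τ, f (fricke L hL τ) * Function.Periodic.qParam 1 τ ^ m =
    F (Function.Periodic.qParam 1 τ)) ∧ HasExp k F l

theorem mdiff_add {f g : ℍ → ℂ} (hf : MDiff f) (hg : MDiff g) : MDiff (fun τ => f τ + g τ) := by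
  rw [UpperHalfPlane.mdifferentiable_iff] at *
  exact hf.add hg

theorem mdiff_mul {f g : ℍ → ℂ} (hf : MDiff f) (hg : MDiff g) : MDiff (fun τ => f τ * g τ) := by
  rw [UpperHalfPlane.mdifferentiable_iff] at *
  exact hf.mul hg

theorem mdiff_const (c : ℂ) : MDiff (fun _ : ℍ => c) := by
  rw [UpperHalfPlane.mdifferentiable_iff]
  exact differentiableOn_const c

namespace HasFrickeExp

variable {L k m n : ℕ} {hL : 0 < L} {f g : ℍ → ℂ} {l l' : List ℤ}

theorem add (hf : HasFrickeExp L hL k f m l) (hg : HasFrickeExp L hL k g m l') :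
    HasFrickeExp L hL k (fun τ => f τ + g τ) m (addList l l') := by
  obtain ⟨F, hF, hFl⟩ := hf.exists_hasExp
  obtain ⟨G, hG, hGl⟩ := hg.exists_hasExp
  exact ⟨mdiff_add hf.mdiff hg.mdiff, fun γ hγ => (hf.bounded γ hγ).add (hg.bounded γ hγ), _,
    fun τ => by rw [add_mul, hF, hG], hFl.add hGl⟩

theorem mul (hf : HasFrickeExp L hL k f m l) (hg : HasFrickeExp L hL k g n l') :
    HasFrickeExp L hL k (fun τ => f τ * g τ) (m + n) ((mulList l l').take k) := by
  obtain ⟨F, hF, hFl⟩ := hf.exists_hasExp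
  obtain ⟨G, hG, hGl⟩ := hg.exists_hasExp
  exact ⟨mdiff_mul hf.mdiff hg.mdiff, fun γ hγ => (hf.bounded γ hγ).mul (hg.bounded γ hγ), _,
    fun τ => by rw [pow_add, mul_mul_mul_comm, hF, hG], hFl.mul hGl⟩

theorem const (L : ℕ) (hL : 0 < L) (k : ℕ) (c : ℤ) :
    HasFrickeExp L hL k (fun _ => (c : ℂ)) 0 [c] :=
  ⟨mdiff_const _, fun _ _ => Filter.const_boundedAtFilter _ _, _, fun _ => by rw [pow_zero, mul_one],
    HasExp.const k c⟩

/-- Relaxing the pole order from `m` to `j + m` allows functions with different pole orders to be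
added. -/
theorem shift (hf : HasFrickeExp L hL k f m l) (j : ℕ) :
    HasFrickeExp L hL k f (j + m) (List.replicate j 0 ++ l) := by
  obtain ⟨F, hF, hFl⟩ := hf.exists_hasExp
  refine ⟨hf.mdiff, hf.bounded, fun q => q ^ j * F q, fun τ => ?_, ?_⟩
  · rw [pow_add, mul_left_comm, hF]
  · have h1 : (fun q : ℂ => q ^ j) =O[𝓝[≠] 0] (1 : ℂ → ℂ) :=
      (((continuous_pow j).tendsto 0).isBigO_one ℂ).mono nhdsWithin_le_nhds
    refine (h1.mul hFl).congr (fun q => ?_) fun q => by simp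
    rw [evalList_append, evalList_replicate, List.length_replicate]
    ring

/-- If `f g` is invariant under `Γ₀(L)`, `f` vanishes to sufficiently high order at the cusp `0`,
and `g` is not zero, then `f` is zero. -/
theorem eq_zero (hf : HasFrickeExp L hL k f m l) (hg : HasFrickeExp L hL k g n l')
    (hinv : ∀ γ : SL(2, ℤ), (L : ℤ) ∣ γ 1 0 → ∀ τ, f (γ • τ) * g (γ • τ) = f τ * g τ)
    (hk : m + n + 1 ≤ k) (hl : vanishes (m + n + 1) l) (hl' : vanishes k l' = false) (τ : ℍ) :
    f τ = 0 := by
  obtain ⟨F, hF, hFl⟩ := hf.exists_hasExp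
  obtain ⟨G, hG, hGl⟩ := hg.exists_hasExp
  have hq : Tendsto (fun τ : ℍ => Function.Periodic.qParam 1 τ) atImInfty (𝓝[≠] 0) :=
    (Function.Periodic.qParam_tendsto one_pos).comp tendsto_coe_atImInfty
  have hq0 (τ : ℍ) : Function.Periodic.qParam 1 τ ≠ 0 := Function.Periodic.qParam_ne_zero _
  -- At the Fricke image `f g` is `q ^ (-(m + n)) F G`. As `F = O(q ^ (m + n + 1))`, it is `O(q)`,
  -- so `f g` vanishes at the cusp `0`.
  have hFG : ∀ τ, f τ * g τ = 0 := by
    refine eq_zero_of_gamma0 hL (mdiff_mul hf.mdiff hg.mdiff) hinv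
      (fun γ hγ => (hf.bounded γ hγ).mul (hg.bounded γ hγ)) ?_
    have h1 := (((hFl.mono hk).isBigO hl).mul hGl.isBigO_one).comp_tendsto hq
    have h2 : (fun τ : ℍ => f (fricke L hL τ) * g (fricke L hL τ)) =O[atImInfty]
        fun τ : ℍ => Function.Periodic.qParam 1 τ := by
      have h3 := (isBigO_refl (fun τ : ℍ => (Function.Periodic.qParam 1 τ ^ (m + n))⁻¹)
        atImInfty).mul h1
      refine h3.congr (fun τ => ?_) fun τ => ?_
      · simp only [Function.comp_apply, ← hF, ← hG]
        have := hq0 τ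
        field_simp
        ring
      · simp only [Function.comp_apply, Pi.one_apply]
        have := hq0 τ
        field_simp
        ring
    exact h2.trans_tendsto (hq.mono_right nhdsWithin_le_nhds)
  -- Every nonzero `q` in the unit disc comes from a point of `ℍ`, so `g = 0` would make `G` zero
  -- near `0`, against `hl'`.
  have hne : g ≠ 0 := by
    rintro rfl
    refine hGl.not_eventuallyEq_zero hl' ?_
    have hI : ∀ᶠ q : ℂ in 𝓝[≠] 0, ‖q‖ < 1 := by
      refine nhdsWithin_le_nhds ?_
      filter_upwards [Metric.ball_mem_nhds (0 : ℂ) one_pos] with q hq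
        using mem_ball_zero_iff.mp hq
    filter_upwards [hI, self_mem_nhdsWithin] with q h1 (h2 : q ≠ 0)
    have him : 0 < (Function.Periodic.invQParam 1 q).im := by
      rw [Function.Periodic.im_invQParam]
      have := Real.log_neg (norm_pos_iff.mpr h2) h1
      have hpi := Real.pi_pos
      rw [neg_div, neg_mul, ← mul_neg]
      exact mul_pos (by positivity) (neg_pos.mpr this)
    have := hG ⟨_, him⟩
    rw [UpperHalfPlane.coe_mk, Function.Periodic.qParam_right_inv one_ne_zero h2] at this
    simpa using this.symm
  have := (UpperHalfPlane.mul_eq_zero_iff hf.mdiff hg.mdiff).mp (funext hFG)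
  exact congrFun (this.resolve_right hne) τ

end HasFrickeExp

theorem qParam_one_eq_pow (z : ℂ) :
    Function.Periodic.qParam 1 z = Function.Periodic.qParam 24 z ^ 24 := by
  rw [Function.Periodic.qParam, Function.Periodic.qParam, ← Complex.exp_nat_mul]
  push_cast
  ring_nf

theorem tendsto_eulerE_qParam_pow {d : ℕ} (hd : d ≠ 0) :
    Tendsto (fun τ : ℍ => eulerE (Function.Periodic.qParam 1 τ ^ d)) atImInfty (𝓝 1) := by
  have h1 : ContinuousAt eulerE 0 := (differentiableAt_eulerE (by simp)).continuousAt
  have h2 : Tendsto (fun τ : ℍ => Function.Periodic.qParam 1 (τ : ℂ) ^ d) atImInfty (𝓝 0) := by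
    simpa [hd] using (qParam_tendsto_atImInfty one_pos).pow d
  have h3 : Tendsto eulerE (𝓝 0) (𝓝 1) := by simpa only [eulerE_zero] using h1.tendsto
  exact h3.comp h2

theorem etaQuot_eq_qParam_mul {L : ℕ} {r : ℕ → ℤ} {m : ℤ} (hm : ∑ d ∈ L.divisors, d * r d = 24 * m)
    (z : ℂ) : etaQuot L r z = Function.Periodic.qParam 1 z ^ m *
      ∏ d ∈ L.divisors, eulerE (Function.Periodic.qParam 1 z ^ d) ^ r d := by
  have hQ0 : Function.Periodic.qParam 24 z ≠ 0 := Function.Periodic.qParam_ne_zero _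
  have h1 : Function.Periodic.qParam 1 z ^ m = Function.Periodic.qParam 24 z ^ (24 * m) := by
    rw [qParam_one_eq_pow, _root_.zpow_mul]
    rfl
  rw [h1, etaQuot, ← hm, ← prod_zpow_const hQ0, ← Finset.prod_mul_distrib]
  refine Finset.prod_congr rfl fun d _ => ?_
  rw [etaMul_eq_eulerE, mul_zpow, ← zpow_natCast, ← _root_.zpow_mul]

/-- The expansion at the cusp `0` of a multiple of an eta quotient, normalized to have leading
coefficient `1` there. -/
theorem hasFrickeExp_etaQuot {L : ℕ} (hL : 0 < L) {r : ℕ → ℤ} {s : List ℕ} (hs0 : 0 ∉ s)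
    (hs : s.Nodup) (hsL : s.toFinset = L.divisors) (hr0 : ∑ d ∈ L.divisors, r d = 0)
    {κ : ℕ} (hκ : 0 < κ) (hκ2 : (κ : ℚ) ^ 2 * ∏ d ∈ L.divisors, (d : ℚ) ^ r (L / d) = 1)
    -- `hm` fixes the pole order at the cusp `0`. In `hord`, `g` is the gcd of the lower left entry
    -- with `L`, which is all that matters for the order; `g = 1` is the cusp `0` and is left out.
    {m : ℕ} (hm : ∑ d ∈ L.divisors, d * r (L / d) = -24 * m)
    (hord : ∀ g ∈ L.divisors, g ≠ 1 →
      0 ≤ ∑ d ∈ L.divisors, r d * ((Nat.gcd g d : ℤ) ^ 2 * (L / d : ℕ)))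
    (hhead : (eulerProdList (fun d => (-r (L / d)).toNat) s).headD 0 ≠ 0)
    (hinv : vanishes 12 (addList (mulList (eulerProdList (fun d => (-r (L / d)).toNat) s)
      (invList 12 (eulerProdList (fun d => (-r (L / d)).toNat) s) 12)) [-1])) :
    HasFrickeExp L hL 12 (fun τ => κ * etaQuot L r τ) m (eulerQuotList (fun d => r (L / d)) s) := by
  refine ⟨mdiff_mul (mdiff_const _) (mdiff_etaQuot L r), fun γ hγ => ?_, _, fun τ => ?_,
    hasExp_eulerQuot (fun d => r (L / d)) hs0 hhead hinv⟩
  · refine (Filter.const_boundedAtFilter _ _).mul (isBoundedAtImInfty_etaQuot_smul hr0 γ ?_)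
    have hg : Int.gcd (γ 1 0) L ∈ L.divisors :=
      Nat.mem_divisors.mpr ⟨Int.natCast_dvd_natCast.mp (Int.gcd_dvd_right _ _), hL.ne'⟩
    refine (hord _ hg fun h => hγ (Int.isCoprime_iff_gcd_eq_one.mpr h)).trans_eq ?_
    refine Finset.sum_congr rfl fun d hd => ?_
    have : Nat.gcd (Int.gcd (γ 1 0) L) d = Int.gcd (γ 1 0) d := by
      rw [Int.gcd, Int.gcd, Int.natAbs_natCast, Int.natAbs_natCast, Nat.gcd_assoc,
        Nat.gcd_eq_right (Nat.dvd_of_mem_divisors hd)]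
    rw [this]
  · have hκR : (κ : ℝ) ^ 2 * ∏ d ∈ L.divisors, (d : ℝ) ^ r (L / d) = 1 := by
      have := congrArg (fun x : ℚ => (x : ℝ)) hκ2
      push_cast at this
      exact this
    have hκ0 : (0 : ℝ) < κ := Nat.cast_pos.mpr hκ
    rw [etaQuot_fricke hL hr0 (C := (κ : ℝ)⁻¹) (by positivity)
      (by rw [inv_pow]; exact inv_eq_of_mul_eq_one_right hκR)]
    have hκC : (κ : ℂ) ≠ 0 := Nat.cast_ne_zero.mpr hκ.ne'
    have hq0 : Function.Periodic.qParam 1 (τ : ℂ) ≠ 0 := Function.Periodic.qParam_ne_zero _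
    have h1 := etaQuot_eq_qParam_mul (m := -m) (by rw [hm]; ring) (τ : ℂ)
    have h2 : Function.Periodic.qParam 1 (τ : ℂ) ^ (-m : ℤ) * Function.Periodic.qParam 1 τ ^ m = 1 := by
      rw [_root_.zpow_neg, zpow_natCast, inv_mul_cancel₀ (pow_ne_zero _ hq0)]
    rw [← List.prod_toFinset _ hs, hsL, h1]
    push_cast
    rw [mul_inv_cancel_left₀ hκC, mul_right_comm, h2, one_mul]

end GenusZero

/-! ### Identities between eta quotients -/

namespace GenusZero

open UpperHalfPlane ModularGroup Matrix Matrix.SpecialLinearGroup Filter Asymptotics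
open scoped MatrixGroups Manifold ModularForm

/-- Exponents of the eta quotient `t_N`. -/
def hauptExp : ℕ → ℕ → ℤ
  | 2, 1 => -24
  | 2, 2 => 24
  | 3, 1 => -12
  | 3, 3 => 12
  | 4, 1 => -8
  | 4, 4 => 8
  | 5, 1 => -6
  | 5, 5 => 6
  | 6, 1 => -5
  | 6, 2 => 1
  | 6, 3 => -1
  | 6, 6 => 5
  | 8, 1 => -4
  | 8, 2 => 2
  | 8, 4 => -2
  | 8, 8 => 4
  | 9, 1 => -3
  | 9, 9 => 3
  | 10, 1 => -3
  | 10, 2 => 1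
  | 10, 5 => -1
  | 10, 10 => 3
  | 12, 1 => -3
  | 12, 2 => 2
  | 12, 3 => 1
  | 12, 4 => -1
  | 12, 6 => -2
  | 12, 12 => 3
  | 16, 1 => -2
  | 16, 2 => 1
  | 16, 8 => -1
  | 16, 16 => 2
  | 18, 1 => -2
  | 18, 2 => 1
  | 18, 3 => 1
  | 18, 6 => -1
  | 18, 9 => -1
  | 18, 18 => 2
  | 25, 1 => -1
  | 25, 25 => 1
  | _, _ => 0

/-- Half the exponents of the eta quotients `t_2`, `t_5`, `t_8`. -/
def halfHauptExp : ℕ → ℕ → ℤ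
  | 2, 1 => -12
  | 2, 2 => 12
  | 5, 1 => -3
  | 5, 5 => 3
  | 8, 1 => -2
  | 8, 2 => 1
  | 8, 4 => -1
  | 8, 8 => 2
  | _, _ => 0

/-- Half the exponents of the eta quotients `t_6 + 9`, `t_10 + 5`, `t_12 + 3`. -/
def halfShiftExp : ℕ → ℕ → ℤ
  | 6, 1 => -4
  | 6, 2 => 2
  | 6, 3 => 4
  | 6, 6 => -2
  | 10, 1 => -2
  | 10, 2 => 1
  | 10, 5 => 2
  | 10, 10 => -1
  | 12, 1 => -2
  | 12, 2 => 1
  | 12, 3 => 2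
  | 12, 6 => -1
  | _, _ => 0

/-- Exponents of the eta quotient `t_18 + 3`. -/
def shiftExp : ℕ → ℤ
  | 1 => -2
  | 2 => 1
  | 9 => 2
  | 18 => -1
  | _ => 0

theorem HasFrickeExp.sub {L k m : ℕ} {hL : 0 < L} {f g : ℍ → ℂ} {l l' : List ℤ}
    (hf : HasFrickeExp L hL k f m l) (hg : HasFrickeExp L hL k g m l') :
    HasFrickeExp L hL k (fun τ => f τ - g τ) m (addList l ((mulList [-1] l').take k)) := by
  have h := (HasFrickeExp.const L hL k (-1)).mul hg
  rw [zero_add] at h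
  simpa [sub_eq_add_neg] using hf.add h

/-- If `E` and `t²` are invariant under `Γ₀(L)` and both `E` and `t` have a simple pole at the cusp
`0`, then `E = t + c` can be checked on the leading terms at the cusp `0`. -/
theorem HasFrickeExp.eq_add_const {L : ℕ} {hL : 0 < L} {E t : ℍ → ℂ} {l l' : List ℤ}
    (hE : HasFrickeExp L hL 12 E 1 l) (ht : HasFrickeExp L hL 12 t 1 l')
    (hEinv : ∀ γ : SL(2, ℤ), (L : ℤ) ∣ γ 1 0 → ∀ τ, E (γ • τ) = E τ)
    (htinv : ∀ γ : SL(2, ℤ), (L : ℤ) ∣ γ 1 0 → ∀ τ, t (γ • τ) ^ 2 = t τ ^ 2) (c : ℤ)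
    (h1 : vanishes 3 (addList (addList l ((mulList [-1] l').take 12)) [0, -c]))
    (h2 : vanishes 12 (addList (addList l l') [0, -c]) = false) (τ : ℍ) : E τ = t τ + c := by
  have hc : HasFrickeExp L hL 12 (fun _ => ((-c : ℤ) : ℂ)) 1 [0, -c] :=
    (HasFrickeExp.const L hL 12 (-c)).shift 1
  -- `(E - t - c)(E + t - c) = (E - c)² - t²` involves `t` only through its square.
  have := ((hE.sub ht).add hc).eq_zero ((hE.add ht).add hc) (fun γ hγ τ => by
    rw [hEinv γ hγ]
    linear_combination -htinv γ hγ τ) (by norm_num) h1 h2 τ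
  push_cast at this
  linear_combination this

theorem mul_etaQuot_smul_sq {L : ℕ} {r : ℕ → ℤ} (hr0 : ∑ d ∈ L.divisors, r d = 0)
    (hr : TrivialCharacter (ZMod 12) L r) (κ : ℂ) (γ : SL(2, ℤ)) (hγ : (L : ℤ) ∣ γ 1 0) (τ : ℍ) :
    (κ * etaQuot L r (γ • τ : ℍ)) ^ 2 = (κ * etaQuot L r τ) ^ 2 := by
  rw [mul_pow, mul_pow, etaQuot_smul_sq hr0 hr γ hγ]

theorem mul_etaQuot_smul {L : ℕ} {r : ℕ → ℤ} (hr0 : ∑ d ∈ L.divisors, r d = 0)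
    (hr : TrivialCharacter (ZMod 12) L r) (κ : ℂ) (γ : SL(2, ℤ)) (hγ : (L : ℤ) ∣ γ 1 0) (τ : ℍ) :
    κ * etaQuot L (fun d => 2 * r d) (γ • τ : ℍ) = κ * etaQuot L (fun d => 2 * r d) τ := by
  rw [etaQuot_smul hr0 hr γ hγ]

/-! ### Expansions and characters of the individual eta quotients -/

theorem hasFrickeExp_hauptmodul_6 : HasFrickeExp 6 (by norm_num) 12
    (fun τ => (72 : ℕ) * etaQuot 6 (hauptExp 6) τ) 1
    (eulerQuotList (fun d => (hauptExp 6) (6 / d)) [1, 2, 3, 6]) :=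
  hasFrickeExp_etaQuot (by norm_num) (by decide) (by decide) (by decide +kernel)
    (by decide +kernel) (by norm_num) (by decide +kernel) (by decide +kernel) (by decide +kernel)
    (by decide +kernel) (by decide +kernel)

theorem trivialCharacter_hauptExp_6 : TrivialCharacter (ZMod 12) 6 (hauptExp 6) :=
  .of_three_four (by unfold TrivialCharacter; decide +kernel)
    (by unfold TrivialCharacter; decide +kernel)

theorem hasFrickeExp_hauptmodul_10 : HasFrickeExp 10 (by norm_num) 12
    (fun τ => (20 : ℕ) * etaQuot 10 (hauptExp 10) τ) 1
    (eulerQuotList (fun d => (hauptExp 10) (10 / d)) [1, 2, 5, 10]) :=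
  hasFrickeExp_etaQuot (by norm_num) (by decide) (by decide) (by decide +kernel)
    (by decide +kernel) (by norm_num) (by decide +kernel) (by decide +kernel) (by decide +kernel)
    (by decide +kernel) (by decide +kernel)

theorem trivialCharacter_hauptExp_10 : TrivialCharacter (ZMod 12) 10 (hauptExp 10) :=
  .of_three_four (by unfold TrivialCharacter; decide +kernel)
    (by unfold TrivialCharacter; decide +kernel)

theorem hasFrickeExp_hauptmodul_12 : HasFrickeExp 12 (by norm_num) 12
    (fun τ => (12 : ℕ) * etaQuot 12 (hauptExp 12) τ) 1
    (eulerQuotList (fun d => (hauptExp 12) (12 / d)) [1, 2, 3, 4, 6, 12]) :=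
  hasFrickeExp_etaQuot (by norm_num) (by decide) (by decide) (by decide +kernel)
    (by decide +kernel) (by norm_num) (by decide +kernel) (by decide +kernel) (by decide +kernel)
    (by decide +kernel) (by decide +kernel)

theorem trivialCharacter_hauptExp_12 : TrivialCharacter (ZMod 12) 12 (hauptExp 12) :=
  .of_three_four (by unfold TrivialCharacter; decide +kernel)
    (by unfold TrivialCharacter; decide +kernel)

theorem hasFrickeExp_hauptmodul_16 : HasFrickeExp 16 (by norm_num) 12
    (fun τ => (8 : ℕ) * etaQuot 16 (hauptExp 16) τ) 1
    (eulerQuotList (fun d => (hauptExp 16) (16 / d)) [1, 2, 4, 8, 16]) :=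
  hasFrickeExp_etaQuot (by norm_num) (by decide) (by decide) (by decide +kernel)
    (by decide +kernel) (by norm_num) (by decide +kernel) (by decide +kernel) (by decide +kernel)
    (by decide +kernel) (by decide +kernel)

theorem trivialCharacter_hauptExp_16 : TrivialCharacter (ZMod 12) 16 (hauptExp 16) :=
  .of_three_four (by unfold TrivialCharacter; decide +kernel)
    (by unfold TrivialCharacter; decide +kernel)

theorem hasFrickeExp_hauptmodul_18 : HasFrickeExp 18 (by norm_num) 12
    (fun τ => (6 : ℕ) * etaQuot 18 (hauptExp 18) τ) 1
    (eulerQuotList (fun d => (hauptExp 18) (18 / d)) [1, 2, 3, 6, 9, 18]) :=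
  hasFrickeExp_etaQuot (by norm_num) (by decide) (by decide) (by decide +kernel)
    (by decide +kernel) (by norm_num) (by decide +kernel) (by decide +kernel) (by decide +kernel)
    (by decide +kernel) (by decide +kernel)

theorem trivialCharacter_hauptExp_18 : TrivialCharacter (ZMod 12) 18 (hauptExp 18) :=
  .of_three_four (by unfold TrivialCharacter; decide +kernel)
    (by unfold TrivialCharacter; decide +kernel)

theorem hasFrickeExp_hauptmodul_25 : HasFrickeExp 25 (by norm_num) 12
    (fun τ => (5 : ℕ) * etaQuot 25 (hauptExp 25) τ) 1
    (eulerQuotList (fun d => (hauptExp 25) (25 / d)) [1, 5, 25]) :=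
  hasFrickeExp_etaQuot (by norm_num) (by decide) (by decide) (by decide +kernel)
    (by decide +kernel) (by norm_num) (by decide +kernel) (by decide +kernel) (by decide +kernel)
    (by decide +kernel) (by decide +kernel)

theorem trivialCharacter_hauptExp_25 : TrivialCharacter (ZMod 12) 25 (hauptExp 25) :=
  .of_three_four (by unfold TrivialCharacter; decide +kernel)
    (by unfold TrivialCharacter; decide +kernel)

theorem hasFrickeExp_shift_6 : HasFrickeExp 6 (by norm_num) 12
    (fun τ => (9 : ℕ) * etaQuot 6 (fun d => 2 * halfShiftExp 6 d) τ) 1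
    (eulerQuotList (fun d => (fun d => 2 * halfShiftExp 6 d) (6 / d)) [1, 2, 3, 6]) :=
  hasFrickeExp_etaQuot (by norm_num) (by decide) (by decide) (by decide +kernel)
    (by decide +kernel) (by norm_num) (by decide +kernel) (by decide +kernel) (by decide +kernel)
    (by decide +kernel) (by decide +kernel)

theorem trivialCharacter_halfShiftExp_6 : TrivialCharacter (ZMod 12) 6 (halfShiftExp 6) :=
  .of_three_four (by unfold TrivialCharacter; decide +kernel)
    (by unfold TrivialCharacter; decide +kernel)

theorem hasFrickeExp_shift_10 : HasFrickeExp 10 (by norm_num) 12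
    (fun τ => (5 : ℕ) * etaQuot 10 (fun d => 2 * halfShiftExp 10 d) τ) 1
    (eulerQuotList (fun d => (fun d => 2 * halfShiftExp 10 d) (10 / d)) [1, 2, 5, 10]) :=
  hasFrickeExp_etaQuot (by norm_num) (by decide) (by decide) (by decide +kernel)
    (by decide +kernel) (by norm_num) (by decide +kernel) (by decide +kernel) (by decide +kernel)
    (by decide +kernel) (by decide +kernel)

theorem trivialCharacter_halfShiftExp_10 : TrivialCharacter (ZMod 12) 10 (halfShiftExp 10) :=
  .of_three_four (by unfold TrivialCharacter; decide +kernel)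
    (by unfold TrivialCharacter; decide +kernel)

theorem hasFrickeExp_shift_12 : HasFrickeExp 12 (by norm_num) 12
    (fun τ => (3 : ℕ) * etaQuot 12 (fun d => 2 * halfShiftExp 12 d) τ) 1
    (eulerQuotList (fun d => (fun d => 2 * halfShiftExp 12 d) (12 / d)) [1, 2, 3, 4, 6, 12]) :=
  hasFrickeExp_etaQuot (by norm_num) (by decide) (by decide) (by decide +kernel)
    (by decide +kernel) (by norm_num) (by decide +kernel) (by decide +kernel) (by decide +kernel)
    (by decide +kernel) (by decide +kernel)

theorem trivialCharacter_halfShiftExp_12 : TrivialCharacter (ZMod 12) 12 (halfShiftExp 12) :=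
  .of_three_four (by unfold TrivialCharacter; decide +kernel)
    (by unfold TrivialCharacter; decide +kernel)

theorem hasFrickeExp_shift_18 : HasFrickeExp 18 (by norm_num) 12
    (fun τ => (3 : ℕ) * etaQuot 18 (shiftExp) τ) 1
    (eulerQuotList (fun d => (shiftExp) (18 / d)) [1, 2, 3, 6, 9, 18]) :=
  hasFrickeExp_etaQuot (by norm_num) (by decide) (by decide) (by decide +kernel)
    (by decide +kernel) (by norm_num) (by decide +kernel) (by decide +kernel) (by decide +kernel)
    (by decide +kernel) (by decide +kernel)

theorem trivialCharacter_shiftExp : TrivialCharacter (ZMod 12) 18 (shiftExp) :=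
  .of_three_four (by unfold TrivialCharacter; decide +kernel)
    (by unfold TrivialCharacter; decide +kernel)

/-- `t_8` viewed at level `16`, with a double pole at the cusp `0`. Its exponents are even, so it is
invariant and not only up to sign. -/
theorem hasFrickeExp_hauptmodul_8 : HasFrickeExp 16 (by norm_num) 12
    (fun τ => (32 : ℕ) * etaQuot 16 (fun d => 2 * halfHauptExp 8 d) τ) 2
    (eulerQuotList (fun d => (fun d => 2 * halfHauptExp 8 d) (16 / d)) [1, 2, 4, 8, 16]) :=
  hasFrickeExp_etaQuot (by norm_num) (by decide) (by decide) (by decide +kernel)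
    (by decide +kernel) (by norm_num) (by decide +kernel) (by decide +kernel) (by decide +kernel)
    (by decide +kernel) (by decide +kernel)

theorem trivialCharacter_halfHauptExp_8 : TrivialCharacter (ZMod 12) 16 (halfHauptExp 8) :=
  .of_three_four (by unfold TrivialCharacter; decide +kernel)
    (by unfold TrivialCharacter; decide +kernel)

/-- `t_5` viewed at level `25`, where its pole at the cusp `0` has order five. -/
theorem hasFrickeExp_hauptmodul_5 : HasFrickeExp 25 (by norm_num) 12
    (fun τ => (125 : ℕ) * etaQuot 25 (fun d => 2 * halfHauptExp 5 d) τ) 5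
    (eulerQuotList (fun d => (fun d => 2 * halfHauptExp 5 d) (25 / d)) [1, 5, 25]) :=
  hasFrickeExp_etaQuot (by norm_num) (by decide) (by decide) (by decide +kernel)
    (by decide +kernel) (by norm_num) (by decide +kernel) (by decide +kernel) (by decide +kernel)
    (by decide +kernel) (by decide +kernel)

theorem trivialCharacter_halfHauptExp_5 : TrivialCharacter (ZMod 12) 25 (halfHauptExp 5) :=
  .of_three_four (by unfold TrivialCharacter; decide +kernel)
    (by unfold TrivialCharacter; decide +kernel)

theorem shift_eq_6 (τ : ℍ) :
    (9 : ℕ) * etaQuot 6 (fun d => 2 * halfShiftExp 6 d) τ =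
      (72 : ℕ) * etaQuot 6 (hauptExp 6) τ + (9 : ℤ) :=
  hasFrickeExp_shift_6.eq_add_const hasFrickeExp_hauptmodul_6
    (mul_etaQuot_smul (by decide +kernel) trivialCharacter_halfShiftExp_6 _)
    (mul_etaQuot_smul_sq (by decide +kernel) trivialCharacter_hauptExp_6 _)
    9 (by decide +kernel) (by decide +kernel) τ

theorem shift_eq_10 (τ : ℍ) :
    (5 : ℕ) * etaQuot 10 (fun d => 2 * halfShiftExp 10 d) τ =
      (20 : ℕ) * etaQuot 10 (hauptExp 10) τ + (5 : ℤ) :=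
  hasFrickeExp_shift_10.eq_add_const hasFrickeExp_hauptmodul_10
    (mul_etaQuot_smul (by decide +kernel) trivialCharacter_halfShiftExp_10 _)
    (mul_etaQuot_smul_sq (by decide +kernel) trivialCharacter_hauptExp_10 _)
    5 (by decide +kernel) (by decide +kernel) τ

theorem shift_eq_12 (τ : ℍ) :
    (3 : ℕ) * etaQuot 12 (fun d => 2 * halfShiftExp 12 d) τ =
      (12 : ℕ) * etaQuot 12 (hauptExp 12) τ + (3 : ℤ) :=
  hasFrickeExp_shift_12.eq_add_const hasFrickeExp_hauptmodul_12
    (mul_etaQuot_smul (by decide +kernel) trivialCharacter_halfShiftExp_12 _)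
    (mul_etaQuot_smul_sq (by decide +kernel) trivialCharacter_hauptExp_12 _)
    3 (by decide +kernel) (by decide +kernel) τ

end GenusZero

/-! ### Identities proved by eliminating undetermined signs -/

namespace GenusZero

open UpperHalfPlane ModularGroup Matrix Matrix.SpecialLinearGroup Filter Asymptotics
open scoped MatrixGroups Manifold ModularForm

theorem shift_eq_18 (τ : ℍ) : (3 : ℕ) * etaQuot 18 shiftExp τ =
    (6 : ℕ) * etaQuot 18 (hauptExp 18) τ + (3 : ℤ) := by
  have hE := hasFrickeExp_shift_18
  have ht := hasFrickeExp_hauptmodul_18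
  have hc (c : ℤ) (n : ℕ) := (HasFrickeExp.const 18 (by norm_num) 12 c).shift n
  have h1 := (hE.sub ht).add (hc (-3) 1)
  -- Here both `E` and `t` are known only up to sign. These are the remaining factors of `((E - t)²
  -- - 9)((E + t)² - 9)`, a polynomial in `E²` and `t²`.
  have h2 := ((hE.sub ht).add (hc 3 1)).mul
    (((hE.add ht).mul (hE.add ht)).add (hc (-9) 2))
  have hEi := mul_etaQuot_smul_sq (by decide +kernel) trivialCharacter_shiftExp (3 : ℕ)
  have hti := mul_etaQuot_smul_sq (by decide +kernel) trivialCharacter_hauptExp_18 (6 : ℕ)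
  have h := h1.eq_zero h2 (fun γ hγ τ => by
    have e1 := hEi γ hγ τ
    have e2 := hti γ hγ τ
    generalize ((3 : ℕ) : ℂ) * etaQuot 18 shiftExp (γ • τ : ℍ) = a at *
    generalize ((6 : ℕ) : ℂ) * etaQuot 18 (hauptExp 18) (γ • τ : ℍ) = b at *
    generalize ((3 : ℕ) : ℂ) * etaQuot 18 shiftExp τ = a' at *
    generalize ((6 : ℕ) : ℂ) * etaQuot 18 (hauptExp 18) τ = b' at *
    have key (a b : ℂ) : (a - b + (-3 : ℤ)) * ((a - b + (3 : ℤ)) * ((a + b) * (a + b) + (-9 : ℤ))) =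
        (a ^ 2 - b ^ 2) ^ 2 - 18 * (a ^ 2 + b ^ 2) + 81 := by
      push_cast; ring
    rw [key, key, e1, e2]) (by norm_num) (by decide +kernel) (by decide +kernel) τ
  push_cast at h ⊢
  linear_combination h

theorem hauptmodul_8_eq (τ : ℍ) : (32 : ℕ) * etaQuot 16 (fun d => 2 * halfHauptExp 8 d) τ =
    ((8 : ℕ) * etaQuot 16 (hauptExp 16) τ) ^ 2 + 4 * ((8 : ℕ) * etaQuot 16 (hauptExp 16) τ) := by
  have hy := hasFrickeExp_hauptmodul_8
  have hx := hasFrickeExp_hauptmodul_16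
  have hx4 := (HasFrickeExp.const 16 (by norm_num) 12 4).mul (hx.shift 1)
  have h1 := (hy.sub (hx.mul hx)).sub hx4
  -- The conjugate under `x ↦ -x`; the product is `(y - x²)² - 16 x²`.
  have h2 := (hy.sub (hx.mul hx)).add hx4
  have hyi := mul_etaQuot_smul (by decide +kernel) trivialCharacter_halfHauptExp_8 (32 : ℕ)
  have hxi := mul_etaQuot_smul_sq (by decide +kernel) trivialCharacter_hauptExp_16 (8 : ℕ)
  have h := h1.eq_zero h2 (fun γ hγ τ => by
    have e1 := hyi γ hγ τ
    have e2 := hxi γ hγ τ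
    generalize ((32 : ℕ) : ℂ) * etaQuot 16 (fun d => 2 * halfHauptExp 8 d) (γ • τ : ℍ) = a at *
    generalize ((8 : ℕ) : ℂ) * etaQuot 16 (hauptExp 16) (γ • τ : ℍ) = b at *
    generalize ((32 : ℕ) : ℂ) * etaQuot 16 (fun d => 2 * halfHauptExp 8 d) τ = a' at *
    generalize ((8 : ℕ) : ℂ) * etaQuot 16 (hauptExp 16) τ = b' at *
    have key (a b : ℂ) : (a - b * b - (4 : ℤ) * b) * (a - b * b + (4 : ℤ) * b) =
        (a - b ^ 2) ^ 2 - 16 * b ^ 2 := by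
      push_cast; ring
    rw [key, key, e1, e2]) (by norm_num) (by decide +kernel) (by decide +kernel) τ
  push_cast at h ⊢
  linear_combination h

theorem hauptmodul_5_eq (τ : ℍ) : (125 : ℕ) * etaQuot 25 (fun d => 2 * halfHauptExp 5 d) τ =
    u55 ((5 : ℕ) * etaQuot 25 (hauptExp 25) τ) := by
  have hy := hasFrickeExp_hauptmodul_5
  have hx := hasFrickeExp_hauptmodul_25
  have hc (c : ℤ) := HasFrickeExp.const 25 (by norm_num) 12 c
  have hx2 := hx.mul hx
  have hx4 := hx2.mul hx2
  -- Odd part `o` and even part `e` of `u55 x` are separated: `y - o - e` has the conjugate `y + o -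
  -- e`, with product `(y - e)² - o²`.
  have ho := ((hx4.mul hx).add ((hc 15).mul ((hx2.mul hx).shift 2))).add ((hc 25).mul (hx.shift 4))
  have he := ((hc 5).mul (hx4.shift 1)).add ((hc 25).mul (hx2.shift 3))
  have h1 := (hy.sub ho).sub he
  have h2 := (hy.add ho).sub he
  have hyi := mul_etaQuot_smul (by decide +kernel) trivialCharacter_halfHauptExp_5 (125 : ℕ)
  have hxi := mul_etaQuot_smul_sq (by decide +kernel) trivialCharacter_hauptExp_25 (5 : ℕ)
  have h := h1.eq_zero h2 (fun γ hγ τ => by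
    have e1 := hyi γ hγ τ
    have e2 := hxi γ hγ τ
    generalize ((125 : ℕ) : ℂ) * etaQuot 25 (fun d => 2 * halfHauptExp 5 d) (γ • τ : ℍ) = a at *
    generalize ((5 : ℕ) : ℂ) * etaQuot 25 (hauptExp 25) (γ • τ : ℍ) = b at *
    generalize ((125 : ℕ) : ℂ) * etaQuot 25 (fun d => 2 * halfHauptExp 5 d) τ = a' at *
    generalize ((5 : ℕ) : ℂ) * etaQuot 25 (hauptExp 25) τ = b' at *
    have key (a b : ℂ) : (a - (b * b * (b * b) * b + (15 : ℤ) * (b * b * b) + (25 : ℤ) * b) -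
          ((5 : ℤ) * (b * b * (b * b)) + (25 : ℤ) * (b * b))) *
        (a + (b * b * (b * b) * b + (15 : ℤ) * (b * b * b) + (25 : ℤ) * b) -
          ((5 : ℤ) * (b * b * (b * b)) + (25 : ℤ) * (b * b))) =
        (a - 5 * (b ^ 2) ^ 2 - 25 * b ^ 2) ^ 2 - b ^ 2 * ((b ^ 2) ^ 2 + 15 * b ^ 2 + 25) ^ 2 := by
      push_cast; ring
    rw [key, key, e1, e2]) (by norm_num) (by decide +kernel) (by decide +kernel) τ
  rw [u55]
  push_cast at h ⊢
  linear_combination h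

end GenusZero

/-! ### The modular invariant in terms of `t_2` -/

namespace GenusZero

open UpperHalfPlane ModularGroup Matrix Matrix.SpecialLinearGroup Filter Asymptotics
open scoped MatrixGroups Manifold ModularForm

theorem exists_hasExp_E₄ : ∃ G : ℂ → ℂ,
    (∀ τ : ℍ, ModularForm.E₄ τ = G (Function.Periodic.qParam 1 τ)) ∧ HasExp 2 G [1, 240] := by
  refine ⟨cuspFunction 1 ModularForm.E₄, fun τ =>
    (SlashInvariantFormClass.eq_cuspFunction ModularForm.E₄ τ one_mem_strictPeriods_SL
      one_ne_zero).symm, ?_⟩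
  have h := (hasFPowerSeriesOnBall_cuspFunction one_pos
    (ModularFormClass.analyticAt_cuspFunction_zero ModularForm.E₄ one_pos one_mem_strictPeriods_SL)
    fun τ => by
      simpa only [smul_eq_mul] using ModularForm.hasSum_qExpansion (f := ModularForm.E₄) one_pos
        one_mem_strictPeriods_SL τ).hasFPowerSeriesAt.isBigO_sub_partialSum_pow 2
  refine (h.mono nhdsWithin_le_nhds).trans (IsBigO.of_bound 1 (.of_forall fun q => by simp))
    |>.congr_left fun q => ?_
  simp [FormalMultilinearSeries.partialSum, Finset.sum_range_succ,
    EisensteinSeries.E_qExpansion_coeff_zero (show 3 ≤ 4 by norm_num) ⟨2, rfl⟩,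
    ModularForm.E₄_qExpansion_coeff_one]

theorem E₄_smul (γ : SL(2, ℤ)) (τ : ℍ) :
    ModularForm.E₄ (γ • τ) = den γ τ ^ 4 * ModularForm.E₄ τ := by
  exact SlashInvariantForm.slash_action_eqn'' (Γ := 𝒮ℒ) ModularForm.E₄ (γ := mapGL ℝ γ) ⟨γ, rfl⟩ τ

theorem discriminant_smul (γ : SL(2, ℤ)) (τ : ℍ) :
    ModularForm.discriminant (γ • τ) = den γ τ ^ 12 * ModularForm.discriminant τ := by
  have h := eta_smul_sq γ τ
  have hχ : (ZMod.stdAddChar (etaExpSL γ)) ^ 12 = (1 : ℂ) := by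
    rw [← AddChar.map_nsmul_eq_pow, nsmul_eq_mul, ZMod.natCast_self, zero_mul,
      AddChar.map_zero_eq_one]
  have e (z : ℍ) : ModularForm.discriminant z = (ModularForm.eta z ^ 2) ^ 12 := by
    rw [ModularForm.discriminant]; ring
  rw [e, e, h, mul_pow, mul_pow, hχ, one_mul]

theorem j_smul (γ : SL(2, ℤ)) (τ : ℍ) : j (γ • τ) = j τ := by
  have := den_ne_zero γ τ
  have := ModularForm.discriminant_ne_zero τ
  rw [j, j, E₄_smul, discriminant_smul]
  field_simp

/-- `-1 / (2τ) = S(2τ)`, so the behaviour of `j` at the cusp `0` is that of `j(2τ)` at `i∞`. -/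
theorem j_fricke_two (τ : ℍ) : j (fricke 2 (by norm_num) τ) = j (dilate two_ne_zero τ) := by
  have : fricke 2 (by norm_num) τ = S • dilate two_ne_zero τ := by
    ext1
    rw [coe_S_smul, coe_fricke]
    simp [dilate]
  rw [this, j_smul]

theorem mdiff_E₄ : MDiff (fun τ : ℍ => ModularForm.E₄ τ) := ModularFormClass.holo ModularForm.E₄

theorem mdiff_j : MDiff j := by
  have h1 := mdiff_E₄
  have h2 : MDiff (fun τ : ℍ => ModularForm.discriminant τ) :=
    CuspFormClass.holo CuspForm.discriminant
  rw [UpperHalfPlane.mdifferentiable_iff] at *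
  refine (h1.pow 3).div h2 fun z _ => ModularForm.discriminant_ne_zero _

theorem discriminant_eq (τ : ℍ) : ModularForm.discriminant τ =
    Function.Periodic.qParam 1 τ * eulerE (Function.Periodic.qParam 1 τ) ^ 24 := by
  have h := etaMul_eq_eulerE 1 τ
  rw [etaMul, Nat.cast_one, one_mul, pow_one, pow_one] at h
  rw [ModularForm.discriminant, h, mul_pow, ← qParam_one_eq_pow]

theorem hasFrickeExp_hauptmodul_2 : HasFrickeExp 2 (by norm_num) 12
    (fun τ => (4096 : ℕ) * etaQuot 2 (fun d => 2 * halfHauptExp 2 d) τ) 1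
    (eulerQuotList (fun d => (fun d => 2 * halfHauptExp 2 d) (2 / d)) [1, 2]) :=
  hasFrickeExp_etaQuot (by norm_num) (by decide) (by decide) (by decide +kernel)
    (by decide +kernel) (by norm_num) (by decide +kernel) (by decide +kernel) (by decide +kernel)
    (by decide +kernel) (by decide +kernel)

theorem trivialCharacter_halfHauptExp_2 : TrivialCharacter (ZMod 12) 2 (halfHauptExp 2) :=
  .of_three_four (by unfold TrivialCharacter; decide +kernel)
    (by unfold TrivialCharacter; decide +kernel)

/-- The simple zero of `t_2` at `i∞` cancels the simple pole of `j`. -/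
theorem isBoundedAtImInfty_j_mul :
    IsBoundedAtImInfty fun τ => j τ * ((4096 : ℕ) * etaQuot 2 (fun d => 2 * halfHauptExp 2 d) τ) := by
  have hdiv : Nat.divisors 2 = {1, 2} := by decide +kernel
  have e (τ : ℍ) : j τ * ((4096 : ℕ) * etaQuot 2 (fun d => 2 * halfHauptExp 2 d) τ) =
      ModularForm.E₄ τ ^ 3 * (4096 * eulerE (Function.Periodic.qParam 1 τ ^ 2) ^ 24 *
        ((eulerE (Function.Periodic.qParam 1 τ)) ^ 48)⁻¹) := by
    have h1 := etaMul_ne_zero one_ne_zero τ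
    have hq := qParam_one_eq_pow (τ : ℂ)
    have hq0 : Function.Periodic.qParam 24 (τ : ℂ) ≠ 0 := Function.Periodic.qParam_ne_zero _
    rw [etaMul_eq_eulerE, pow_one, pow_one] at h1
    have h2 := right_ne_zero_of_mul h1
    have : etaQuot 2 (fun d => 2 * halfHauptExp 2 d) τ = etaMul 2 τ ^ 24 / etaMul 1 τ ^ 24 := by
      simp only [etaQuot, hdiv, halfHauptExp, Finset.prod_pair (show 1 ≠ 2 by norm_num)]
      rw [div_eq_inv_mul]
      rfl
    rw [this, j, discriminant_eq, etaMul_eq_eulerE, etaMul_eq_eulerE, pow_one, pow_one, hq] at *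
    push_cast
    field_simp
  simp only [e]
  have h4 : IsBoundedAtImInfty fun τ : ℍ => ModularForm.E₄ τ :=
    ModularFormClass.bdd_at_infty ModularForm.E₄
  have h5 := (((tendsto_eulerE_qParam_pow two_ne_zero).pow 24).const_mul 4096).mul
    (((tendsto_eulerE_qParam_pow one_ne_zero).pow 48).inv₀ (by simp))
  simp only [pow_one] at h5
  have h6 : IsBoundedAtImInfty fun τ : ℍ => ModularForm.E₄ τ ^ 3 := by
    simpa only [pow_succ, pow_zero, one_mul] using! (h4.mul h4).mul h4
  exact h6.mul (h5.isBigO_one ℝ)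

/-- `j = (t_2 + 16)³ / t_2`. -/
theorem j_mul_hauptmodul_2 (τ : ℍ) :
    j τ * ((4096 : ℕ) * etaQuot 2 (fun d => 2 * halfHauptExp 2 d) τ) =
      ((4096 : ℕ) * etaQuot 2 (fun d => 2 * halfHauptExp 2 d) τ + 16) ^ 3 := by
  have ht := hasFrickeExp_hauptmodul_2
  have hti := mul_etaQuot_smul (by decide +kernel) trivialCharacter_halfHauptExp_2 (4096 : ℕ)
  set t : ℍ → ℂ := fun τ => (4096 : ℕ) * etaQuot 2 (fun d => 2 * halfHauptExp 2 d) τ with htdef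
  replace hti : ∀ γ : SL(2, ℤ), ((2 : ℕ) : ℤ) ∣ γ 1 0 → ∀ τ, t (γ • τ) = t τ := hti
  change j τ * t τ = (t τ + 16) ^ 3
  -- Precision four is what `E₄ = 1 + 240 q + O(q²)` yields at `2τ`, and it is exactly what the
  -- triple pole of `j t_2` at the cusp `0` requires.
  replace ht : HasFrickeExp 2 (by norm_num) 4 t 1 _ :=
    ⟨ht.mdiff, ht.bounded, ht.exists_hasExp.imp fun F hF => ⟨hF.1, hF.2.mono (by norm_num)⟩⟩
  obtain ⟨G, hG, hGl⟩ := exists_hasExp_E₄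
  have hG2 : HasExp 4 (fun q => G (q ^ 2)) [1, 0, 240, 0] := hGl.expand 1
  have hE := ((hasExp_eulerE_pow two_ne_zero).mono (show 4 ≤ 12 by norm_num)).pow 24
  have hEi := hE.inv (m := [1, 0, 24, 0]) (by norm_num) (by decide +kernel) (by decide +kernel)
  obtain ⟨F, hF, hFl⟩ := ht.exists_hasExp
  have hjt : HasFrickeExp 2 (by norm_num) 4 (fun τ => j τ * t τ) 3
      ((mulList ((mulList (powList 4 [1, 0, 240, 0] 3) [1, 0, 24, 0]).take 4)
        (eulerQuotList (fun d => (fun d => 2 * halfHauptExp 2 d) (2 / d)) [1, 2])).take 4) := by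
    refine ⟨mdiff_mul mdiff_j ht.mdiff, fun γ hγ => ?_, _, fun τ => ?_,
      ((hG2.pow 3).mul hEi).mul hFl⟩
    · have h2 : ((2 : ℕ) : ℤ) ∣ γ 1 0 := by
        by_contra h
        exact hγ ((Int.isCoprime_iff_gcd_eq_one.mpr
          (by rw [Int.gcd_comm]; exact ((Nat.Prime.coprime_iff_not_dvd Nat.prime_two).mpr
            fun h' => h (Int.natCast_dvd.mpr h')))))
      simp only [j_smul, hti γ h2]
      exact isBoundedAtImInfty_j_mul
    · have hq2 : Function.Periodic.qParam 1 (dilate two_ne_zero τ : ℍ) =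
          Function.Periodic.qParam 1 τ ^ 2 := by
        rw [Function.Periodic.qParam, Function.Periodic.qParam, ← Complex.exp_nat_mul]
        simp [dilate]
        ring_nf
      have hq0 : Function.Periodic.qParam 1 (τ : ℂ) ≠ 0 := Function.Periodic.qParam_ne_zero _
      rw [j_fricke_two, j, discriminant_eq, hG, hq2, ← hF]
      field_simp
  have hc (c : ℤ) (n : ℕ) := (HasFrickeExp.const 2 (by norm_num) 4 c).shift n
  have h16 := ht.add (hc 16 1)
  have h1 := hjt.sub ((h16.mul h16).mul h16)
  have h := h1.eq_zero (HasFrickeExp.const 2 (by norm_num) 4 1) (fun γ hγ τ => by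
    simp only [j_smul, hti γ hγ]) (by norm_num) (by decide +kernel) (by decide +kernel) τ
  push_cast at h
  linear_combination h

end GenusZero

/-! ### Relations between the Hauptmoduln -/

namespace GenusZero

open UpperHalfPlane ModularGroup Matrix Matrix.SpecialLinearGroup Filter Asymptotics
open scoped MatrixGroups Manifold ModularForm

theorem fricke_dilate {M N : ℕ} (hM : 0 < M) (hN : N ≠ 0) (h : 0 < N * M) (τ : ℍ) :
    fricke M hM (dilate hN τ) = fricke (N * M) h τ := by
  ext1
  rw [coe_fricke, coe_fricke]
  simp only [dilate, UpperHalfPlane.coe_mk]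
  push_cast
  ring

theorem mul_etaQuot_fricke {L : ℕ} (hL : 0 < L) {r : ℕ → ℤ} (hr0 : ∑ d ∈ L.divisors, r d = 0)
    {κ : ℕ} (hκ : 0 < κ) (hκ2 : (κ : ℚ) ^ 2 * ∏ d ∈ L.divisors, (d : ℚ) ^ r (L / d) = 1) (τ : ℍ) :
    κ * etaQuot L r (fricke L hL τ) = etaQuot L (fun d => r (L / d)) τ := by
  have hκR : (κ : ℝ) ^ 2 * ∏ d ∈ L.divisors, (d : ℝ) ^ r (L / d) = 1 := by
    have := congrArg (fun x : ℚ => (x : ℝ)) hκ2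
    push_cast at this
    exact this
  have hκ0 : (0 : ℝ) < κ := Nat.cast_pos.mpr hκ
  have hκC : (κ : ℂ) ≠ 0 := Nat.cast_ne_zero.mpr hκ.ne'
  rw [etaQuot_fricke hL hr0 (C := (κ : ℝ)⁻¹) (by positivity)
    (by rw [inv_pow]; exact inv_eq_of_mul_eq_one_right hκR)]
  push_cast
  rw [mul_inv_cancel_left₀ hκC]

/-- The constant `κ_N` with `t_N(-1 / (N τ)) t_N(τ) = κ_N`. -/
def frickeConst : ℕ → ℕ
  | 2 => 4096
  | 3 => 729
  | 4 => 256
  | 5 => 125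
  | 6 => 72
  | 8 => 32
  | 9 => 27
  | 10 => 20
  | 12 => 12
  | 16 => 8
  | 18 => 6
  | 25 => 5
  | _ => 0

theorem hauptmodul_eq_2 (τ : ℍ) :
    hauptmodul 2 τ = (frickeConst 2 : ℕ) * etaQuot 2 (hauptExp 2) τ := by
  have h : Nat.divisors 2 = {1, 2} := by decide +kernel
  have h1 := etaMul_ne_zero (show 1 ≠ 0 by norm_num) τ
  simp [etaQuot, h, hauptExp, hauptmodul, frickeConst, _root_.zpow_neg]
  field_simp
  try ring

theorem hauptmodul_eq_3 (τ : ℍ) :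
    hauptmodul 3 τ = (frickeConst 3 : ℕ) * etaQuot 3 (hauptExp 3) τ := by
  have h : Nat.divisors 3 = {1, 3} := by decide +kernel
  have h1 := etaMul_ne_zero (show 1 ≠ 0 by norm_num) τ
  simp [etaQuot, h, hauptExp, hauptmodul, frickeConst, _root_.zpow_neg]
  field_simp
  try ring

theorem hauptmodul_eq_4 (τ : ℍ) :
    hauptmodul 4 τ = (frickeConst 4 : ℕ) * etaQuot 4 (hauptExp 4) τ := by
  have h : Nat.divisors 4 = {1, 2, 4} := by decide +kernel
  have h1 := etaMul_ne_zero (show 1 ≠ 0 by norm_num) τ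
  simp [etaQuot, h, hauptExp, hauptmodul, frickeConst, _root_.zpow_neg]
  field_simp
  try ring

theorem hauptmodul_eq_5 (τ : ℍ) :
    hauptmodul 5 τ = (frickeConst 5 : ℕ) * etaQuot 5 (hauptExp 5) τ := by
  have h : Nat.divisors 5 = {1, 5} := by decide +kernel
  have h1 := etaMul_ne_zero (show 1 ≠ 0 by norm_num) τ
  simp [etaQuot, h, hauptExp, hauptmodul, frickeConst, _root_.zpow_neg]
  field_simp
  try ring

theorem hauptmodul_eq_6 (τ : ℍ) :
    hauptmodul 6 τ = (frickeConst 6 : ℕ) * etaQuot 6 (hauptExp 6) τ := by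
  have h : Nat.divisors 6 = {1, 2, 3, 6} := by decide +kernel
  have h1 := etaMul_ne_zero (show 1 ≠ 0 by norm_num) τ
  have h3 := etaMul_ne_zero (show 3 ≠ 0 by norm_num) τ
  simp [etaQuot, h, hauptExp, hauptmodul, frickeConst, _root_.zpow_neg]
  field_simp
  try ring

theorem hauptmodul_eq_8 (τ : ℍ) :
    hauptmodul 8 τ = (frickeConst 8 : ℕ) * etaQuot 8 (hauptExp 8) τ := by
  have h : Nat.divisors 8 = {1, 2, 4, 8} := by decide +kernel
  have h1 := etaMul_ne_zero (show 1 ≠ 0 by norm_num) τ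
  have h4 := etaMul_ne_zero (show 4 ≠ 0 by norm_num) τ
  simp [etaQuot, h, hauptExp, hauptmodul, frickeConst, _root_.zpow_neg]
  field_simp
  try ring

theorem hauptmodul_eq_9 (τ : ℍ) :
    hauptmodul 9 τ = (frickeConst 9 : ℕ) * etaQuot 9 (hauptExp 9) τ := by
  have h : Nat.divisors 9 = {1, 3, 9} := by decide +kernel
  have h1 := etaMul_ne_zero (show 1 ≠ 0 by norm_num) τ
  simp [etaQuot, h, hauptExp, hauptmodul, frickeConst, _root_.zpow_neg]
  field_simp
  try ring

theorem hauptmodul_eq_10 (τ : ℍ) :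
    hauptmodul 10 τ = (frickeConst 10 : ℕ) * etaQuot 10 (hauptExp 10) τ := by
  have h : Nat.divisors 10 = {1, 2, 5, 10} := by decide +kernel
  have h1 := etaMul_ne_zero (show 1 ≠ 0 by norm_num) τ
  have h5 := etaMul_ne_zero (show 5 ≠ 0 by norm_num) τ
  simp [etaQuot, h, hauptExp, hauptmodul, frickeConst, _root_.zpow_neg]
  field_simp
  try ring

theorem hauptmodul_eq_12 (τ : ℍ) :
    hauptmodul 12 τ = (frickeConst 12 : ℕ) * etaQuot 12 (hauptExp 12) τ := by
  have h : Nat.divisors 12 = {1, 2, 3, 4, 6, 12} := by decide +kernel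
  have h1 := etaMul_ne_zero (show 1 ≠ 0 by norm_num) τ
  have h4 := etaMul_ne_zero (show 4 ≠ 0 by norm_num) τ
  have h6 := etaMul_ne_zero (show 6 ≠ 0 by norm_num) τ
  simp [etaQuot, h, hauptExp, hauptmodul, frickeConst, _root_.zpow_neg]
  field_simp
  try ring

theorem hauptmodul_eq_16 (τ : ℍ) :
    hauptmodul 16 τ = (frickeConst 16 : ℕ) * etaQuot 16 (hauptExp 16) τ := by
  have h : Nat.divisors 16 = {1, 2, 4, 8, 16} := by decide +kernel
  have h1 := etaMul_ne_zero (show 1 ≠ 0 by norm_num) τ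
  have h8 := etaMul_ne_zero (show 8 ≠ 0 by norm_num) τ
  simp [etaQuot, h, hauptExp, hauptmodul, frickeConst, _root_.zpow_neg]
  field_simp
  try ring

theorem hauptmodul_eq_18 (τ : ℍ) :
    hauptmodul 18 τ = (frickeConst 18 : ℕ) * etaQuot 18 (hauptExp 18) τ := by
  have h : Nat.divisors 18 = {1, 2, 3, 6, 9, 18} := by decide +kernel
  have h1 := etaMul_ne_zero (show 1 ≠ 0 by norm_num) τ
  have h6 := etaMul_ne_zero (show 6 ≠ 0 by norm_num) τ
  have h9 := etaMul_ne_zero (show 9 ≠ 0 by norm_num) τ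
  simp [etaQuot, h, hauptExp, hauptmodul, frickeConst, _root_.zpow_neg]
  field_simp
  try ring

theorem hauptmodul_eq_25 (τ : ℍ) :
    hauptmodul 25 τ = (frickeConst 25 : ℕ) * etaQuot 25 (hauptExp 25) τ := by
  have h : Nat.divisors 25 = {1, 5, 25} := by decide +kernel
  have h1 := etaMul_ne_zero (show 1 ≠ 0 by norm_num) τ
  simp [etaQuot, h, hauptExp, hauptmodul, frickeConst, _root_.zpow_neg]
  field_simp
  try ring

theorem hauptmodul_eq {N : ℕ} (hN : N ∈ [2, 3, 4, 5, 6, 8, 9, 10, 12, 16, 18, 25]) (τ : ℍ) :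
    hauptmodul N τ = (frickeConst N : ℕ) * etaQuot N (hauptExp N) τ := by
  fin_cases hN
  · exact hauptmodul_eq_2 τ
  · exact hauptmodul_eq_3 τ
  · exact hauptmodul_eq_4 τ
  · exact hauptmodul_eq_5 τ
  · exact hauptmodul_eq_6 τ
  · exact hauptmodul_eq_8 τ
  · exact hauptmodul_eq_9 τ
  · exact hauptmodul_eq_10 τ
  · exact hauptmodul_eq_12 τ
  · exact hauptmodul_eq_16 τ
  · exact hauptmodul_eq_18 τ
  · exact hauptmodul_eq_25 τ

/-- The exponents of `t_N` change sign under `d ↦ N / d`, so the Fricke involution inverts the eta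
quotient up to a constant. There are no zeros because `η` has none on `ℍ`. -/
theorem hauptmodul_fricke {N : ℕ} (hN : N ∈ [2, 3, 4, 5, 6, 8, 9, 10, 12, 16, 18, 25]) (h0 : 0 < N)
    (τ : ℍ) : hauptmodul N (fricke N h0 τ) * hauptmodul N τ = frickeConst N ∧
      hauptmodul N τ ≠ 0 := by
  have key : (∀ d ∈ N.divisors, hauptExp N (N / d) = -hauptExp N d) ∧
      ∑ d ∈ N.divisors, hauptExp N d = 0 ∧ 0 < frickeConst N ∧
      (frickeConst N : ℚ) ^ 2 * ∏ d ∈ N.divisors, (d : ℚ) ^ hauptExp N (N / d) = 1 := by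
    revert N
    decide +kernel
  obtain ⟨h1, h2, h3, h4⟩ := key
  have hne (r : ℕ → ℤ) : etaQuot N r τ ≠ 0 := Finset.prod_ne_zero_iff.mpr fun d hd =>
    zpow_ne_zero _ (etaMul_ne_zero (Nat.pos_of_mem_divisors hd).ne' τ)
  have h5 : etaQuot N (fun d => hauptExp N (N / d)) τ * etaQuot N (hauptExp N) τ = 1 := by
    rw [etaQuot, etaQuot, ← Finset.prod_mul_distrib]
    refine Finset.prod_eq_one fun d hd => ?_
    rw [h1 d hd, _root_.zpow_neg, inv_mul_cancel₀ (zpow_ne_zero _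
      (etaMul_ne_zero (Nat.pos_of_mem_divisors hd).ne' τ))]
  rw [hauptmodul_eq hN, hauptmodul_eq hN, mul_etaQuot_fricke h0 h2 h3 h4]
  exact ⟨by rw [mul_left_comm, h5, mul_one], mul_ne_zero (Nat.cast_ne_zero.mpr h3.ne') (hne _)⟩

end GenusZero

/-! ### Product formulas for shifted Hauptmoduln -/

namespace GenusZero

open UpperHalfPlane ModularGroup Matrix Matrix.SpecialLinearGroup Filter Asymptotics
open scoped MatrixGroups Manifold ModularForm

theorem hauptmodul_6_add_nine (τ : ℍ) :
    hauptmodul 6 τ + 9 = 9 * ((etaMul 2 τ ^ 4 * etaMul 3 τ ^ 8) / (etaMul 1 τ ^ 8 * etaMul 6 τ ^ 4)) := by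
  have hdiv : Nat.divisors 6 = {1, 2, 3, 6} := by decide +kernel
  have h1 := etaMul_ne_zero (show 1 ≠ 0 by norm_num) τ
  have h6 := etaMul_ne_zero (show 6 ≠ 0 by norm_num) τ
  have h := shift_eq_6 τ
  have ht := hauptmodul_eq_6 τ
  rw [frickeConst] at ht
  rw [← ht] at h
  simp [etaQuot, hdiv, halfShiftExp, _root_.zpow_neg] at h
  rw [← h]
  field_simp

/-- The Fricke image of the formula for `t_6 + 9`, since `t + 8 = t (72 / t + 9) / 9`. The second
formulas at levels `10`, `12`, `18` arise in the same way. -/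
theorem hauptmodul_6_add_eight (τ : ℍ) :
    hauptmodul 6 τ + 8 = 8 * ((etaMul 2 τ ^ 9 * etaMul 3 τ ^ 3) / (etaMul 1 τ ^ 9 * etaMul 6 τ ^ 3)) := by
  have hdiv : Nat.divisors 6 = {1, 2, 3, 6} := by decide +kernel
  have h1 := etaMul_ne_zero (show 1 ≠ 0 by norm_num) τ
  have h2 := etaMul_ne_zero (show 2 ≠ 0 by norm_num) τ
  have h3 := etaMul_ne_zero (show 3 ≠ 0 by norm_num) τ
  have h6 := etaMul_ne_zero (show 6 ≠ 0 by norm_num) τ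
  have h := shift_eq_6 (fricke 6 (by norm_num) τ)
  have ht := hauptmodul_eq_6 (fricke 6 (by norm_num) τ)
  rw [frickeConst] at ht
  rw [mul_etaQuot_fricke (by norm_num) (by decide +kernel) (by norm_num) (by decide +kernel), ← ht] at h
  obtain ⟨h0, h00⟩ := hauptmodul_fricke (N := 6) (by simp) (by norm_num) τ
  simp [etaQuot, hdiv, halfShiftExp, _root_.zpow_neg] at h
  have h2 : hauptmodul 6 τ + 8 =
      hauptmodul 6 τ * (hauptmodul 6 (fricke 6 (by norm_num) τ) + 9) / 9 := by
    rw [mul_add, mul_comm, h0, frickeConst]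
    push_cast
    ring
  rw [h2, ← h, hauptmodul]
  field_simp
  norm_num

theorem hauptmodul_10_add_five (τ : ℍ) :
    hauptmodul 10 τ + 5 = 5 * ((etaMul 2 τ ^ 2 * etaMul 5 τ ^ 4) / (etaMul 1 τ ^ 4 * etaMul 10 τ ^ 2)) := by
  have hdiv : Nat.divisors 10 = {1, 2, 5, 10} := by decide +kernel
  have h10 := etaMul_ne_zero (show 10 ≠ 0 by norm_num) τ
  have h1 := etaMul_ne_zero (show 1 ≠ 0 by norm_num) τ
  have h := shift_eq_10 τ
  have ht := hauptmodul_eq_10 τ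
  rw [frickeConst] at ht
  rw [← ht] at h
  simp [etaQuot, hdiv, halfShiftExp, _root_.zpow_neg] at h
  rw [← h]
  field_simp

theorem hauptmodul_10_add_four (τ : ℍ) :
    hauptmodul 10 τ + 4 = 4 * ((etaMul 2 τ ^ 5 * etaMul 5 τ) / (etaMul 1 τ ^ 5 * etaMul 10 τ)) := by
  have hdiv : Nat.divisors 10 = {1, 2, 5, 10} := by decide +kernel
  have h1 := etaMul_ne_zero (show 1 ≠ 0 by norm_num) τ
  have h2 := etaMul_ne_zero (show 2 ≠ 0 by norm_num) τ
  have h5 := etaMul_ne_zero (show 5 ≠ 0 by norm_num) τ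
  have h10 := etaMul_ne_zero (show 10 ≠ 0 by norm_num) τ
  have h := shift_eq_10 (fricke 10 (by norm_num) τ)
  have ht := hauptmodul_eq_10 (fricke 10 (by norm_num) τ)
  rw [frickeConst] at ht
  rw [mul_etaQuot_fricke (by norm_num) (by decide +kernel) (by norm_num) (by decide +kernel), ← ht] at h
  obtain ⟨h0, h00⟩ := hauptmodul_fricke (N := 10) (by simp) (by norm_num) τ
  simp [etaQuot, hdiv, halfShiftExp, _root_.zpow_neg] at h
  have h2 : hauptmodul 10 τ + 4 =
      hauptmodul 10 τ * (hauptmodul 10 (fricke 10 (by norm_num) τ) + 5) / 5 := by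
    rw [mul_add, mul_comm, h0, frickeConst]
    push_cast
    ring
  rw [h2, ← h, hauptmodul]
  field_simp
  norm_num

theorem hauptmodul_12_add_three (τ : ℍ) :
    hauptmodul 12 τ + 3 = 3 * ((etaMul 2 τ ^ 2 * etaMul 3 τ ^ 4) / (etaMul 1 τ ^ 4 * etaMul 6 τ ^ 2)) := by
  have hdiv : Nat.divisors 12 = {1, 2, 3, 4, 6, 12} := by decide +kernel
  have h1 := etaMul_ne_zero (show 1 ≠ 0 by norm_num) τ
  have h6 := etaMul_ne_zero (show 6 ≠ 0 by norm_num) τ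
  have h := shift_eq_12 τ
  have ht := hauptmodul_eq_12 τ
  rw [frickeConst] at ht
  rw [← ht] at h
  simp [etaQuot, hdiv, halfShiftExp, _root_.zpow_neg] at h
  rw [← h]
  field_simp

theorem hauptmodul_12_add_four (τ : ℍ) :
    hauptmodul 12 τ + 4 = 4 * ((etaMul 3 τ * etaMul 4 τ ^ 3) / (etaMul 1 τ ^ 3 * etaMul 12 τ)) := by
  have hdiv : Nat.divisors 12 = {1, 2, 3, 4, 6, 12} := by decide +kernel
  have h1 := etaMul_ne_zero (show 1 ≠ 0 by norm_num) τ
  have h2 := etaMul_ne_zero (show 2 ≠ 0 by norm_num) τ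
  have h3 := etaMul_ne_zero (show 3 ≠ 0 by norm_num) τ
  have h4 := etaMul_ne_zero (show 4 ≠ 0 by norm_num) τ
  have h6 := etaMul_ne_zero (show 6 ≠ 0 by norm_num) τ
  have h12 := etaMul_ne_zero (show 12 ≠ 0 by norm_num) τ
  have h := shift_eq_12 (fricke 12 (by norm_num) τ)
  have ht := hauptmodul_eq_12 (fricke 12 (by norm_num) τ)
  rw [frickeConst] at ht
  rw [mul_etaQuot_fricke (by norm_num) (by decide +kernel) (by norm_num) (by decide +kernel), ← ht] at h
  obtain ⟨h0, h00⟩ := hauptmodul_fricke (N := 12) (by simp) (by norm_num) τ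
  simp [etaQuot, hdiv, halfShiftExp, _root_.zpow_neg] at h
  have h2 : hauptmodul 12 τ + 4 =
      hauptmodul 12 τ * (hauptmodul 12 (fricke 12 (by norm_num) τ) + 3) / 3 := by
    rw [mul_add, mul_comm, h0, frickeConst]
    push_cast
    ring
  rw [h2, ← h, hauptmodul]
  field_simp
  norm_num

theorem hauptmodul_18_add_three (τ : ℍ) :
    hauptmodul 18 τ + 3 = 3 * ((etaMul 2 τ * etaMul 9 τ ^ 2) / (etaMul 1 τ ^ 2 * etaMul 18 τ)) := by
  have hdiv : Nat.divisors 18 = {1, 2, 3, 6, 9, 18} := by decide +kernel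
  have h18 := etaMul_ne_zero (show 18 ≠ 0 by norm_num) τ
  have h1 := etaMul_ne_zero (show 1 ≠ 0 by norm_num) τ
  have h := shift_eq_18 τ
  have ht := hauptmodul_eq_18 τ
  rw [frickeConst] at ht
  rw [← ht] at h
  simp [etaQuot, hdiv, shiftExp, _root_.zpow_neg] at h
  rw [← h]
  field_simp

theorem hauptmodul_18_add_two (τ : ℍ) :
    hauptmodul 18 τ + 2 = 2 * ((etaMul 2 τ ^ 3 * etaMul 3 τ) / (etaMul 1 τ ^ 3 * etaMul 6 τ)) := by
  have hdiv : Nat.divisors 18 = {1, 2, 3, 6, 9, 18} := by decide +kernel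
  have h1 := etaMul_ne_zero (show 1 ≠ 0 by norm_num) τ
  have h2 := etaMul_ne_zero (show 2 ≠ 0 by norm_num) τ
  have h3 := etaMul_ne_zero (show 3 ≠ 0 by norm_num) τ
  have h6 := etaMul_ne_zero (show 6 ≠ 0 by norm_num) τ
  have h9 := etaMul_ne_zero (show 9 ≠ 0 by norm_num) τ
  have h18 := etaMul_ne_zero (show 18 ≠ 0 by norm_num) τ
  have h := shift_eq_18 (fricke 18 (by norm_num) τ)
  have ht := hauptmodul_eq_18 (fricke 18 (by norm_num) τ)
  rw [frickeConst] at ht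
  rw [mul_etaQuot_fricke (by norm_num) (by decide +kernel) (by norm_num) (by decide +kernel), ← ht] at h
  obtain ⟨h0, h00⟩ := hauptmodul_fricke (N := 18) (by simp) (by norm_num) τ
  simp [etaQuot, hdiv, shiftExp, _root_.zpow_neg] at h
  have h2 : hauptmodul 18 τ + 2 =
      hauptmodul 18 τ * (hauptmodul 18 (fricke 18 (by norm_num) τ) + 3) / 3 := by
    rw [mul_add, mul_comm, h0, frickeConst]
    push_cast
    ring
  rw [h2, ← h, hauptmodul]
  field_simp

end GenusZero

/-! ### The rational maps between the modular curves -/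

namespace GenusZero

open UpperHalfPlane

/-- `t_M(τ) = u(t_L(τ))` and `t_M(Nτ) = v(t_L(τ))`. -/
def IsRow (M N L : ℕ) (u v : ℂ → ℂ) : Prop :=
  ∀ τ : ℍ, hauptmodul M τ = u (hauptmodul L τ) ∧ hauptmodul M (N * (τ : ℂ)) = v (hauptmodul L τ)

theorem IsRow.comp {M N L K L' NK : ℕ} {u v u' v' : ℂ → ℂ} (h : IsRow M N L u v)
    (h' : IsRow L K L' u' v') (hK : K ≠ 0) (hNK : N * K = NK) :
    IsRow M NK L' (u ∘ u') (v ∘ v') := by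
  subst hNK
  intro τ
  refine ⟨by rw [(h τ).1, (h' τ).1]; rfl, ?_⟩
  have h1 := (h (dilate hK τ)).2
  have h2 : ((dilate hK τ : ℍ) : ℂ) = K * τ := rfl
  rw [h2, (h' τ).2, ← mul_assoc] at h1
  push_cast
  exact h1

theorem etaMul_natCast_mul (d N : ℕ) (z : ℂ) : etaMul d (N * z) = etaMul (d * N) z := by
  rw [etaMul, etaMul]
  push_cast
  ring_nf

/-- Levels of the Hauptmoduln that occur in the table. -/
abbrev levels : List ℕ := [2, 3, 4, 5, 6, 8, 9, 10, 12, 16, 18, 25]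

theorem pos_of_mem_levels {M : ℕ} (hM : M ∈ levels) : 0 < M := by
  fin_cases hM <;> norm_num

/-- The level `M` Fricke image of `Nτ` is the level `L` Fricke image of `τ`. Hence `t_M(Nτ) = κ_M /
u(κ_L / t_L(τ))`, and `huv` says that `v` is this conjugate of `u`. The values of `u` concerned are
values of `t_M`, hence nonzero, which is why `huv` may assume this. -/
theorem IsRow.of_left {M N L : ℕ} {u v : ℂ → ℂ} (hM : M ∈ levels) (hL : L ∈ levels) (hN : N ≠ 0)
    (hNM : L = N * M) (hu : ∀ τ : ℍ, hauptmodul M τ = u (hauptmodul L τ))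
    (huv : ∀ t, t ≠ 0 → u (frickeConst L / t) ≠ 0 → u (frickeConst L / t) * v t = frickeConst M) : IsRow M N L u v := by
  subst hNM
  intro τ
  refine ⟨hu τ, ?_⟩
  have hM0 : 0 < M := pos_of_mem_levels hM
  have h0 : 0 < N * M := Nat.mul_pos (Nat.pos_of_ne_zero hN) hM0
  obtain ⟨h1, h2⟩ := hauptmodul_fricke hM hM0 (dilate hN τ)
  obtain ⟨h3, h4⟩ := hauptmodul_fricke hL h0 τ
  have h5 := (hauptmodul_fricke hM hM0 (fricke (N * M) h0 τ)).2
  rw [hu, eq_div_of_mul_eq h4 h3] at h5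
  rw [fricke_dilate hM0 hN h0, hu, eq_div_of_mul_eq h4 h3, ← huv _ h4 h5] at h1
  exact mul_left_cancel₀ h5 h1

theorem IsRow.of_right {M N L : ℕ} {u v : ℂ → ℂ} (hM : M ∈ levels) (hL : L ∈ levels) (hN : N ≠ 0)
    (hNM : L = N * M) (hv : ∀ τ : ℍ, hauptmodul M (N * (τ : ℂ)) = v (hauptmodul L τ))
    (huv : ∀ t, t ≠ 0 → v (frickeConst L / t) ≠ 0 → u t * v (frickeConst L / t) = frickeConst M) : IsRow M N L u v := by
  subst hNM
  intro τ
  refine ⟨?_, hv τ⟩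
  have hM0 : 0 < M := pos_of_mem_levels hM
  have h0 : 0 < N * M := Nat.mul_pos (Nat.pos_of_ne_zero hN) hM0
  obtain ⟨h1, h2⟩ := hauptmodul_fricke hM hM0 τ
  obtain ⟨h3, h4⟩ := hauptmodul_fricke hL h0 τ
  have h6 : (N : ℂ) * (fricke (N * M) h0 τ : ℍ) = (fricke M hM0 τ : ℍ) := by
    rw [coe_fricke, coe_fricke]
    have := ne_zero τ
    have : (N : ℂ) ≠ 0 := Nat.cast_ne_zero.mpr hN
    have : (M : ℂ) ≠ 0 := Nat.cast_ne_zero.mpr hM0.ne'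
    push_cast
    field_simp
  have h7 := hv (fricke (N * M) h0 τ)
  rw [h6, eq_div_of_mul_eq h4 h3] at h7
  have h5 := (hauptmodul_fricke hM hM0 (fricke M hM0 τ)).2
  rw [h7] at h5
  rw [h7, ← huv _ h4 h5, mul_comm] at h1
  exact mul_right_cancel₀ h5 h1

/-- The starting point for powers of two. The map `v82` gives a product formula for `t_16 + 2`, its
square one for `t_8 + 4`, and the descent continues to levels `4` and `2` without new expansions. -/
theorem isRow_8_2 : IsRow 8 2 16 u82 v82 := by
  refine .of_left (by simp) (by simp) two_ne_zero rfl (fun τ => ?_) fun t ht h => ?_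
  · have h := hauptmodul_8_eq τ
    have h16 := hauptmodul_eq_16 τ
    rw [frickeConst] at h16
    rw [← h16] at h
    have h8 : hauptmodul 8 τ =
        ((32 : ℕ) : ℂ) * etaQuot 16 (fun d => 2 * halfHauptExp 8 d) τ := by
      have hdiv : Nat.divisors 16 = {1, 2, 4, 8, 16} := by decide +kernel
      have h1 := etaMul_ne_zero (show 1 ≠ 0 by norm_num) τ
      have h4 := etaMul_ne_zero (show 4 ≠ 0 by norm_num) τ
      simp [etaQuot, hdiv, halfHauptExp, hauptmodul, _root_.zpow_neg]
      field_simp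
      ring
    rw [h8, h, u82]
    ring
  · have e : u82 ((frickeConst 16 : ℕ) / t) = 32 * (t + 2) / t ^ 2 := by
      simp only [u82, frickeConst]
      push_cast
      field_simp
      ring
    rw [e] at h ⊢
    have h2 : t + 2 ≠ 0 := fun h0 => by simp [h0] at h
    rw [v82, frickeConst]
    push_cast
    field_simp

/-- `t_16 + 2 = 2 [2]^6 / ([1]^4 [4]^2)`. -/
theorem hauptmodul_16_add_two (τ : ℍ) :
    hauptmodul 16 τ + 2 = 2 * (etaMul 2 τ ^ 6 / (etaMul 1 τ ^ 4 * etaMul 4 τ ^ 2)) := by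
  have h := (isRow_8_2 τ).2
  have h0 := (hauptmodul_fricke (N := 16) (by simp) (by norm_num) τ).2
  have h2 : hauptmodul 16 τ + 2 ≠ 0 := by
    intro h2
    rw [v82, h2, div_zero] at h
    exact (hauptmodul_fricke (N := 8) (by simp) (by norm_num) (dilate two_ne_zero τ)).2 h
  have h3 : hauptmodul 16 τ + 2 = hauptmodul 16 τ ^ 2 / hauptmodul 8 ((2 : ℕ) * (τ : ℂ)) := by
    rw [h, v82]
    field_simp
  have h1 := etaMul_ne_zero (show 1 ≠ 0 by norm_num) τ
  have h2 := etaMul_ne_zero (show 2 ≠ 0 by norm_num) τ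
  have h4 := etaMul_ne_zero (show 4 ≠ 0 by norm_num) τ
  have h8 := etaMul_ne_zero (show 8 ≠ 0 by norm_num) τ
  have h16 := etaMul_ne_zero (show 16 ≠ 0 by norm_num) τ
  rw [h3]
  simp only [hauptmodul, etaMul_natCast_mul, Nat.reduceMul]
  field_simp

theorem hauptmodul_8_add_four (τ : ℍ) :
    hauptmodul 8 τ + 4 = 4 * (etaMul 2 τ ^ 12 / (etaMul 1 τ ^ 8 * etaMul 4 τ ^ 4)) := by
  rw [(isRow_8_2 τ).1, u82_add_four, hauptmodul_16_add_two]
  ring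

/-- Here `v` is read off from the product formula for `t_8 + 4`, and `u` is recovered by Fricke
duality. -/
theorem isRow_4_2 : IsRow 4 2 8 u42 v42 := by
  refine .of_right (by simp) (by simp) two_ne_zero rfl (fun τ => ?_) fun t ht h => ?_
  · have h1 := etaMul_ne_zero (show 1 ≠ 0 by norm_num) τ
    have h2 := etaMul_ne_zero (show 2 ≠ 0 by norm_num) τ
    have h4 := etaMul_ne_zero (show 4 ≠ 0 by norm_num) τ
    rw [v42, hauptmodul_8_add_four]
    simp only [hauptmodul, etaMul_natCast_mul, Nat.reduceMul]
    field_simp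
    ring
  · have e : v42 ((frickeConst 8 : ℕ) / t) = 256 / (t * (t + 8)) := by
      simp only [v42, frickeConst]
      push_cast
      -- At `t = -8` both sides are a division by zero, hence `0`.
      by_cases h8 : t + 8 = 0
      · have : 32 / t + 4 = 0 := by
          rw [eq_neg_of_add_eq_zero_left h8]; norm_num
        rw [this, h8]
        simp
      have : 32 / t + 4 = 4 * (t + 8) / t := by field_simp; ring
      rw [this]
      field_simp
      norm_num
    rw [e] at h ⊢
    have h2 : t + 8 ≠ 0 := fun h0 => by simp [h0] at h
    rw [u42, frickeConst]
    push_cast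
    field_simp

theorem hauptmodul_4_add_sixteen (τ : ℍ) :
    hauptmodul 4 τ + 16 = 16 * (etaMul 2 τ ^ 24 / (etaMul 1 τ ^ 16 * etaMul 4 τ ^ 8)) := by
  rw [(isRow_4_2 τ).1, u42_add_sixteen, hauptmodul_8_add_four]
  ring

theorem isRow_2_2 : IsRow 2 2 4 u22 v22 := by
  intro τ
  have h1 := etaMul_ne_zero (show 1 ≠ 0 by norm_num) τ
  have h2 := etaMul_ne_zero (show 2 ≠ 0 by norm_num) τ
  have h4 := etaMul_ne_zero (show 4 ≠ 0 by norm_num) τ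
  rw [u22, v22, hauptmodul_4_add_sixteen]
  simp only [hauptmodul, etaMul_natCast_mul, Nat.reduceMul]
  constructor <;> field_simp <;> norm_num

/-- Every linear factor of `u` and `v` is an eta quotient, so both relations compare monomials in
eta functions. -/
theorem isRow_2_3 : IsRow 2 3 6 u23 v23 := by
  intro τ
  have h1 := etaMul_ne_zero (show 1 ≠ 0 by norm_num) τ
  have h2 := etaMul_ne_zero (show 2 ≠ 0 by norm_num) τ
  have h3 := etaMul_ne_zero (show 3 ≠ 0 by norm_num) τ
  have h6 := etaMul_ne_zero (show 6 ≠ 0 by norm_num) τ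
  rw [u23, v23, hauptmodul_6_add_nine, hauptmodul_6_add_eight]
  simp only [hauptmodul, etaMul_natCast_mul, Nat.reduceMul]
  constructor <;> field_simp <;> norm_num

theorem isRow_3_2 : IsRow 3 2 6 u32 v32 := by
  intro τ
  have h1 := etaMul_ne_zero (show 1 ≠ 0 by norm_num) τ
  have h2 := etaMul_ne_zero (show 2 ≠ 0 by norm_num) τ
  have h3 := etaMul_ne_zero (show 3 ≠ 0 by norm_num) τ
  have h6 := etaMul_ne_zero (show 6 ≠ 0 by norm_num) τ
  rw [u32, v32, hauptmodul_6_add_nine, hauptmodul_6_add_eight]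
  simp only [hauptmodul, etaMul_natCast_mul, Nat.reduceMul]
  constructor <;> field_simp <;> norm_num

theorem isRow_2_5 : IsRow 2 5 10 u25 v25 := by
  intro τ
  have h1 := etaMul_ne_zero (show 1 ≠ 0 by norm_num) τ
  have h2 := etaMul_ne_zero (show 2 ≠ 0 by norm_num) τ
  have h5 := etaMul_ne_zero (show 5 ≠ 0 by norm_num) τ
  have h10 := etaMul_ne_zero (show 10 ≠ 0 by norm_num) τ
  rw [u25, v25, hauptmodul_10_add_five, hauptmodul_10_add_four]
  simp only [hauptmodul, etaMul_natCast_mul, Nat.reduceMul]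
  constructor <;> field_simp <;> norm_num

theorem isRow_5_2 : IsRow 5 2 10 u52 v52 := by
  intro τ
  have h1 := etaMul_ne_zero (show 1 ≠ 0 by norm_num) τ
  have h2 := etaMul_ne_zero (show 2 ≠ 0 by norm_num) τ
  have h5 := etaMul_ne_zero (show 5 ≠ 0 by norm_num) τ
  have h10 := etaMul_ne_zero (show 10 ≠ 0 by norm_num) τ
  rw [u52, v52, hauptmodul_10_add_five, hauptmodul_10_add_four]
  simp only [hauptmodul, etaMul_natCast_mul, Nat.reduceMul]
  constructor <;> field_simp <;> norm_num

theorem isRow_4_3 : IsRow 4 3 12 u43 v43 := by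
  intro τ
  have h1 := etaMul_ne_zero (show 1 ≠ 0 by norm_num) τ
  have h2 := etaMul_ne_zero (show 2 ≠ 0 by norm_num) τ
  have h3 := etaMul_ne_zero (show 3 ≠ 0 by norm_num) τ
  have h4 := etaMul_ne_zero (show 4 ≠ 0 by norm_num) τ
  have h6 := etaMul_ne_zero (show 6 ≠ 0 by norm_num) τ
  have h12 := etaMul_ne_zero (show 12 ≠ 0 by norm_num) τ
  rw [u43, v43, hauptmodul_12_add_three, hauptmodul_12_add_four]
  simp only [hauptmodul, etaMul_natCast_mul, Nat.reduceMul]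
  constructor <;> field_simp <;> norm_num

theorem isRow_9_2 : IsRow 9 2 18 u92 v92 := by
  intro τ
  have h1 := etaMul_ne_zero (show 1 ≠ 0 by norm_num) τ
  have h2 := etaMul_ne_zero (show 2 ≠ 0 by norm_num) τ
  have h3 := etaMul_ne_zero (show 3 ≠ 0 by norm_num) τ
  have h6 := etaMul_ne_zero (show 6 ≠ 0 by norm_num) τ
  have h9 := etaMul_ne_zero (show 9 ≠ 0 by norm_num) τ
  have h18 := etaMul_ne_zero (show 18 ≠ 0 by norm_num) τ
  rw [u92, v92, hauptmodul_18_add_three, hauptmodul_18_add_two]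
  simp only [hauptmodul, etaMul_natCast_mul, Nat.reduceMul]
  constructor <;> field_simp

/-- The product formulas show `t_6 + 9 = (t_12 + 3)²`; Fricke duality supplies `v`. -/
theorem isRow_6_2 : IsRow 6 2 12 u62 v62 := by
  refine .of_left (by simp) (by simp) (by norm_num) rfl (fun τ => ?_) fun t ht h => ?_
  · have h := hauptmodul_6_add_nine τ
    have h2 : hauptmodul 6 τ + 9 = (hauptmodul 12 τ + 3) ^ 2 := by
      rw [h, hauptmodul_12_add_three]
      ring
    rw [u62]
    linear_combination h2
  · have e : u62 ((frickeConst 12 : ℕ) / t) = 72 * (t + 2) / t ^ 2 := by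
      simp only [u62, frickeConst]
      push_cast
      field_simp
      ring
    rw [e] at h ⊢
    have h2 : t + 2 ≠ 0 := fun h0 => by simp [h0] at h
    rw [v62, frickeConst]
    push_cast
    rw [div_mul_div_comm, div_eq_iff (mul_ne_zero (pow_ne_zero _ ht) h2)]
    ring

/-- The cubic analogue is `t_6 + 8 = (t_18 + 2)³`. -/
theorem isRow_6_3 : IsRow 6 3 18 u63 v63 := by
  refine .of_left (by simp) (by simp) (by norm_num) rfl (fun τ => ?_) fun t ht h => ?_
  · have h2 : hauptmodul 6 τ + 8 = (hauptmodul 18 τ + 2) ^ 3 := by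
      rw [hauptmodul_6_add_eight, hauptmodul_18_add_two]
      ring
    rw [u63]
    linear_combination h2
  · have e : u63 ((frickeConst 18 : ℕ) / t) = 72 * (t ^ 2 + 3 * t + 3) / t ^ 3 := by
      simp only [u63, frickeConst]
      push_cast
      field_simp
      ring
    rw [e] at h ⊢
    have h2 : t ^ 2 + 3 * t + 3 ≠ 0 := fun h0 => by simp [h0] at h
    rw [v63, frickeConst]
    push_cast
    rw [div_mul_div_comm, div_eq_iff (mul_ne_zero (pow_ne_zero _ ht) h2)]
    ring

/-- No identity of level `9` is needed: over `t_18` one has `u33 ∘ u92 = u32 ∘ u63`, and the other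
three maps are already known. -/
theorem isRow_3_3 : IsRow 3 3 9 u33 v33 := by
  refine .of_left (by simp) (by simp) (by norm_num) rfl (fun τ => ?_) fun t ht h => ?_
  · have h2 : hauptmodul 18 τ + 2 ≠ 0 := by
      intro h
      have h9 := (isRow_9_2 τ).1
      rw [u92, h, div_zero] at h9
      exact (hauptmodul_fricke (N := 9) (by simp) (by norm_num) τ).2 h9
    rw [(isRow_9_2 τ).1, u33_u92 h2, ← (isRow_6_3 τ).1, ← (isRow_3_2 τ).1]
  · have e : u33 ((frickeConst 9 : ℕ) / t) = 729 * (t ^ 2 + 9 * t + 27) / t ^ 3 := by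
      simp only [u33, frickeConst]
      push_cast
      field_simp
      ring
    rw [e] at h ⊢
    have h2 : t ^ 2 + 9 * t + 27 ≠ 0 := fun h0 => by simp [h0] at h
    rw [v33, frickeConst]
    push_cast
    rw [div_mul_div_comm, div_eq_iff (mul_ne_zero (pow_ne_zero _ ht) h2)]
    ring

theorem isRow_5_5 : IsRow 5 5 25 u55 v55 := by
  refine .of_left (by simp) (by simp) (by norm_num) rfl (fun τ => ?_) fun t ht h => ?_
  · have hdiv : Nat.divisors 25 = {1, 5, 25} := by decide +kernel
    have h5 : hauptmodul 5 τ =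
        ((125 : ℕ) : ℂ) * etaQuot 25 (fun d => 2 * halfHauptExp 5 d) τ := by
      have h1 := etaMul_ne_zero (show 1 ≠ 0 by norm_num) τ
      simp [etaQuot, hdiv, halfHauptExp, hauptmodul, _root_.zpow_neg]
      field_simp
      ring
    have h25 := hauptmodul_eq_25 τ
    rw [frickeConst] at h25
    rw [h5, hauptmodul_5_eq, ← h25]
  · have e : u55 ((frickeConst 25 : ℕ) / t) = 125 * (t ^ 4 + 5 * t ^ 3 + 15 * t ^ 2 + 25 * t + 25) / t ^ 5 := by
      simp only [u55, frickeConst]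
      push_cast
      field_simp
      ring
    rw [e] at h ⊢
    have h2 : t ^ 4 + 5 * t ^ 3 + 15 * t ^ 2 + 25 * t + 25 ≠ 0 := fun h0 => by simp [h0] at h
    rw [v55, frickeConst]
    push_cast
    rw [div_mul_div_comm, div_eq_iff (mul_ne_zero (pow_ne_zero _ ht) h2)]
    ring

end GenusZero

/-! ### The table of rational maps, and the covering of the `j`-line -/

namespace GenusZero

open UpperHalfPlane Filter Polynomial

theorem TableRow.isRow {M N L : ℕ} {u v m : ℂ → ℂ} (h : TableRow M N u v m) (hL : N * M = L) :
    IsRow M N L u v := by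
  cases h <;> norm_num at hL <;> subst hL
  · exact isRow_2_2
  · exact isRow_2_3
  · exact isRow_2_2.comp isRow_4_2 (by norm_num) rfl
  · exact isRow_2_5
  · exact isRow_2_3.comp isRow_6_2 (by norm_num) rfl
  · exact isRow_2_2.comp isRow_4_3 (by norm_num) rfl
  · exact isRow_2_2.comp (isRow_4_2.comp isRow_8_2 (by norm_num) (show _ = 4 by rfl)) (by norm_num) rfl
  · exact isRow_2_3.comp isRow_6_3 (by norm_num) rfl
  · exact isRow_3_2
  · exact isRow_3_3
  · exact isRow_3_2.comp isRow_6_2 (by norm_num) rfl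
  · exact isRow_3_3.comp isRow_9_2 (by norm_num) rfl
  · exact isRow_3_2.comp isRow_6_3 (by norm_num) rfl
  · exact isRow_4_2
  · exact isRow_4_3
  · exact isRow_4_2.comp isRow_8_2 (by norm_num) rfl
  · exact isRow_5_2
  · exact isRow_5_5
  · exact isRow_6_2
  · exact isRow_6_3
  · exact isRow_8_2
  · exact isRow_9_2

theorem j_mul_hauptmodul_two (τ : ℍ) : j τ * hauptmodul 2 τ = (hauptmodul 2 τ + 16) ^ 3 := by
  have h : hauptmodul 2 τ = ((4096 : ℕ) : ℂ) * etaQuot 2 (fun d => 2 * halfHauptExp 2 d) τ := by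
    have hdiv : Nat.divisors 2 = {1, 2} := by decide +kernel
    have h1 := etaMul_ne_zero one_ne_zero τ
    simp [etaQuot, hdiv, halfHauptExp, hauptmodul, _root_.zpow_neg]
    field_simp
    ring
  rw [h, j_mul_hauptmodul_2]

theorem hauptmodul_ne_zero {N : ℕ} (hN : N ∈ levels) (τ : ℍ) : hauptmodul N τ ≠ 0 :=
  (hauptmodul_fricke hN (pos_of_mem_levels hN) τ).2

theorem hauptmodul_6_add_eight_ne_zero (τ : ℍ) : hauptmodul 6 τ + 8 ≠ 0 := fun h => by
  have h2 := (isRow_2_3 τ).1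
  rw [u23, h] at h2
  exact hauptmodul_ne_zero (N := 2) (by simp) τ (by simpa using h2)

theorem hauptmodul_6_add_nine_ne_zero (τ : ℍ) : hauptmodul 6 τ + 9 ≠ 0 := fun h => by
  have h2 := (isRow_2_3 τ).1
  rw [u23, h, div_zero] at h2
  exact hauptmodul_ne_zero (by simp) τ h2

/-- Transferred from `t_2` through `t_6`, over which both `t_2` and `t_3` are rational. -/
theorem j_mul_hauptmodul_three (τ : ℍ) : j τ * hauptmodul 3 τ =
    (hauptmodul 3 τ + 27) * (hauptmodul 3 τ + 3) ^ 3 := by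
  have h := j_mul_hauptmodul_two τ
  have h0 := hauptmodul_ne_zero (N := 6) (by simp) τ
  have h8 := hauptmodul_6_add_eight_ne_zero τ
  have h9 := hauptmodul_6_add_nine_ne_zero τ
  rw [(isRow_2_3 τ).1, u23] at h
  rw [(isRow_3_2 τ).1, u32]
  generalize hauptmodul 6 τ = t at *
  have h' : j τ = (t * (t + 8) ^ 3 / (t + 9) + 16) ^ 3 / (t * (t + 8) ^ 3 / (t + 9)) := by
    rw [eq_div_iff (by positivity), h]
  rw [h']
  field_simp
  ring

theorem j_mul_hauptmodul_five (τ : ℍ) : j τ * hauptmodul 5 τ =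
    (hauptmodul 5 τ ^ 2 + 10 * hauptmodul 5 τ + 5) ^ 3 := by
  have h := j_mul_hauptmodul_two τ
  have h0 := hauptmodul_ne_zero (N := 10) (by simp) τ
  have h2 := hauptmodul_ne_zero (N := 2) (by simp) τ
  have h3 := hauptmodul_ne_zero (N := 5) (by simp) τ
  rw [(isRow_2_5 τ).1, u25] at h h2
  rw [(isRow_5_2 τ).1, u52] at h3 ⊢
  generalize hauptmodul 10 τ = t at *
  have h4 : t + 4 ≠ 0 := fun h4 => by simp [h4] at h3
  have h5 : t + 5 ≠ 0 := fun h5 => by simp [h5] at h3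
  have h' : j τ = (t * (t + 4) ^ 5 / (t + 5) + 16) ^ 3 / (t * (t + 4) ^ 5 / (t + 5)) := by
    rw [eq_div_iff h2, h]
  rw [h']
  field_simp
  ring

theorem isCovering_cover {M : ℕ} (hM : M ∈ [2, 3, 4, 5, 6, 8, 9]) :
    IsCovering M (coverP M) (coverQ M) := by
  refine ⟨isCoprime_cover M, fun τ => ?_⟩
  have h2 := j_mul_hauptmodul_two τ
  have h3 := j_mul_hauptmodul_three τ
  have h4 := (isRow_2_2 τ).1
  fin_cases hM
  all_goals simp only [coverP, coverQ, eval_add, eval_mul, eval_pow, eval_X, eval_ofNat]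
  · exact h2
  · exact h3
  · rw [h4, u22] at h2
    exact h2
  · exact j_mul_hauptmodul_five τ
  · have h9 := hauptmodul_6_add_nine_ne_zero τ
    rw [(isRow_2_3 τ).1, u23] at h2
    field_simp at h2
    linear_combination h2
  · rw [h4, (isRow_4_2 τ).1, u22, u42] at h2
    exact h2
  · rw [(isRow_3_3 τ).1, u33] at h3
    exact h3

theorem coverP_ne_zero {M : ℕ} (hM : M ∈ [2, 3, 4, 5, 6, 8, 9]) : coverP M ≠ 0 := by
  have key (h : (coverP M).eval 0 ≠ 0) : coverP M ≠ 0 := fun h0 => h (by rw [h0, eval_zero])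
  fin_cases hM
  exacts [key eval_zero_coverP_2, key eval_zero_coverP_3, key eval_zero_coverP_4,
    key eval_zero_coverP_5, key eval_zero_coverP_6, key eval_zero_coverP_8, key eval_zero_coverP_9]

theorem tendsto_hauptmodul {N : ℕ} (hN : N ∈ levels) :
    Tendsto (fun τ : ℍ => hauptmodul N τ) atImInfty (𝓝 0) := by
  have hm : ∑ d ∈ N.divisors, d * hauptExp N d = 24 * 1 := by
    revert N
    decide +kernel
  have h1 : Tendsto (fun τ : ℍ => ∏ d ∈ N.divisors,
      eulerE (Function.Periodic.qParam 1 τ ^ d) ^ hauptExp N d) atImInfty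
        (𝓝 (∏ d ∈ N.divisors, 1 ^ hauptExp N d)) :=
    tendsto_finsetProd _ fun d hd =>
      (tendsto_eulerE_qParam_pow (Nat.pos_of_mem_divisors hd).ne').zpow₀ _ (Or.inl one_ne_zero)
  have h2 := ((qParam_tendsto_atImInfty one_pos).mul h1).const_mul (frickeConst N : ℂ)
  rw [zero_mul, mul_zero] at h2
  refine h2.congr fun τ => ?_
  rw [hauptmodul_eq hN, etaQuot_eq_qParam_mul hm, zpow_one]

/-- The values are nonzero yet tend to `0` at `i∞`, whereas a finite set without `0` stays away from
`0`. -/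
theorem infinite_range_hauptmodul {N : ℕ} (hN : N ∈ levels) :
    (Set.range fun τ : ℍ => hauptmodul N τ).Infinite := by
  intro hfin
  have h0 : (0 : ℂ) ∉ Set.range fun τ : ℍ => hauptmodul N τ := by
    rintro ⟨τ, h⟩
    exact hauptmodul_ne_zero hN τ h
  obtain ⟨τ, hτ⟩ := ((tendsto_hauptmodul hN).eventually
    (hfin.isClosed.isOpen_compl.mem_nhds h0)).exists
  exact hτ ⟨τ, rfl⟩

theorem exists_tableRow {M N : ℕ} (hM : 1 < M) (hN : 1 < N) (hgM : genus M = 0)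
    (hgNM : genus (N * M) = 0) : M ∈ [2, 3, 4, 5, 6, 8, 9] ∧ ∃ u v m, TableRow M N u v m := by
  have h1 := genus_eq_zero hgM
  have h2 := genus_eq_zero hgNM
  -- `M ≥ 2`, and the largest level of genus zero is `25`.
  have hN13 : N < 13 := by
    by_contra h
    have h3 : 26 ≤ N * M := by nlinarith
    simp only [List.mem_cons, List.not_mem_nil, or_false] at h2
    omega
  have key : ∀ M ∈ [1, 2, 3, 4, 5, 6, 7, 8, 9, 10, 12, 13, 16, 18, 25], 1 < M → ∀ N < 13, 1 < N ∧
      N * M ∈ [1, 2, 3, 4, 5, 6, 7, 8, 9, 10, 12, 13, 16, 18, 25] →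
      (M, N) ∈ [(2, 2), (2, 3), (2, 4), (2, 5), (2, 6), (2, 8), (2, 9), (3, 2), (3, 3), (3, 4),
        (3, 6), (4, 2), (4, 3), (4, 4), (5, 2), (5, 5), (6, 2), (6, 3), (8, 2), (9, 2)] := by
    decide +kernel
  have h3 := key M h1 hM N hN13 ⟨hN, h2⟩
  simp only [List.mem_cons, Prod.mk.injEq, List.not_mem_nil, or_false] at h3
  rcases h3 with ⟨rfl, rfl⟩ | ⟨rfl, rfl⟩ | ⟨rfl, rfl⟩ | ⟨rfl, rfl⟩ | ⟨rfl, rfl⟩ | ⟨rfl, rfl⟩ |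
    ⟨rfl, rfl⟩ | ⟨rfl, rfl⟩ | ⟨rfl, rfl⟩ | ⟨rfl, rfl⟩ | ⟨rfl, rfl⟩ | ⟨rfl, rfl⟩ | ⟨rfl, rfl⟩ |
    ⟨rfl, rfl⟩ | ⟨rfl, rfl⟩ | ⟨rfl, rfl⟩ | ⟨rfl, rfl⟩ | ⟨rfl, rfl⟩ | ⟨rfl, rfl⟩ | ⟨rfl, rfl⟩
  all_goals exact ⟨by simp, _, _, _, by constructor⟩

end GenusZero

theorem mainTheorem2 (M N : ℕ) (hM : 1 < M) (hN : 1 < N)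
    (hgM : GenusZero.genus M = 0) (hgNM : GenusZero.genus (N * M) = 0) :
    (∃ P Q : Polynomial ℂ, GenusZero.IsCovering M P Q) ∧
    (∃ u v m : ℂ → ℂ, GenusZero.TableRow M N u v m) ∧
    ∀ u v m : ℂ → ℂ, GenusZero.TableRow M N u v m →
      (∀ τ : ℍ,
        GenusZero.hauptmodul M τ = u (GenusZero.hauptmodul (N * M) τ) ∧
        GenusZero.hauptmodul M (N * (τ : ℂ)) = v (GenusZero.hauptmodul (N * M) τ)) ∧
      ∀ P Q : Polynomial ℂ, GenusZero.IsCovering M P Q →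
        ∀ᶠ t in 𝓝 (0 : ℂ), GenusZero.hFun P Q (u t) = m t * GenusZero.hFun P Q (v t) := by
  obtain ⟨hM', hrow⟩ := GenusZero.exists_tableRow hM hN hgM hgNM
  have hcover := GenusZero.isCovering_cover hM'
  refine ⟨⟨_, _, hcover⟩, hrow, fun u v m h => ⟨h.isRow rfl, fun P Q hPQ => ?_⟩⟩
  rw [hPQ.hFun_eq hcover (GenusZero.coverP_ne_zero hM') (GenusZero.infinite_range_hauptmodul (by
    fin_cases hM' <;> simp))]
  exact h.eventually_hFun_cover
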